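/- Let $F_0\subsetneq F_1\subsetneq F_2\subsetneq\cdots$ be a sequence of function fields over $\mathbb F_q$, each with full constant field $\mathbb F_q$ and with every $F_{j}/F_{j-1}$ finite and separable, and let $x_0,x_1,\dots$ be elements transcendental over $\mathbb F_q$ such that $F_0=\mathbb F_q(x_0)$ and $F_j=F_{j-1}(x_j)$ for $j\ge 1$. Put $m_j=[F_j:F_{j-1}]$. Fix $i\ge 2$ and put $m=m_1\cdots m_i$, $\widetilde m=m_1\cdots m_{i-1}$ and $h_j=[F_i:\mathbb F_q(x_j)]$. Let $S$ be a set of $s>0$ rational places of $F_0$, each of which splits completely in $F_i/F_0$ (has exactly $[F_i:F_0]$ places of $F_i$ above it), let $\mathcal B$ be the set of places of $F_i$ lying over places in $S$, and assume that no $Q\in\mathcal B$ is a pole of any of $x_1,\dots,x_i$. Let $D$ be a divisor of $F_0$ of degree $l$ with $\operatorname{Supp}(D)\cap S=\emptyset$, let $\{f_w\}$ be a basis of the Riemann–Roch space $\mathcal L(D)$, let $\ell(D)=\dim\mathcal L(D)$, and let $V\subseteq F_i$ be the $\mathbb F_q$-span of the functions $$f_w\,x_1^{e_1}\cdots x_i^{e_i},\qquad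 0\le e_j\le m_j-1\ (1\le j\le i-1),\quad 0\le e_i\le m_i-2 .$$ Then the following hold. 1. $\mathcal B$ is finite, $n:=|\mathcal B|=ms$, every $Q\in\mathcal B$ is rational and is not a pole of any $f\in V$, and so the evaluation map $f\mapsto (f(Q))_{Q\in\mathcal B}$ from $V$ to $\mathbb F_q^{\mathcal B}\cong\mathbb F_q^{n}$ is well defined. Let $\mathcal C$ be its image. 2. There are exactly $\widetilde m s$ places $R$ of $F_{i-1}$ over places in $S$, and the sets $A_R=\{Q: Q\cap F_{i-1}=R\}$ partition $\mathcal B$ into $\widetilde m s$ subsets of size $m_i$ each. 3. If $x_i$ takes pairwise distinct values at the $m_i$ places of $A_R$, then for every codeword $c\in\mathcal C$ and every $Q\in A_R$ the symbol $c_Q$ is recovered by polynomial interpolation through the other positions of $A_R$: there is exactly one polynomial $g$ over $\mathbb F_q$ of degree less than $m_i-1$ with $g(x_i(Q'))=c_{Q'}$ for all $Q'\in A_R\setminus\{Q\}$, and $c_Q=g(x_i(Q))$. If this holds for all the sets $A_R$ (the interpolation nodes are distinct), then $\mathcal C$ is a locally recoverable code with locality $m_i-1$: for every coordinate there are at most $m_i-1$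 other coordinates which determine it in every codeword. 4. Suppose that $d_0:=n-lm-\sum_{j=1}^{i-1}(m_j-1)h_j-(m_i-2)h_i$ is positive. Then $$\dim\mathcal C=\ell(D)\,(m_i-1)\,m_{i-1}\cdots m_1\ \ge\ (l+1)(m_i-1)\,m_{i-1}\cdots m_1,$$ and, if $\mathcal C\ne 0$, its minimum distance $d$ satisfies $d\ge d_0$. -/

import Mathlib

open scoped IntermediateField Polynomial

/-! ### Places of a function field -/

/-- A place of `F/K`, given by its valuation ring `K ⊆ O ⊊ F`.
The place as a set is the maximal ideal of `O`. -/
@[ext]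
structure Place (K F : Type*) [Field K] [Field F] [Algebra K F] where
  ring : ValuationSubring F
  algebraMap_mem : ∀ a : K, algebraMap K F a ∈ ring
  ne_top : ring ≠ ⊤

namespace Place

variable {K F E : Type*} [Field K] [Field F] [Field E] [Algebra K F] [Algebra K E]

instance instAlgebraRing (P : Place K F) : Algebra K P.ring :=
  RingHom.toAlgebra
    { toFun := fun a => ⟨algebraMap K F a, P.algebraMap_mem a⟩
      map_one' := Subtype.ext (map_one _)
      map_mul' := fun _ _ => Subtype.ext (map_mul _ _ _)
      map_zero' := Subtype.ext (map_zero _)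
      map_add' := fun _ _ => Subtype.ext (map_add _ _ _) }

/-- The degree of a place: the degree of its residue class field over `K`. -/
noncomputable def degree (P : Place K F) : ℕ :=
  Module.finrank K (IsLocalRing.ResidueField P.ring)

/-- `f` has a pole at `P`, that is `ν_P(f) < 0`, that is `f` is not in the valuation ring. -/
def IsPole (P : Place K F) (f : F) : Prop := f ∉ P.ring

/-- `f(P) = a`: the residue class of `f` modulo `P` is the constant `a`,
that is `f - a` lies in the maximal ideal of the valuation ring. -/
def HasValue (P : Place K F) (f : F) (a : K) : Prop :=
  P.ring.valuation (f - algebraMap K F a) < 1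

/-- The value `f(P)` as an element of `K` (meaningful when `P` is rational and not a pole
of `f`). -/
noncomputable def value (P : Place K F) (f : F) : K :=
  Classical.epsilon (P.HasValue f)

/-- `t` is a uniformizer at `P`: it generates the maximal ideal of the valuation ring. -/
def IsUniformizer (P : Place K F) (t : P.ring) : Prop :=
  IsLocalRing.maximalIdeal P.ring = Ideal.span {t}

/-- `Q` lies over `P`, that is `Q ∩ F = P`, with respect to an embedding `F → E`. -/
def LiesOver (φ : F →ₐ[K] E) (Q : Place K E) (P : Place K F) : Prop :=
  Q.ring.comap φ.toRingHom = P.ring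

end Place

/-! ### Divisors -/

/-- Divisors: finite formal sums of places with integer coefficients. -/
abbrev PlaceDivisor (K F : Type*) [Field K] [Field F] [Algebra K F] := Place K F →₀ ℤ

namespace PlaceDivisor

variable {K F : Type*} [Field K] [Field F] [Algebra K F]

/-- The degree `∑ n_P deg P` of the divisor `∑ n_P P`. -/
noncomputable def deg (D : PlaceDivisor K F) : ℤ := D.sum fun P n => n * (P.degree : ℤ)

/-- The Riemann-Roch space `L(D) = {f | f = 0 or ν_P(f) ≥ - n_P for all P}` of `D = ∑ n_P P`.
With `t` a uniformizer at `P`, the condition `ν_P(f) ≥ - n_P` says that `f * t ^ n_P`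
is in the valuation ring. -/
def riemannRochSpace (D : PlaceDivisor K F) : Submodule K F where
  carrier := {f | ∀ (P : Place K F) (t : P.ring), P.IsUniformizer t →
    f * (t : F) ^ (D P) ∈ P.ring}
  zero_mem' := fun P t _ => by rw [zero_mul]; exact P.ring.zero_mem
  add_mem' := fun {f g} hf hg P t ht => by
    rw [add_mul]; exact P.ring.add_mem _ _ (hf P t ht) (hg P t ht)
  smul_mem' := fun c f hf P t ht => by
    rw [Algebra.smul_def, mul_assoc]
    exact P.ring.mul_mem _ _ (P.algebraMap_mem c) (hf P t ht)

end PlaceDivisor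

/-! ### Linear codes with coordinates indexed by `ι` -/

section Codes

variable {K ι : Type*} [Field K]

/-- The number of non-zero entries of a word. -/
noncomputable def wordWeight (c : ι → K) : ℕ := (Function.support c).ncard

/-- The minimum distance: the least weight of a non-zero codeword (for a code `C ≠ 0`). -/
noncomputable def minDistance (C : Submodule K (ι → K)) : ℕ :=
  sInf {w | ∃ c ∈ C, c ≠ 0 ∧ w = wordWeight c}

/-- `C` has locality `r`: for every coordinate `a` there are at most `r` other coordinates
whose entries determine the entry at `a` of every codeword. -/
def IsLocallyRecoverable (C : Submodule K (ι → K)) (r : ℕ) : Prop :=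
  ∀ a : ι, ∃ R : Finset ι, a ∉ R ∧ R.card ≤ r ∧
    ∀ c ∈ C, ∀ c' ∈ C, (∀ b ∈ R, c b = c' b) → c a = c' a

/-- The evaluation code of a space `V` of functions at a set `B` of places: the words
`(f(Q))_{Q ∈ B}` with `f ∈ V`. -/
def evalCode {F : Type*} [Field F] [Algebra K F] (V : Submodule K F) (B : Set (Place K F)) :
    Submodule K (B → K) where
  carrier := {c | ∃ f ∈ V, ∀ Q : B, Q.1.HasValue f (c Q)}
  zero_mem' := ⟨0, V.zero_mem, fun Q => by simp [Place.HasValue]⟩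
  add_mem' := by
    rintro c c' ⟨f, hf, h⟩ ⟨f', hf', h'⟩
    refine ⟨f + f', V.add_mem hf hf', fun Q => ?_⟩
    have e : f + f' - algebraMap K F ((c + c') Q)
        = (f - algebraMap K F (c Q)) + (f' - algebraMap K F (c' Q)) := by
      rw [Pi.add_apply, map_add]; ring
    unfold Place.HasValue
    rw [e]
    exact Valuation.map_add_lt _ (h Q) (h' Q)
  smul_mem' := by
    rintro a c ⟨f, hf, h⟩
    refine ⟨a • f, V.smul_mem a hf, fun Q => ?_⟩
    have e : a • f - algebraMap K F ((a • c) Q)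
        = algebraMap K F a * (f - algebraMap K F (c Q)) := by
      rw [Pi.smul_apply, smul_eq_mul, map_mul, Algebra.smul_def]; ring
    unfold Place.HasValue
    rw [e, map_mul]
    exact lt_of_le_of_lt (mul_le_of_le_one_left'
      ((ValuationSubring.valuation_le_one_iff _ _).2 (Q.1.algebraMap_mem a))) (h Q)

end Codes

/-! ### Sequences of function fields -/

/-- A sequence `F 0 ⊊ F 1 ⊊ F 2 ⊊ ⋯` of function fields over `K` with full constant field `K`,
where `F 0 = K(x 0)` is a rational function field, `F (j+1) = F j (x (j+1))`, every step is
finite and separable, and every `x j` is transcendental over `K`. The fields are subfields of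
a common overfield `Ω` (for example of their union). -/
structure FunctionFieldSequence (K Ω : Type*) [Field K] [Field Ω] [Algebra K Ω] where
  F : ℕ → IntermediateField K Ω
  x : ℕ → Ω
  transcendental : ∀ j, Transcendental K (x j)
  zero_eq : F 0 = K⟮x 0⟯
  succ_eq : ∀ j, F (j + 1) = (IntermediateField.adjoin (F j) {x (j + 1)}).restrictScalars K
  lt_succ : ∀ j, F j < F (j + 1)
  finite : ∀ j, FiniteDimensional (F j) (IntermediateField.extendScalars (lt_succ j).le)
  separable : ∀ j, Algebra.IsSeparable (F j) (IntermediateField.extendScalars (lt_succ j).le)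
  constants : ∀ j, ∀ z ∈ F j, IsAlgebraic K z → z ∈ Set.range (algebraMap K Ω)

namespace FunctionFieldSequence

variable {K Ω : Type*} [Field K] [Field Ω] [Algebra K Ω] (T : FunctionFieldSequence K Ω)

theorem F_mono {j i : ℕ} (h : j ≤ i) : T.F j ≤ T.F i :=
  monotone_nat_of_le_succ (fun k => (T.lt_succ k).le) h

theorem x_mem_self (j : ℕ) : T.x j ∈ T.F j := by
  cases j with
  | zero => rw [T.zero_eq]; exact IntermediateField.mem_adjoin_simple_self K _
  | succ k =>
    rw [T.succ_eq k, IntermediateField.mem_restrictScalars]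
    exact IntermediateField.mem_adjoin_simple_self (T.F k) _

/-- The function `x j` as an element of `F i`, for `j ≤ i`. -/
def gen {j i : ℕ} (h : j ≤ i) : T.F i := ⟨T.x j, T.F_mono h (T.x_mem_self j)⟩

/-- `m_j = [F_j : F_{j-1}]`, for `j ≥ 1`. -/
noncomputable def m (j : ℕ) : ℕ := IntermediateField.relfinrank (T.F (j - 1)) (T.F j)

/-- `h_j = [F_i : K(x_j)]`, for `j ≤ i`. -/
noncomputable def h (i j : ℕ) : ℕ := IntermediateField.relfinrank K⟮T.x j⟯ (T.F i)

/-- The place `Q` of `F i` lies over the place `P` of `F j`. -/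
def Over {j i : ℕ} (hji : j ≤ i) (Q : Place K (T.F i)) (P : Place K (T.F j)) : Prop :=
  Q.LiesOver (IntermediateField.inclusion (T.F_mono hji)) P

/-- `P` splits completely in `F i / F 0`: there are exactly `[F i : F 0]` places over `P`. -/
def SplitsCompletely (i : ℕ) (P : Place K (T.F 0)) : Prop :=
  {Q : Place K (T.F i) | T.Over (Nat.zero_le i) Q P}.ncard
    = IntermediateField.relfinrank (T.F 0) (T.F i)

/-- The set of the places of `F i` that lie over a place in `S`. -/
def placesAbove (i : ℕ) (S : Finset (Place K (T.F 0))) : Set (Place K (T.F i)) :=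
  {Q | ∃ P ∈ S, T.Over (Nat.zero_le i) Q P}

/-- The set of the places of `F i` that lie over a place `R` of `F (i-1)`. -/
def fibre (i : ℕ) (R : Place K (T.F (i - 1))) : Set (Place K (T.F i)) :=
  {Q | T.Over (Nat.sub_le i 1) Q R}

/-- The function `x_1 ^ e_1 ⋯ x_i ^ e_i` in `F i`. -/
def monomial (i : ℕ) (e : ℕ → ℕ) : T.F i :=
  ∏ j : Fin i, T.gen (Nat.succ_le_of_lt j.2) ^ e (j + 1)

/-- The span of the functions `f_w x_1 ^ e_1 ⋯ x_i ^ e_i` with `e_i ≤ m_i - 2` and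
`e_j ≤ m_j - 1` for `1 ≤ j < i`. -/
def codeSpace (i : ℕ) {κ : Type*} (f : κ → T.F 0) : Submodule K (T.F i) :=
  Submodule.span K
    {g | ∃ (w : κ) (e : ℕ → ℕ), e i ≤ T.m i - 2 ∧
      (∀ j ∈ Finset.Icc 1 (i - 1), e j ≤ T.m j - 1) ∧
      g = IntermediateField.inclusion (T.F_mono (Nat.zero_le i)) (f w) * T.monomial i e}

end FunctionFieldSequence

/-! The code is controlled by one count: if its domain of evaluation is B, a nonzero f in V has at
most n - d₀ zeros on B. When d₀ > 0 this makes evaluation injective on V, so dim C = dim V, and it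
bounds every nonzero weight below by d₀.

The count rests on two inequalities, expressed by `colength`, the K-dimension of O_Q/(a), which
plays the role of order times degree. First, the colengths of y at its zeros sum to at most [F :
K(y)] (`finite_and_sum_colength_le`). This is a case of the fundamental inequality
`finrank_pi_quotient_le`: by weak approximation, K-independent elements of a product of residue
rings lift to functions, and these stay independent over the subfield. Second, if the poles of g are
bounded by Σ a_j (y_j)_∞, then [F : K(g)] ≤ Σ a_j [F : K(y_j)] (`finrank_adjoin_le_of_poles`). This
is asymptotic: a basis of F/K(g) times the powers g^0, ..., g^k fills a space whose dimension is at
most k Σ a_j [F : K(y_j)] + O(1).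

On F_0 = K(x_0) the space L(D) is z⁻¹ times the polynomials in x_0 of degree at most l
(`exists_mul_eq_aeval`), so fz has poles at most l (x_0)_∞ + Σ a_j (x_j)_∞. But z is not a unit over
x_0 = ∞, which may belong to S. Hence `card_zeros_le` works with g = (fz)^d p(x_0)^(-l), where p has
degree d and no root in K: at the places in question the order of g is d times that of f, both
degree bounds carry the factor d, and d cancels.

For dim V, the powers x_j^e with e < m_j are independent over F_{j-1}, so the spanning products are
independent over K (`finrank_codeSpace`).

For locality, complete splitting is equality in the fundamental inequality, which makes all places
over S rational and all fibres of size m_i (`SplitsCompletely.ncard_fibre`). On the fibre over R a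
function from F_{i-1} has the single value it takes at R, so f is there a polynomial in x_i of
degree at most m_i - 2, determined by its values at m_i - 1 distinct nodes
(`exists_eval_of_mem_codeSpace`). -/

/-! ### Elementary properties of places -/

/-- Every transcendental element generates a subfield of finite index: `F/K` is an extension of
transcendence degree at most one that is finite over the subfields `K(y)`. -/
def FiniteOverTranscendentals (K F : Type*) [Field K] [Field F] [Algebra K F] : Prop :=
  ∀ y : F, Transcendental K y → FiniteDimensional K⟮y⟯ F

namespace Place

variable {K F : Type*} [Field K] [Field F] [Algebra K F] (P : Place K F)

/-- The valuation attached to a place. -/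
noncomputable abbrev v : Valuation F P.ring.ValueGroup := P.ring.valuation

variable {P} in
theorem v_le_one_iff {a : F} : P.v a ≤ 1 ↔ a ∈ P.ring := P.ring.valuation_le_one_iff a

variable {P} in
theorem one_lt_v_iff {a : F} : 1 < P.v a ↔ a ∉ P.ring := by
  rw [← v_le_one_iff, not_le]

variable {P} in
theorem v_lt_one_iff {a : F} : P.v a < 1 ↔ a = 0 ∨ a⁻¹ ∉ P.ring := by
  rw [← P.ring.mem_nonunits_iff, P.ring.mem_nonunits_iff_or]

theorem v_algebraMap_le (a : K) : P.v (algebraMap K F a) ≤ 1 :=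
  v_le_one_iff.2 (P.algebraMap_mem a)

theorem v_algebraMap {a : K} (ha : a ≠ 0) : P.v (algebraMap K F a) = 1 := by
  refine le_antisymm (P.v_algebraMap_le a) ?_
  have h := P.v_algebraMap_le a⁻¹
  rw [map_inv₀, map_inv₀] at h
  have h0 : 0 < P.v (algebraMap K F a) := by
    rw [zero_lt_iff]; simpa using ha
  exact (inv_le_one₀ h0).1 h

variable {P} in
theorem eq_zero_of_v_algebraMap_lt {a : K} (h : P.v (algebraMap K F a) < 1) : a = 0 := by
  by_contra ha
  exact h.ne (P.v_algebraMap ha)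

variable {P} in
theorem aeval_mem {a : F} (ha : a ∈ P.ring) (p : K[X]) : Polynomial.aeval a p ∈ P.ring := by
  rw [Polynomial.aeval_eq_sum_range]
  refine sum_mem fun k _ => ?_
  rw [Algebra.smul_def]
  exact mul_mem (P.algebraMap_mem _) (pow_mem ha _)

variable {P} in
theorem aeval_sub_coeff_zero {a : F} (ha : P.v a < 1) (p : K[X]) :
    P.v (Polynomial.aeval a p - algebraMap K F (p.coeff 0)) < 1 := by
  have h : Polynomial.aeval a p - algebraMap K F (p.coeff 0)
      = Polynomial.aeval a p.divX * a := by
    conv_lhs => rw [← p.divX_mul_X_add]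
    simp
  rw [h, map_mul]
  exact mul_lt_one_of_nonneg_of_lt_one_right (v_le_one_iff.2 (aeval_mem (v_le_one_iff.1 ha.le) _))
    zero_le ha

variable {P} in
theorem v_eq_one_of_sub_lt {a b : F} (hb : P.v b = 1) (h : P.v (a - b) < 1) : P.v a = 1 := by
  have := P.v.map_add_eq_of_lt_right (x := a - b) (y := b) (by rwa [hb])
  rwa [sub_add_cancel, hb] at this

variable {P} in
theorem v_aeval_eq_one {a : F} (ha : P.v a < 1) {p : K[X]} (hp : p.coeff 0 ≠ 0) :
    P.v (Polynomial.aeval a p) = 1 :=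
  v_eq_one_of_sub_lt (P.v_algebraMap hp) (aeval_sub_coeff_zero ha p)

-- Split off the exact power of the variable: the cofactor has nonzero constant term, hence is a
-- unit at P. This is what makes elements of positive order transcendental and the value group
-- archimedean.
variable {P} in
theorem v_aeval_eq_pow {a : F} (ha : P.v a < 1) {p : K[X]} (hp : p ≠ 0) :
    ∃ s : ℕ, P.v (Polynomial.aeval a p) = P.v a ^ s := by
  obtain ⟨q, hq, hq'⟩ := Polynomial.exists_eq_pow_rootMultiplicity_mul_and_not_dvd p hp 0
  refine ⟨p.rootMultiplicity 0, ?_⟩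
  have h0 : q.coeff 0 ≠ 0 := by
    intro h
    apply hq'
    rw [Polynomial.dvd_iff_isRoot, Polynomial.IsRoot.def, ← Polynomial.coeff_zero_eq_eval_zero, h]
  conv_lhs => rw [hq]
  simp [v_aeval_eq_one ha h0]

variable {P} in
theorem transcendental_of_v_lt_one {a : F} (ha : P.v a < 1) (h0 : a ≠ 0) :
    Transcendental K a := by
  intro halg
  obtain ⟨p, hp, hp0⟩ := halg
  obtain ⟨s, hs⟩ := v_aeval_eq_pow ha hp
  rw [hp0, map_zero] at hs
  exact pow_ne_zero s ((P.v.ne_zero_iff).2 h0) hs.symm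

variable {P} in
theorem v_algebraMap_eq_one_of_isAlgebraic {a : F} (ha : IsAlgebraic K a) : a ∈ P.ring := by
  by_contra h
  have h1 : P.v a⁻¹ < 1 := by
    rw [map_inv₀]; exact inv_lt_one_of_one_lt₀ (one_lt_v_iff.2 h)
  have h0 : a ≠ 0 := by rintro rfl; exact h P.ring.zero_mem
  exact transcendental_of_v_lt_one h1 (inv_ne_zero h0) ha.inv

/-- The values at a place are archimedean. -/
theorem exists_pow_le (hF : FiniteOverTranscendentals K F) {a b : F} (ha : P.v a < 1)
    (hb : b ≠ 0) : ∃ k : ℕ, P.v a ^ k ≤ P.v b := by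
  rcases eq_or_ne a 0 with rfl | ha0
  · exact ⟨1, by simp⟩
  by_cases hbr : b ∈ P.ring
  swap
  · exact ⟨0, by rw [pow_zero]; exact (one_lt_v_iff.2 hbr).le⟩
  have htr := transcendental_of_v_lt_one ha ha0
  have := hF a htr
  have halg : IsAlgebraic K⟮a⟯ b := Algebra.IsAlgebraic.isAlgebraic b
  open scoped IntermediateField.algebraAdjoinAdjoin in
  have halg' : IsAlgebraic (Algebra.adjoin K {a}) b :=
    (IsFractionRing.isAlgebraic_iff (Algebra.adjoin K {a}) K⟮a⟯ F).2 halg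
  -- In an equation for b over K[a] with nonzero constant term, that term is b times an integral
  -- element up to sign. Its value, a power of v a, is therefore at most v b.
  obtain ⟨q, hq0, hq⟩ := halg'.exists_nonzero_coeff_and_aeval_eq_zero
    (mem_nonZeroDivisors_of_ne_zero hb)
  have hmem : ∀ c : Algebra.adjoin K {a}, (c : F) ∈ P.ring := by
    rintro ⟨c, hc⟩
    rw [Algebra.adjoin_singleton_eq_range_aeval] at hc
    obtain ⟨p, rfl⟩ := hc
    exact aeval_mem (v_le_one_iff.1 ha.le) p
  have key : -((q.coeff 0 : Algebra.adjoin K {a}) : F) = Polynomial.aeval b q.divX * b := by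
    have h := hq
    rw [← q.divX_mul_X_add] at h
    simp only [map_add, map_mul, Polynomial.aeval_X, Polynomial.aeval_C] at h
    rw [eq_comm, ← sub_eq_zero, sub_neg_eq_add]
    exact h
  obtain ⟨c, hc⟩ : ∃ c : Algebra.adjoin K {a}, c = q.coeff 0 := ⟨_, rfl⟩
  obtain ⟨c, hcm⟩ := c
  rw [← hc] at hq0 key
  have hcm' := hcm
  rw [Algebra.adjoin_singleton_eq_range_aeval] at hcm'
  obtain ⟨p, rfl⟩ := hcm'
  have hp : p ≠ 0 := by
    rintro rfl
    exact hq0 (by ext; simp)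
  obtain ⟨s, hs⟩ := v_aeval_eq_pow ha hp
  refine ⟨s, ?_⟩
  rw [← hs]
  have hv := congrArg P.v key
  rw [Valuation.map_neg, map_mul] at hv
  change P.v (Polynomial.aeval a p) = _ at hv
  rw [hv]
  refine mul_le_of_le_one_left' (v_le_one_iff.2 ?_)
  rw [Polynomial.aeval_eq_sum_range]
  refine sum_mem fun k _ => ?_
  rw [Algebra.smul_def]
  exact mul_mem (hmem _) (pow_mem hbr _)

/-! ### Weak approximation -/

/-- Valuation rings of places are maximal. If O_Q ⊆ O_P and b lies in O_P but not in O_Q, then for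
every a some a b^(-k) lies in O_Q by the archimedean property; multiplying back by b^k inside O_P
gives a ∈ O_P, so O_P would be everything. -/
theorem exists_not_mem_and_mem (hF : FiniteOverTranscendentals K F) {P Q : Place K F}
    (h : P ≠ Q) : ∃ b, b ∈ Q.ring ∧ b ∉ P.ring := by
  by_contra! hle
  apply h
  apply Place.ext
  refine le_antisymm ?_ hle
  intro b hb
  by_contra hbQ
  have hb0 : b ≠ 0 := by rintro rfl; exact hbQ Q.ring.zero_mem
  have hv : Q.v b⁻¹ < 1 := by
    rw [map_inv₀]; exact inv_lt_one_of_one_lt₀ (one_lt_v_iff.2 hbQ)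
  obtain ⟨a, ha⟩ : ∃ a, a ∉ P.ring := by
    by_contra! hall
    exact P.ne_top (top_le_iff.1 fun x _ => hall x)
  have ha0 : a ≠ 0 := by rintro rfl; exact ha P.ring.zero_mem
  obtain ⟨k, hk⟩ := Q.exists_pow_le hF hv (inv_ne_zero ha0)
  apply ha
  have h1 : a * (b⁻¹) ^ k ∈ Q.ring := by
    rw [← v_le_one_iff, map_mul, map_pow]
    calc Q.v a * Q.v b⁻¹ ^ k ≤ Q.v a * Q.v a⁻¹ := by gcongr
      _ = 1 := by rw [← map_mul, mul_inv_cancel₀ ha0, map_one]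
  have h2 := P.ring.mul_mem _ _ (hle _ h1) (pow_mem hb k)
  rwa [mul_assoc, ← mul_pow, inv_mul_cancel₀ hb0, one_pow, mul_one] at h2

theorem exists_pole_and_zero (hF : FiniteOverTranscendentals K F) {P Q : Place K F}
    (h : P ≠ Q) : ∃ b, 1 < P.v b ∧ Q.v b < 1 := by
  obtain ⟨a, haQ, haP⟩ := exists_not_mem_and_mem hF h
  obtain ⟨b, hbP, hbQ⟩ := exists_not_mem_and_mem hF h.symm
  have hb0 : b ≠ 0 := by rintro rfl; exact hbQ Q.ring.zero_mem
  rw [← v_le_one_iff] at haQ hbP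
  rw [← one_lt_v_iff] at haP hbQ
  have hbP0 : 0 < P.v b := by rw [zero_lt_iff]; simpa using hb0
  refine ⟨a / b, ?_, ?_⟩
  · rw [map_div₀, one_lt_div₀ hbP0]
    exact hbP.trans_lt haP
  · rw [map_div₀, div_lt_one₀ (zero_lt_one.trans hbQ)]
    exact haQ.trans_lt hbQ

theorem exists_pow_mul_lt_one (hF : FiniteOverTranscendentals K F) (T : Finset (Place K F))
    {a : F} (ha : ∀ Q ∈ T, Q.v a < 1) (b : Place K F → F) (hb : ∀ Q, b Q ≠ 0) :
    ∃ k : ℕ, ∀ Q ∈ T, ∀ n, k ≤ n → Q.v a ^ n < Q.v (b Q) := by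
  classical
  induction T using Finset.induction_on with
  | empty => exact ⟨0, by simp⟩
  | insert Q T hQ ih =>
    obtain ⟨k, hk⟩ := ih fun Q' h => ha Q' (Finset.mem_insert_of_mem h)
    have hQa := ha Q (Finset.mem_insert_self _ _)
    obtain ⟨k', hk'⟩ := Q.exists_pow_le hF hQa (hb Q)
    refine ⟨max k (k' + 1), fun Q' hQ' n hn => ?_⟩
    rcases Finset.mem_insert.1 hQ' with rfl | h
    · rcases eq_or_ne a 0 with rfl | ha0
      · rw [map_zero, zero_pow (by have := le_max_right k (k' + 1); omega), zero_lt_iff]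
        simpa using hb Q'
      have h0 : 0 < Q'.v a := by rw [zero_lt_iff]; simpa using ha0
      refine lt_of_lt_of_le ?_ hk'
      exact pow_lt_pow_right_of_lt_one₀ h0 hQa (by have := le_max_right k (k' + 1); omega)
    · exact hk Q' h n ((le_max_left _ _).trans hn)

theorem exists_pole_and_zeros (hF : FiniteOverTranscendentals K F) (P : Place K F)
    (T : Finset (Place K F)) (hP : P ∉ T) : ∃ a, 1 < P.v a ∧ ∀ Q ∈ T, Q.v a < 1 := by
  classical
  induction T using Finset.induction_on with
  | empty =>
    by_contra! hall
    exact P.ne_top (top_le_iff.1 fun x _ => v_le_one_iff.1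
      (not_lt.1 fun h => by simpa using hall x h))
  | insert Q T hQ ih =>
    obtain ⟨a, haP, haT⟩ := ih fun h => hP (Finset.mem_insert_of_mem h)
    obtain ⟨b, hbP, hbQ⟩ := exists_pole_and_zero hF (P := P) (Q := Q)
      (fun h => hP (h ▸ Finset.mem_insert_self _ _))
    have hb0 : b ≠ 0 := by rintro rfl; simp at hbP
    obtain ⟨k, hk⟩ := exists_pow_mul_lt_one hF T haT (fun _ => b⁻¹) (fun _ => inv_ne_zero hb0)
    have hT : ∀ Q' ∈ T, ∀ n, k ≤ n → Q'.v (a ^ n * b) < 1 := fun Q' hQ' n hn => by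
      have := hk Q' hQ' n hn
      have hpos : 0 < Q'.v b := by rw [zero_lt_iff]; simpa using hb0
      rw [map_mul, map_pow]
      calc Q'.v a ^ n * Q'.v b < Q'.v b⁻¹ * Q'.v b := by gcongr
        _ = 1 := by rw [← map_mul, inv_mul_cancel₀ hb0, map_one]
    -- b has a pole at P and a zero at Q; a multiplier must make it small on T without spoiling
    -- either. A power of a serves if a is integral at Q. If a has a pole at Q, then a^n/(1 + a^n)
    -- serves: it has value 1 at the poles of a and is as small as a^n at its zeros.
    by_cases haQ : Q.v a ≤ 1
    · refine ⟨a ^ k * b, ?_, fun Q' hQ' => ?_⟩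
      · rw [map_mul, map_pow]
        exact hbP.trans_le (le_mul_of_one_le_left zero_le (one_le_pow₀ haP.le))
      · rcases Finset.mem_insert.1 hQ' with rfl | h
        · rw [map_mul, map_pow]
          exact mul_lt_one_of_nonneg_of_lt_one_right (pow_le_one₀ zero_le haQ) zero_le hbQ
        · exact hT Q' h k le_rfl
    · push Not at haQ
      have hone : ∀ R : Place K F, 1 < R.v a → R.v (a ^ (k + 1) / (1 + a ^ (k + 1))) = 1 := by
        intro R hR
        have h1 : 1 < R.v (a ^ (k + 1)) := by
          rw [map_pow]; exact one_lt_pow₀ hR (by omega)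
        rw [map_div₀, R.v.map_add_eq_of_lt_right (by rwa [map_one]),
          div_self (zero_lt_one.trans h1).ne']
      refine ⟨a ^ (k + 1) / (1 + a ^ (k + 1)) * b, ?_, fun Q' hQ' => ?_⟩
      · rwa [map_mul, hone P haP, one_mul]
      · rcases Finset.mem_insert.1 hQ' with rfl | h
        · rwa [map_mul, hone Q' haQ, one_mul]
        · have h1 : Q'.v (1 + a ^ (k + 1)) = 1 := by
            rw [Q'.v.map_add_eq_of_lt_left, map_one]
            rw [map_one, map_pow]
            exact pow_lt_one₀ zero_le (haT Q' h) (by omega)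
          rw [div_mul_eq_mul_div, map_div₀, h1, div_one]
          exact hT Q' h _ (Nat.le_succ k)

/-- If a has a pole at P and zeros on T, the functions a^n/(1 + a^n) tend to 1 at P and to 0 on T.
-/
theorem exists_near_one (hF : FiniteOverTranscendentals K F) (P : Place K F)
    (T : Finset (Place K F)) (hP : P ∉ T) (b : Place K F → F) (hb : ∀ Q, b Q ≠ 0) :
    ∃ e, P.v (e - 1) ≤ P.v (b P) ∧ ∀ Q ∈ T, Q.v e ≤ Q.v (b Q) := by
  obtain ⟨a, haP, haT⟩ := exists_pole_and_zeros hF P T hP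
  have ha0 : a ≠ 0 := by rintro rfl; simp at haP
  have haP' : P.v a⁻¹ < 1 := by rw [map_inv₀]; exact inv_lt_one_of_one_lt₀ haP
  obtain ⟨k, hk⟩ := exists_pow_mul_lt_one hF T haT b hb
  obtain ⟨k', hk'⟩ := exists_pow_mul_lt_one hF {P} (a := a⁻¹) (by simpa using haP') b hb
  have hk' := hk' P (Finset.mem_singleton_self P)
  set n := max k k' + 1 with hn
  have hPn : 1 < P.v (a ^ n) := by rw [map_pow]; exact one_lt_pow₀ haP (by omega)
  have h1 : P.v (1 + a ^ n) = P.v (a ^ n) :=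
    P.v.map_add_eq_of_lt_right (by rwa [map_one])
  have hne : 1 + a ^ n ≠ 0 := by
    intro h
    rw [h, map_zero] at h1
    exact (zero_lt_one.trans hPn).ne h1
  refine ⟨a ^ n / (1 + a ^ n), ?_, fun Q hQ => ?_⟩
  · have e : a ^ n / (1 + a ^ n) - 1 = - (1 + a ^ n)⁻¹ := by field_simp; ring
    rw [e, Valuation.map_neg, map_inv₀, h1, ← map_inv₀, ← inv_pow, map_pow]
    exact (hk' n (by have := le_max_right k k'; omega)).le
  · have h1 : Q.v (1 + a ^ n) = 1 := by
      rw [Q.v.map_add_eq_of_lt_left, map_one]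
      rw [map_one, map_pow]
      exact pow_lt_one₀ zero_le (haT Q hQ) (by omega)
    rw [map_div₀, h1, div_one, map_pow]
    exact (hk Q hQ n (by have := le_max_left k k'; omega)).le

/-- Weak approximation for finitely many places. -/
theorem exists_approx (hF : FiniteOverTranscendentals K F) (T : Finset (Place K F))
    (u b : Place K F → F) (hb : ∀ Q, b Q ≠ 0) :
    ∃ x, ∀ Q ∈ T, Q.v (x - u Q) ≤ Q.v (b Q) := by
  classical
  -- The tolerance is divided by the target u P in advance, so that it is met after e P is
  -- multiplied by u P. A zero target needs no correction.
  have hc : ∀ P ∈ T, ∃ e, P.v (e - 1) ≤ P.v (b P * (if u P = 0 then 1 else (u P)⁻¹)) ∧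
      ∀ Q ∈ T.erase P, Q.v e ≤ Q.v (b Q * (if u P = 0 then 1 else (u P)⁻¹)) := fun P hP =>
    exists_near_one hF P (T.erase P) (Finset.notMem_erase P T)
      (fun Q => b Q * (if u P = 0 then 1 else (u P)⁻¹))
      (fun Q => mul_ne_zero (hb Q) (by split_ifs <;> simp_all))
  choose! e he he' using hc
  have cancel : ∀ (P Q : Place K F) (w : F),
      Q.v w ≤ Q.v (b Q * (if u P = 0 then 1 else (u P)⁻¹)) → Q.v (w * u P) ≤ Q.v (b Q) := by
    intro P Q w hw
    by_cases h0 : u P = 0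
    · simp [h0]
    · rw [if_neg h0] at hw
      rw [map_mul]
      calc Q.v w * Q.v (u P) ≤ Q.v (b Q * (u P)⁻¹) * Q.v (u P) := by gcongr
        _ = Q.v (b Q) := by rw [← map_mul, mul_assoc, inv_mul_cancel₀ h0, mul_one]
  refine ⟨∑ P ∈ T, e P * u P, fun Q hQ => ?_⟩
  have hs : ∑ P ∈ T, e P * u P - u Q = (e Q - 1) * u Q + ∑ P ∈ T.erase Q, e P * u P := by
    rw [← Finset.add_sum_erase T _ hQ]; ring
  rw [hs]
  refine Q.v.map_add_le (cancel Q Q _ (he Q hQ)) (Q.v.map_sum_le fun P hP => ?_)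
  have hP' := Finset.mem_erase.1 hP
  exact cancel P Q _ (he' P hP'.2 Q (Finset.mem_erase.2 ⟨fun h => hP'.1 h.symm, hQ⟩))

end Place

/-! ### Residue rings at finitely many places -/

theorem finrank_le_of_forall_linearIndependent {K M : Type*} [Field K] [AddCommGroup M]
    [Module K M] {n : ℕ}
    (H : ∀ s : Finset M, LinearIndependent K (fun i : s => (i : M)) → s.card ≤ n) :
    Module.Finite K M ∧ Module.finrank K M ≤ n := by
  have h : Module.rank K M ≤ n := _root_.rank_le H
  have hfin : Module.Finite K M :=
    Module.rank_lt_aleph0_iff.1 (h.trans_lt (Cardinal.natCast_lt_aleph0))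
  exact ⟨hfin, by
    rw [← Module.finrank_eq_rank K M] at h
    exact_mod_cast h⟩

theorem exists_isCoprime_of_mem_adjoin {K F : Type*} [Field K] [Field F] [Algebra K F] {x c : F}
    (hc : c ∈ K⟮x⟯) : ∃ p q : K[X], IsCoprime p q ∧ q ≠ 0 ∧
      c = Polynomial.aeval x p / Polynomial.aeval x q := by
  obtain ⟨r, s, rfl⟩ := (IntermediateField.mem_adjoin_simple_iff K c).1 hc
  by_cases hs : Polynomial.aeval x s = 0
  · exact ⟨0, 1, isCoprime_zero_left.2 isUnit_one, one_ne_zero, by simp [hs]⟩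
  have hs0 : s ≠ 0 := by rintro rfl; simp at hs
  obtain ⟨p, q, g, hpq, hp, hq⟩ : ∃ p q g : K[X], IsCoprime p q ∧ r = g * p ∧ s = g * q := by
    obtain ⟨q, p, g, h, hq, hp⟩ := UniqueFactorizationMonoid.exists_reduced_factors s hs0 r
    exact ⟨p, q, g, h.isCoprime.symm, hp.symm, hq.symm⟩
  refine ⟨p, q, hpq, by rintro rfl; simp [hq] at hs0, ?_⟩
  subst hp hq
  rw [map_mul] at hs
  rw [map_mul, map_mul, mul_div_mul_left _ _ (left_ne_zero_of_mul hs)]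

namespace Place

variable {K F : Type*} [Field K] [Field F] [Algebra K F]

/-- The ideal of the elements of value at most `v a`. -/
def ballIdeal (P : Place K F) (a : F) : Ideal P.ring where
  carrier := {x | P.v (x : F) ≤ P.v a}
  zero_mem' := by simp
  add_mem' := fun {x y} hx hy => by
    change P.v ((x : F) + (y : F)) ≤ P.v a
    exact P.v.map_add_le hx hy
  smul_mem' := fun c x hx => by
    change P.v ((c : F) * (x : F)) ≤ P.v a
    rw [map_mul]
    exact (mul_le_of_le_one_left' (P.ring.valuation_le_one c)).trans hx

@[simp] theorem mem_ballIdeal {P : Place K F} {a : F} {x : P.ring} :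
    x ∈ P.ballIdeal a ↔ P.v (x : F) ≤ P.v a := Iff.rfl

/-- The `K`-dimension of the ring of integers modulo `a`. -/
noncomputable def colength (P : Place K F) (a : F) : ℕ :=
  Module.finrank K (P.ring ⧸ P.ballIdeal a)

/-- Each `I Q` contains a ball, so a function approximating representatives more closely than these
balls has the prescribed classes. -/
theorem exists_lift (hF : FiniteOverTranscendentals K F) (T : Finset (Place K F))
    (I : ∀ Q : Place K F, Ideal Q.ring) (b : Place K F → F) (hb : ∀ Q, b Q ≠ 0)
    (hI : ∀ Q ∈ T, Q.ballIdeal (b Q) ≤ I Q) (z : ∀ Q : T, Q.1.ring ⧸ I Q.1) :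
    ∃ x : F, ∀ Q : T, ∃ hx : x ∈ Q.1.ring, Ideal.Quotient.mk (I Q.1) ⟨x, hx⟩ = z Q := by
  classical
  choose w hw using fun Q : T => Ideal.Quotient.mk_surjective (z Q)
  -- The radius is capped at 1 so that x is also integral at the places of T.
  obtain ⟨x, hx⟩ := exists_approx hF T (fun Q => if h : Q ∈ T then (w ⟨Q, h⟩ : F) else 0)
    (fun Q => if Q.v (b Q) ≤ 1 then b Q else 1)
    (fun Q => by split_ifs; exacts [hb Q, one_ne_zero])
  refine ⟨x, fun Q => ?_⟩
  have h := hx Q.1 Q.2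
  rw [dif_pos Q.2] at h
  have hle : Q.1.v (x - (w Q : F)) ≤ 1 ∧ Q.1.v (x - (w Q : F)) ≤ Q.1.v (b Q.1) := by
    split_ifs at h with h1
    · exact ⟨h.trans h1, h⟩
    · rw [map_one] at h
      exact ⟨h, h.trans (not_le.1 h1).le⟩
  have hxm : x ∈ Q.1.ring := by
    have := Q.1.ring.add_mem _ _ (v_le_one_iff.1 hle.1) (w Q).2
    rwa [sub_add_cancel] at this
  refine ⟨hxm, ?_⟩
  rw [← hw Q, Ideal.Quotient.eq]
  exact hI Q.1 Q.2 (mem_ballIdeal.2 hle.2)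

/-- The fundamental inequality: residue rings at the places of `F` above a rational place `P` of a
subfield `E`, on which the integers at `P` reduce to constants, have total dimension at most
`[F : E]`. -/
theorem finrank_pi_quotient_le {E : Type*} [Field E] [Algebra K E] [Algebra E F]
    [IsScalarTower K E F] [FiniteDimensional E F]
    (hF : FiniteOverTranscendentals K F) (P : Place K E) (T : Finset (Place K F))
    (I : ∀ Q : Place K F, Ideal Q.ring) (b : Place K F → F) (hb : ∀ Q, b Q ≠ 0)
    (hI : ∀ Q ∈ T, Q.ballIdeal (b Q) ≤ I Q)
    (hP : ∀ c ∈ P.ring, ∃ l : K, ∀ Q ∈ T, ∃ h : algebraMap E F c - algebraMap K F l ∈ Q.ring,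
      (⟨_, h⟩ : Q.ring) ∈ I Q) :
    Module.Finite K (∀ Q : T, Q.1.ring ⧸ I Q.1) ∧
      Module.finrank K (∀ Q : T, Q.1.ring ⧸ I Q.1) ≤ Module.finrank E F := by
  refine finrank_le_of_forall_linearIndependent fun s hs => ?_
  -- The lifts are E-independent: divide an E-relation by its coefficient of largest value at P. All
  -- coefficients become integral at P and reduce to constants, one of them 1, which gives a
  -- nontrivial K-relation between the residue vectors.
  choose u hu hu' using fun z : s => exists_lift hF T I b hb hI z.1
  have hli : LinearIndependent E u := by
    rw [Fintype.linearIndependent_iff]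
    intro g hg
    by_contra! hne
    obtain ⟨i₁, hi₁⟩ := hne
    obtain ⟨i₀, -, hmax⟩ := Finset.exists_max_image Finset.univ (fun i => P.v (g i))
      ⟨i₁, Finset.mem_univ _⟩
    have hv0 : 0 < P.v (g i₀) := lt_of_lt_of_le (by rw [zero_lt_iff]; simpa using hi₁)
      (hmax i₁ (Finset.mem_univ _))
    have hg0 : g i₀ ≠ 0 := by rintro h; simp [h] at hv0
    have hc : ∀ i, g i / g i₀ ∈ P.ring := fun i => by
      rw [← v_le_one_iff, map_div₀, div_le_one₀ hv0]
      exact hmax i (Finset.mem_univ _)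
    -- The constant supplied by `hP` need not be unique, so at `i₀` it is fixed to be 1.
    have hsel : ∀ i, ∃ l : K, (i = i₀ → l = 1) ∧ ∀ Q ∈ T,
        ∃ h : algebraMap E F (g i / g i₀) - algebraMap K F l ∈ Q.ring,
          (⟨_, h⟩ : Q.ring) ∈ I Q := fun i => by
      by_cases h : i = i₀
      · refine ⟨1, fun _ => rfl, fun Q _ => ⟨?_, ?_⟩⟩
        · simp [h, div_self hg0]
        · convert! (I Q).zero_mem using 1
          ext
          simp [h, div_self hg0]
      · obtain ⟨l, hl⟩ := hP _ (hc i)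
        exact ⟨l, fun h' => absurd h' h, hl⟩
    choose l hl1 hl using hsel
    have hsum : ∑ i, (algebraMap E F (g i / g i₀)) * u i = 0 := by
      have : ∑ i, (algebraMap E F (g i / g i₀)) * u i = (algebraMap E F (g i₀)⁻¹) *
          ∑ i, g i • u i := by
        rw [Finset.mul_sum]
        refine Finset.sum_congr rfl fun i _ => ?_
        rw [Algebra.smul_def, div_eq_mul_inv, map_mul]; ring
      rw [this, hg, mul_zero]
    have hrel : ∑ i : s, l i • (i : ∀ Q : T, Q.1.ring ⧸ I Q.1) = 0 := by
      funext Q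
      have h1 : ∀ i : s, (l i • (i : ∀ Q : T, Q.1.ring ⧸ I Q.1)) Q =
          Ideal.Quotient.mk (I Q.1) (algebraMap K Q.1.ring (l i) * ⟨u i, hu i Q⟩) := by
        intro i
        rw [Pi.smul_apply, ← hu' i Q, ← Algebra.smul_def]
        rfl
      rw [Finset.sum_apply, Finset.sum_congr rfl fun i _ => h1 i, ← map_sum, Pi.zero_apply,
        Ideal.Quotient.eq_zero_iff_mem]
      have h2 : ∑ i : s, algebraMap K Q.1.ring (l i) * (⟨u i, hu i Q⟩ : Q.1.ring) =
          - ∑ i : s, (⟨_, (hl i Q.1 Q.2).1⟩ : Q.1.ring) * ⟨u i, hu i Q⟩ := by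
        apply Subtype.ext
        have : ((∑ i : s, (⟨_, (hl i Q.1 Q.2).1⟩ : Q.1.ring) * ⟨u i, hu i Q⟩ : Q.1.ring) : F)
            = ∑ i : s, (algebraMap E F (g i / g i₀) - algebraMap K F (l i)) * u i := by
          push_cast; rfl
        rw [NegMemClass.coe_neg, this]
        have h3 : ((∑ i : s, algebraMap K Q.1.ring (l i) * (⟨u i, hu i Q⟩ : Q.1.ring) :
            Q.1.ring) : F) = ∑ i : s, algebraMap K F (l i) * u i := by
          push_cast; rfl
        rw [h3]
        simp_rw [sub_mul]
        rw [Finset.sum_sub_distrib, hsum, zero_sub, neg_neg]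
      rw [h2]
      exact neg_mem (sum_mem fun i _ => (I Q.1).mul_mem_right _ (hl i Q.1 Q.2).2)
    have := Fintype.linearIndependent_iff.1 hs l hrel i₀
    rw [hl1 i₀ rfl] at this
    exact one_ne_zero this
  have := hli.fintype_card_le_finrank
  simpa using this

variable {y : F}

/-- Write c = p(y)/q(y) in lowest terms. Integrality at one zero of y forces q(0) ≠ 0, and then c -
p(0)/q(0) is y times a function integral at every zero of y. The constant is thus the same for all
these zeros. -/
theorem exists_const_sub_mem_ball (hy : Transcendental K y) {c : F} (hc : c ∈ K⟮y⟯)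
    {Q₀ : Place K F} (hQ₀ : Q₀.v y < 1) (hc0 : c ∈ Q₀.ring) :
    ∃ l : K, ∀ Q : Place K F, Q.v y < 1 → Q.v (c - algebraMap K F l) ≤ Q.v y := by
  obtain ⟨p, q, hpq, hq0, rfl⟩ := exists_isCoprime_of_mem_adjoin hc
  have hqy : Polynomial.aeval y q ≠ 0 := fun h => hy ⟨q, hq0, h⟩
  have hq : q.coeff 0 ≠ 0 := by
    intro hq
    have hq1 : Q₀.v (Polynomial.aeval y q) < 1 := by
      simpa [hq] using aeval_sub_coeff_zero hQ₀ q
    have hp : p.coeff 0 ≠ 0 := by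
      intro hp
      obtain ⟨a, b, hab⟩ := hpq
      have := congrArg (fun r => Polynomial.coeff r 0) hab
      simp [Polynomial.mul_coeff_zero, hp, hq] at this
    rw [← v_le_one_iff, map_div₀, v_aeval_eq_one hQ₀ hp,
      div_le_one₀ (by rw [zero_lt_iff]; simpa using hqy)] at hc0
    exact absurd hq1 (not_lt.2 hc0)
  refine ⟨p.coeff 0 / q.coeff 0, fun Q hQ => ?_⟩
  have hX : (p - Polynomial.C (p.coeff 0 / q.coeff 0) * q).coeff 0 = 0 := by
    simp [hq]
  have e : Polynomial.aeval y p / Polynomial.aeval y q - algebraMap K F (p.coeff 0 / q.coeff 0)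
      = Polynomial.aeval y (p - Polynomial.C (p.coeff 0 / q.coeff 0) * q).divX * y
        / Polynomial.aeval y q := by
    have h1 : Polynomial.aeval y (p - Polynomial.C (p.coeff 0 / q.coeff 0) * q).divX * y
        = Polynomial.aeval y (p - Polynomial.C (p.coeff 0 / q.coeff 0) * q) := by
      conv_rhs => rw [← Polynomial.divX_mul_X_add (p - _), hX]
      simp
    rw [h1, map_sub, map_mul, Polynomial.aeval_C]
    field_simp
  rw [e, map_div₀, v_aeval_eq_one hQ hq, div_one, map_mul]
  exact mul_le_of_le_one_left' (v_le_one_iff.2 (aeval_mem (v_le_one_iff.1 hQ.le) _))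

/-- The fundamental inequality over the place y = 0 of K(y), with the residue rings O_Q/(y); these
retain ramification as well as residue degree. -/
theorem finite_and_sum_colength_le (hF : FiniteOverTranscendentals K F) (hy : Transcendental K y)
    (T : Finset (Place K F)) (hT : ∀ Q ∈ T, Q.v y < 1) :
    (∀ Q ∈ T, Module.Finite K (Q.ring ⧸ Q.ballIdeal y)) ∧
      ∑ Q ∈ T, Q.colength y ≤ Module.finrank K⟮y⟯ F := by
  rcases T.eq_empty_or_nonempty with rfl | ⟨Q₀, hQ₀⟩
  · simp
  have := hF y hy
  let P : Place K K⟮y⟯ :=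
    { ring := Q₀.ring.comap (algebraMap K⟮y⟯ F)
      algebraMap_mem := fun a => Q₀.algebraMap_mem a
      ne_top := by
        intro h
        have h1 : (IntermediateField.AdjoinSimple.gen K y)⁻¹ ∈
            Q₀.ring.comap (algebraMap K⟮y⟯ F) := by rw [h]; trivial
        have h2 : y⁻¹ ∈ Q₀.ring := h1
        rcases v_lt_one_iff.1 (hT Q₀ hQ₀) with h3 | h3
        · exact hy (h3 ▸ isAlgebraic_zero)
        · exact h3 h2 }
  have hy0 : y ≠ 0 := by rintro rfl; exact hy isAlgebraic_zero
  obtain ⟨hfin, hle⟩ := finrank_pi_quotient_le hF P T (fun Q => Q.ballIdeal y) (fun _ => y)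
    (fun _ => hy0) (fun _ _ => le_rfl) (fun c hc => by
      obtain ⟨l, hl⟩ := exists_const_sub_mem_ball hy c.2 (hT Q₀ hQ₀) hc
      exact ⟨l, fun Q hQ => ⟨v_le_one_iff.1 ((hl Q (hT Q hQ)).trans (hT Q hQ).le),
        mem_ballIdeal.2 (hl Q (hT Q hQ))⟩⟩)
  have hfin' : ∀ Q : T, Module.Finite K (Q.1.ring ⧸ Q.1.ballIdeal y) := fun Q => by
    classical
    exact Module.Finite.of_surjective
      (LinearMap.proj (R := K) (φ := fun Q : T => Q.1.ring ⧸ Q.1.ballIdeal y) Q)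
      (LinearMap.proj_surjective Q)
  refine ⟨fun Q hQ => hfin' ⟨Q, hQ⟩, ?_⟩
  rw [Module.finrank_pi_fintype] at hle
  rw [← Finset.sum_coe_sort]
  exact hle

/-! ### Additivity of the colength. -/

theorem ballIdeal_eq_top {Q : Place K F} {a : F} (ha : 1 ≤ Q.v a) : Q.ballIdeal a = ⊤ :=
  (Ideal.eq_top_iff_one _).2 (by simpa using ha)

theorem finite_quotient_ballIdeal (hF : FiniteOverTranscendentals K F) (Q : Place K F) {a : F}
    (ha : a ≠ 0) : Module.Finite K (Q.ring ⧸ Q.ballIdeal a) := by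
  by_cases h : Q.v a < 1
  · exact (finite_and_sum_colength_le hF (transcendental_of_v_lt_one h ha) {Q}
      (by simpa using h)).1 Q (Finset.mem_singleton_self Q)
  · have := Ideal.Quotient.subsingleton_iff.2 (ballIdeal_eq_top (not_lt.1 h))
    infer_instance

theorem colength_eq_zero {Q : Place K F} {a : F} (ha : 1 ≤ Q.v a) : Q.colength a = 0 := by
  have := Ideal.Quotient.subsingleton_iff.2 (ballIdeal_eq_top ha)
  exact Module.finrank_zero_of_subsingleton

theorem colength_pos (hF : FiniteOverTranscendentals K F) {Q : Place K F} {a : F}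
    (h : Q.v a < 1) (ha : a ≠ 0) : 0 < Q.colength a := by
  have := finite_quotient_ballIdeal hF Q ha
  have : Nontrivial (Q.ring ⧸ Q.ballIdeal a) := Ideal.Quotient.nontrivial_iff.2 fun h' => by
    rw [Ideal.eq_top_iff_one] at h'
    simp only [mem_ballIdeal, OneMemClass.coe_one, map_one] at h'
    exact absurd h (not_lt.2 h')
  exact Module.finrank_pos

theorem colength_congr {Q : Place K F} {a b : F} (h : Q.v a = Q.v b) :
    Q.colength a = Q.colength b := by
  have : Q.ballIdeal a = Q.ballIdeal b := by ext; simp [h]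
  rw [colength, this, colength]

/-- Multiplication by a embeds O/(b) into O/(ab), with cokernel O/(a). -/
theorem colength_mul (hF : FiniteOverTranscendentals K F) (Q : Place K F) {a b : F}
    (ha : Q.v a ≤ 1) (hb : Q.v b ≤ 1) (ha0 : a ≠ 0) (hb0 : b ≠ 0) :
    Q.colength (a * b) = Q.colength a + Q.colength b := by
  have := finite_quotient_ballIdeal hF Q (mul_ne_zero ha0 hb0)
  have hle : Q.ballIdeal (a * b) ≤ Q.ballIdeal a := fun x hx => by
    rw [mem_ballIdeal] at hx ⊢
    refine hx.trans ?_
    rw [map_mul]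
    exact mul_le_of_le_one_right' hb
  have hva : 0 < Q.v a := by rw [zero_lt_iff]; simpa using ha0
  let g : (Q.ring ⧸ Q.ballIdeal (a * b)) →ₗ[K] (Q.ring ⧸ Q.ballIdeal a) :=
    (Ideal.Quotient.factorₐ K hle).toLinearMap
  let f : Q.ring →ₗ[K] (Q.ring ⧸ Q.ballIdeal (a * b)) :=
    (Ideal.Quotient.mkₐ K (Q.ballIdeal (a * b))).toLinearMap ∘ₗ
      LinearMap.mulLeft K (⟨a, v_le_one_iff.1 ha⟩ : Q.ring)
  have hker : LinearMap.ker f = (Q.ballIdeal b).restrictScalars K := by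
    ext x
    rw [LinearMap.mem_ker, Submodule.restrictScalars_mem, mem_ballIdeal]
    change Ideal.Quotient.mk _ (_ * x) = 0 ↔ _
    rw [Ideal.Quotient.eq_zero_iff_mem, mem_ballIdeal]
    change Q.v (a * (x : F)) ≤ _ ↔ _
    rw [map_mul, map_mul, mul_le_mul_iff_right₀ hva]
  have hrange : LinearMap.range f = LinearMap.ker g := by
    ext z
    obtain ⟨x, rfl⟩ := Ideal.Quotient.mk_surjective z
    rw [LinearMap.mem_ker, LinearMap.mem_range]
    have hg : g (Ideal.Quotient.mk _ x) = Ideal.Quotient.mk (Q.ballIdeal a) x := rfl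
    rw [hg, Ideal.Quotient.eq_zero_iff_mem]
    constructor
    · rintro ⟨w, hw⟩
      have hw' : Ideal.Quotient.mk (Q.ballIdeal (a * b))
        (⟨a, v_le_one_iff.1 ha⟩ * w) = Ideal.Quotient.mk _ x := hw
      rw [Ideal.Quotient.eq] at hw'
      have h1 := hle hw'
      have h2 : (⟨a, v_le_one_iff.1 ha⟩ * w : Q.ring) ∈ Q.ballIdeal a :=
        (Q.ballIdeal a).mul_mem_right _ (by simp)
      simpa using (Q.ballIdeal a).sub_mem h2 h1
    · intro hx
      rw [mem_ballIdeal] at hx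
      refine ⟨⟨(x : F) / a, ?_⟩, ?_⟩
      · rwa [← v_le_one_iff, map_div₀, div_le_one₀ hva]
      · change Ideal.Quotient.mk _ _ = _
        congr 1
        apply Subtype.ext
        change a * ((x : F) / a) = x
        rw [mul_div_cancel₀ _ ha0]
  have hgs : Function.Surjective g := Ideal.Quotient.factor_surjective hle
  have h1 := LinearMap.finrank_range_add_finrank_ker g
  rw [LinearMap.range_eq_top.2 hgs, finrank_top, ← hrange,
    ← (f.quotKerEquivRange).finrank_eq, hker,
    (Submodule.Quotient.restrictScalarsEquiv K (Q.ballIdeal b)).finrank_eq] at h1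
  exact h1.symm

theorem colength_pow (hF : FiniteOverTranscendentals K F) (Q : Place K F) {a : F}
    (ha : Q.v a ≤ 1) (ha0 : a ≠ 0) (k : ℕ) : Q.colength (a ^ k) = k * Q.colength a := by
  induction k with
  | zero => rw [pow_zero, colength_eq_zero (by simp), zero_mul]
  | succ k ih =>
    rw [pow_succ, colength_mul hF Q (by rw [map_pow]; exact pow_le_one₀ zero_le ha) ha
      (pow_ne_zero _ ha0) ha0, ih]
    ring

theorem colength_prod (hF : FiniteOverTranscendentals K F) (Q : Place K F) {ι : Type*}
    (s : Finset ι) (a : ι → F) (ha : ∀ i ∈ s, Q.v (a i) ≤ 1) (ha0 : ∀ i ∈ s, a i ≠ 0) :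
    Q.colength (∏ i ∈ s, a i) = ∑ i ∈ s, Q.colength (a i) := by
  classical
  induction s using Finset.induction_on with
  | empty => rw [Finset.prod_empty, Finset.sum_empty, colength_eq_zero (by simp)]
  | insert i s hi ih =>
    have ha' := fun j (hj : j ∈ s) => ha j (Finset.mem_insert_of_mem (b := i) hj)
    have ha0' := fun j (hj : j ∈ s) => ha0 j (Finset.mem_insert_of_mem (b := i) hj)
    rw [Finset.prod_insert hi, Finset.sum_insert hi, colength_mul hF Q
      (ha i (Finset.mem_insert_self _ _)) _ (ha0 i (Finset.mem_insert_self _ _))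
      (Finset.prod_ne_zero_iff.2 ha0'), ih ha' ha0']
    rw [map_prod]
    exact Finset.prod_le_one' ha'

end Place

/-! ### Poles -/

namespace Place

variable {K F : Type*} [Field K] [Field F] [Algebra K F]

/-- The integral closure of a subring is the intersection of the valuation rings containing it. The
trivial valuation ring is not a place, but it imposes no condition. -/
theorem isIntegral_of_forall_mem (A : Subalgebra K F) {y : F}
    (h : ∀ P : Place K F, (∀ a ∈ A, a ∈ P.ring) → y ∈ P.ring) : IsIntegral A y := by
  have hy : y ∈ (⨅ V : {V : ValuationSubring F // (A : Set F) ⊆ V.toSubring}, V.1.toSubring) := by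
    rw [Subring.mem_iInf]
    rintro ⟨V, hV⟩
    by_cases htop : V = ⊤
    · subst htop; trivial
    · exact h ⟨V, fun a => hV (A.algebraMap_mem a), htop⟩ fun a ha => hV ha
  rw [iInf_valuationSubring_superset] at hy
  have hy' : IsIntegral (Subring.closure (A : Set F)) y := hy
  have hA : Subring.closure (A : Set F) = A.toSubring := Subring.closure_eq A.toSubring
  rw [hA] at hy'
  exact hy'

theorem isAlgebraic_of_forall_mem {y : F} (h : ∀ P : Place K F, y ∈ P.ring) :
    IsAlgebraic K y := by
  have h1 : IsIntegral (⊥ : Subalgebra K F) y := isIntegral_of_forall_mem ⊥ fun P _ => h P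
  have h2 : IsIntegral K y := by
    have : Algebra.IsIntegral K (⊥ : Subalgebra K F) := inferInstance
    exact isIntegral_trans (R := K) (A := (⊥ : Subalgebra K F)) y h1
  exact h2.isAlgebraic

open Classical in
/-- The function `y⁻¹` if `y` has a pole at `Q`, and `1` otherwise. -/
noncomputable def poleInv (Q : Place K F) (y : F) : F := if y ∈ Q.ring then 1 else y⁻¹

theorem poleInv_ne_zero (Q : Place K F) (y : F) : Q.poleInv y ≠ 0 := by
  unfold poleInv
  split_ifs with h
  · exact one_ne_zero
  · exact inv_ne_zero fun h' => h (h' ▸ Q.ring.zero_mem)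

theorem v_poleInv_le (Q : Place K F) (y : F) : Q.v (Q.poleInv y) ≤ 1 := by
  unfold poleInv
  split_ifs with h
  · rw [map_one]
  · rw [map_inv₀]; exact (inv_lt_one_of_one_lt₀ (one_lt_v_iff.2 h)).le

theorem v_mul_poleInv_le (Q : Place K F) (y : F) : Q.v (y * Q.poleInv y) ≤ 1 := by
  unfold poleInv
  split_ifs with h
  · rw [mul_one]; exact v_le_one_iff.2 h
  · rw [mul_inv_cancel₀ (by rintro rfl; exact h Q.ring.zero_mem), map_one]

theorem poleInv_of_mem {Q : Place K F} {y : F} (h : y ∈ Q.ring) : Q.poleInv y = 1 := if_pos h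

theorem poleInv_of_notMem {Q : Place K F} {y : F} (h : y ∉ Q.ring) : Q.poleInv y = y⁻¹ := if_neg h

theorem adjoin_simple_inv (y : F) : K⟮y⁻¹⟯ = K⟮y⟯ := by
  apply le_antisymm <;> rw [IntermediateField.adjoin_simple_le_iff]
  · exact inv_mem (IntermediateField.mem_adjoin_simple_self K y)
  · simpa using inv_mem (IntermediateField.mem_adjoin_simple_self K y⁻¹)

theorem transcendental_inv {y : F} (hy : Transcendental K y) : Transcendental K y⁻¹ :=
  fun h => hy (by simpa using h.inv)

/-- Poles of y are zeros of y⁻¹, and K(y⁻¹) = K(y). The sum is the degree of the part of (y)_∞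
supported on T. -/
theorem sum_colength_poleInv_le (hF : FiniteOverTranscendentals K F) {y : F}
    (hy : Transcendental K y) (T : Finset (Place K F)) :
    ∑ Q ∈ T, Q.colength (Q.poleInv y) ≤ Module.finrank K⟮y⟯ F := by
  classical
  rw [← Finset.sum_filter_add_sum_filter_not T (fun Q => y ∈ Q.ring),
    Finset.sum_eq_zero (s := T.filter fun Q => y ∈ Q.ring), zero_add]
  · have h := (finite_and_sum_colength_le hF (transcendental_inv hy)
      (T.filter fun Q => y ∉ Q.ring) fun Q hQ => by
        rw [map_inv₀]
        exact inv_lt_one_of_one_lt₀ (one_lt_v_iff.2 (Finset.mem_filter.1 hQ).2)).2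
    rw [adjoin_simple_inv] at h
    refine le_trans (le_of_eq ?_) h
    exact Finset.sum_congr rfl fun Q hQ => by rw [poleInv_of_notMem (Finset.mem_filter.1 hQ).2]
  · intro Q hQ
    rw [poleInv_of_mem (Finset.mem_filter.1 hQ).2, colength_eq_zero (by simp)]

/-- Every pole contributes at least 1 to a sum bounded by [F : K(y)]. -/
theorem finite_poles (hF : FiniteOverTranscendentals K F) (y : F) :
    {Q : Place K F | y ∉ Q.ring}.Finite := by
  by_cases hy : IsAlgebraic K y
  · convert! Set.finite_empty
    ext Q
    simpa using v_algebraMap_eq_one_of_isAlgebraic hy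
  by_contra hinf
  obtain ⟨T, hT, hcard⟩ := Set.Infinite.exists_subset_card_eq hinf (Module.finrank K⟮y⟯ F + 1)
  have h := sum_colength_poleInv_le hF hy T
  have h2 : ∑ Q ∈ T, 1 ≤ ∑ Q ∈ T, Q.colength (Q.poleInv y) := Finset.sum_le_sum fun Q hQ => by
    have hQ' : y ∉ Q.ring := hT hQ
    refine colength_pos hF ?_ (Q.poleInv_ne_zero y)
    rw [poleInv_of_notMem hQ', map_inv₀]
    exact inv_lt_one_of_one_lt₀ (one_lt_v_iff.2 hQ')
  rw [Finset.sum_const, smul_eq_mul, mul_one] at h2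
  omega

theorem exists_sum_colength_poleInv_le (hF : FiniteOverTranscendentals K F) (y : F) :
    ∃ N, ∀ T : Finset (Place K F), ∑ Q ∈ T, Q.colength (Q.poleInv y) ≤ N := by
  by_cases hy : IsAlgebraic K y
  · refine ⟨0, fun T => (Finset.sum_eq_zero fun Q _ => ?_).le⟩
    rw [poleInv_of_mem (v_algebraMap_eq_one_of_isAlgebraic hy), colength_eq_zero (by simp)]
  · exact ⟨_, sum_colength_poleInv_le hF hy⟩

/-- The functions `u` such that `u Φ_Q` is integral at every place `Q`. -/
def boundedFunctions (Φ : Place K F → F) : Submodule K F where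
  carrier := {u | ∀ Q : Place K F, u * Φ Q ∈ Q.ring}
  zero_mem' Q := by rw [zero_mul]; exact Q.ring.zero_mem
  add_mem' hu hv Q := by rw [add_mul]; exact Q.ring.add_mem _ _ (hu Q) (hv Q)
  smul_mem' c u hu Q := by
    rw [Algebra.smul_def, mul_assoc]; exact Q.ring.mul_mem _ _ (Q.algebraMap_mem c) (hu Q)

/-- This is the bound ℓ(A) ≤ deg A + 1. The map u ↦ (u Φ_Q mod Φ_Q) over Q ∈ T records principal
parts; a function in its kernel has no poles, hence is algebraic over K and therefore constant. -/
theorem finrank_boundedFunctions_le (hF : FiniteOverTranscendentals K F)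
    (hK : ∀ z : F, IsAlgebraic K z → z ∈ Set.range (algebraMap K F)) (Φ : Place K F → F)
    (hΦ : ∀ Q, Φ Q ≠ 0) (T : Finset (Place K F)) (hT : ∀ Q ∉ T, Q.v (Φ Q) = 1) :
    Module.Finite K (boundedFunctions Φ) ∧
      Module.finrank K (boundedFunctions Φ) ≤ ∑ Q ∈ T, Q.colength (Φ Q) + 1 := by
  have hfin : ∀ Q : Place K F, Module.Finite K (Q.ring ⧸ Q.ballIdeal (Φ Q)) :=
    fun Q => finite_quotient_ballIdeal hF Q (hΦ Q)
  let f : ∀ Q : T, boundedFunctions Φ →ₗ[K] (Q.1.ring ⧸ Q.1.ballIdeal (Φ Q.1)) := fun Q =>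
    (Ideal.Quotient.mkₐ K (Q.1.ballIdeal (Φ Q.1))).toLinearMap ∘ₗ
    { toFun := fun u => (⟨u.1 * Φ Q.1, u.2 Q.1⟩ : Q.1.ring)
      map_add' := fun u w => Subtype.ext (add_mul _ _ _)
      map_smul' := fun c u => Subtype.ext (by
        change (c • u.1) * Φ Q.1 = algebraMap K F c * (u.1 * Φ Q.1)
        rw [Algebra.smul_def, mul_assoc]) }
  let θ := LinearMap.pi f
  have hker : ∀ u ∈ LinearMap.ker θ, ∃ c : K, algebraMap K F c = u.1 := by
    intro u hu
    apply hK
    apply isAlgebraic_of_forall_mem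
    intro Q
    by_cases hQ : Q ∈ T
    · have h := congrFun (LinearMap.mem_ker.1 hu) ⟨Q, hQ⟩
      change Ideal.Quotient.mk _ _ = 0 at h
      rw [Ideal.Quotient.eq_zero_iff_mem, mem_ballIdeal] at h
      change Q.v (u.1 * Φ Q) ≤ Q.v (Φ Q) at h
      have h0 : 0 < Q.v (Φ Q) := by rw [zero_lt_iff]; simpa using hΦ Q
      rw [map_mul, mul_le_iff_le_one_left h0] at h
      exact v_le_one_iff.1 h
    · have h := v_le_one_iff.2 (u.2 Q)
      rw [map_mul, hT Q hQ, mul_one] at h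
      exact v_le_one_iff.1 h
  have hkerle : Module.Finite K (LinearMap.ker θ) ∧ Module.finrank K (LinearMap.ker θ) ≤ 1 := by
    let j : LinearMap.ker θ →ₗ[K] F := (boundedFunctions Φ).subtype ∘ₗ (LinearMap.ker θ).subtype
    have hj : Function.Injective j := fun a b h => Subtype.ext (Subtype.ext h)
    have hr : LinearMap.range j ≤ LinearMap.range (Algebra.linearMap K F) := by
      rintro _ ⟨u, rfl⟩
      obtain ⟨c, hc⟩ := hker u.1 u.2
      exact ⟨c, hc⟩
    have e := LinearEquiv.ofInjective j hj
    have : Module.Finite K (LinearMap.range j) := Submodule.finiteDimensional_of_le hr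
    refine ⟨Module.Finite.equiv e.symm, ?_⟩
    rw [e.finrank_eq]
    calc _ ≤ _ := Submodule.finrank_mono hr
      _ ≤ Module.finrank K K := LinearMap.finrank_range_le _
      _ = 1 := Module.finrank_self K
  have := hkerle.1
  have : Module.Finite K (boundedFunctions Φ ⧸ LinearMap.ker θ) :=
    Module.Finite.equiv θ.quotKerEquivRange.symm
  have hfinW : Module.Finite K (boundedFunctions Φ) :=
    Module.Finite.of_submodule_quotient (LinearMap.ker θ)
  refine ⟨hfinW, ?_⟩
  have h1 := θ.finrank_range_add_finrank_ker
  have h2 : Module.finrank K (LinearMap.range θ) ≤ ∑ Q ∈ T, Q.colength (Φ Q) := by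
    refine (Submodule.finrank_le _).trans (le_of_eq ?_)
    rw [Module.finrank_pi_fintype, ← Finset.sum_coe_sort T]
    rfl
  have := hkerle.2
  omega

/-! ### The degree of a function compared with its poles and zeros. -/

theorem linearIndependent_pow_of_transcendental {g : F} (hg : Transcendental K g) :
    LinearIndependent K (fun k : ℕ => g ^ k) := by
  have h := (Polynomial.basisMonomials K).linearIndependent.map'
    (Polynomial.aeval (R := K) g).toLinearMap
    (LinearMap.ker_eq_bot.2 (transcendental_iff_injective.1 hg))
  convert! h using 1
  ext k
  simp

theorem linearIndependent_pow_mul {E : Type*} [Field E] [Algebra K E] [Algebra E F]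
    [IsScalarTower K E F] {γ : E} (hγ : Transcendental K γ) {ι : Type*} {w : ι → F}
    (hw : LinearIndependent E w) (k : ℕ) : LinearIndependent K (fun p : Fin k × ι =>
      (algebraMap E F γ) ^ (p.1 : ℕ) * w p.2) := by
  have h1 : LinearIndependent K (fun r : Fin k => γ ^ (r : ℕ)) :=
    (linearIndependent_pow_of_transcendental hγ).comp (fun r : Fin k => (r : ℕ)) Fin.val_injective
  convert! linearIndependent_smul h1 hw using 2 with p
  rw [Algebra.smul_def, map_pow]

theorem transcendental_gen {g : F} (hg : Transcendental K g) :
    Transcendental K (IntermediateField.AdjoinSimple.gen K g) := fun h =>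
  hg ((isAlgebraic_algHom_iff K⟮g⟯.val Subtype.val_injective).2 h)

/-- The degree of a function is at most the degree of any divisor bounding its poles. -/
theorem finrank_adjoin_le_of_poles (hF : FiniteOverTranscendentals K F)
    (hK : ∀ z : F, IsAlgebraic K z → z ∈ Set.range (algebraMap K F)) {g : F}
    (hg : Transcendental K g) {ι : Type*} (s : Finset ι) (y : ι → F) (a : ι → ℕ)
    (hy : ∀ j ∈ s, Transcendental K (y j))
    (hgy : ∀ Q : Place K F, g * ∏ j ∈ s, Q.poleInv (y j) ^ a j ∈ Q.ring) :
    Module.finrank K⟮g⟯ F ≤ ∑ j ∈ s, a j * Module.finrank K⟮y j⟯ F := by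
  classical
  have := hF g hg
  set n := Module.finrank K⟮g⟯ F with hn
  set w : Module.Basis (Fin n) K⟮g⟯ F := Module.finBasis K⟮g⟯ F
  choose N hN using fun α => exists_sum_colength_poleInv_le hF (w α)
  set C := ∑ α, N α with hC
  set M := ∑ j ∈ s, a j * Module.finrank K⟮y j⟯ F with hM
  -- The products g^r w_α with r ≤ k are (k + 1) n independent functions with poles at most k Σ a_j
  -- (y_j)_∞ plus the poles of the w_α. The latter cost at most C, whatever k is.
  have key : ∀ k : ℕ, (k + 1) * n ≤ k * M + C + 1 := by
    intro k
    let Φ : Place K F → F := fun Q =>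
      (∏ j ∈ s, Q.poleInv (y j) ^ a j) ^ k * ∏ α, Q.poleInv (w α)
    have hΦ1 : ∀ Q : Place K F, ∏ j ∈ s, Q.poleInv (y j) ^ a j ≠ 0 := fun Q =>
      Finset.prod_ne_zero_iff.2 fun j _ => pow_ne_zero _ (Q.poleInv_ne_zero _)
    have hΦ2 : ∀ Q : Place K F, ∏ α, Q.poleInv (w α) ≠ 0 := fun Q =>
      Finset.prod_ne_zero_iff.2 fun j _ => Q.poleInv_ne_zero _
    have hΦ : ∀ Q, Φ Q ≠ 0 := fun Q => mul_ne_zero (pow_ne_zero _ (hΦ1 Q)) (hΦ2 Q)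
    have hv1 : ∀ Q : Place K F, Q.v (∏ j ∈ s, Q.poleInv (y j) ^ a j) ≤ 1 := fun Q => by
      rw [map_prod]
      exact Finset.prod_le_one' fun j _ => by
        rw [map_pow]; exact pow_le_one₀ zero_le (Q.v_poleInv_le _)
    have hv2 : ∀ Q : Place K F, Q.v (∏ α, Q.poleInv (w α)) ≤ 1 := fun Q => by
      rw [map_prod]
      exact Finset.prod_le_one' fun j _ => Q.v_poleInv_le _
    have hfin : ((⋃ j ∈ s, {Q : Place K F | y j ∉ Q.ring}) ∪
        ⋃ α, {Q : Place K F | w α ∉ Q.ring}).Finite :=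
      (s.finite_toSet.biUnion fun j _ => finite_poles hF _).union
        (Set.finite_iUnion fun α => finite_poles hF _)
    let T := hfin.toFinset
    have hT : ∀ Q ∉ T, Q.v (Φ Q) = 1 := by
      intro Q hQ
      rw [Set.Finite.mem_toFinset, Set.mem_union, not_or] at hQ
      simp only [Set.mem_iUnion, Set.mem_ofPred_eq, not_exists, not_not] at hQ
      have e1 : ∏ j ∈ s, Q.poleInv (y j) ^ a j = 1 :=
        Finset.prod_eq_one fun j hj => by rw [poleInv_of_mem (hQ.1 j hj), one_pow]
      have e2 : ∏ α, Q.poleInv (w α) = 1 :=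
        Finset.prod_eq_one fun α _ => poleInv_of_mem (hQ.2 α)
      simp only [Φ, e1, e2, one_pow, mul_one, map_one]
    obtain ⟨hfd, hle⟩ := finrank_boundedFunctions_le hF hK Φ hΦ T hT
    have hli := linearIndependent_pow_mul (transcendental_gen hg) w.linearIndependent (k + 1)
    have hmem : ∀ p : Fin (k + 1) × Fin n,
        g ^ (p.1 : ℕ) * w p.2 ∈ boundedFunctions Φ := by
      rintro ⟨r, α⟩ Q
      obtain ⟨t, ht⟩ : ∃ t : ℕ, k = r + t := ⟨k - r, by have := r.2; omega⟩
      rw [← v_le_one_iff]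
      have e2 : g ^ (r : ℕ) * w α * Φ Q = (g * ∏ j ∈ s, Q.poleInv (y j) ^ a j) ^ (r : ℕ) *
          ((∏ j ∈ s, Q.poleInv (y j) ^ a j) ^ t * ((w α * Q.poleInv (w α)) *
            ∏ β ∈ Finset.univ.erase α, Q.poleInv (w β))) := by
        simp only [Φ]
        rw [← Finset.mul_prod_erase Finset.univ (fun β => Q.poleInv (w β)) (Finset.mem_univ α)]
        have e3 : (∏ j ∈ s, Q.poleInv (y j) ^ a j) ^ k = (∏ j ∈ s, Q.poleInv (y j) ^ a j) ^ (r : ℕ) *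
            (∏ j ∈ s, Q.poleInv (y j) ^ a j) ^ t := by rw [← pow_add, ← ht]
        rw [e3, mul_pow]; ring
      have h3 : Q.v (∏ β ∈ Finset.univ.erase α, Q.poleInv (w β)) ≤ 1 := by
        rw [map_prod]
        exact Finset.prod_le_one' fun j _ => Q.v_poleInv_le _
      rw [e2, map_mul, map_mul, map_mul, map_pow, map_pow]
      exact mul_le_one' (pow_le_one₀ zero_le (v_le_one_iff.2 (hgy Q)))
        (mul_le_one' (pow_le_one₀ zero_le (hv1 Q)) (mul_le_one' (Q.v_mul_poleInv_le _) h3))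
    have hli' : LinearIndependent K (fun p : Fin (k + 1) × Fin n =>
        (⟨_, hmem p⟩ : boundedFunctions Φ)) :=
      LinearIndependent.of_comp (boundedFunctions Φ).subtype hli
    have hcard := hli'.fintype_card_le_finrank
    rw [Fintype.card_prod, Fintype.card_fin, Fintype.card_fin] at hcard
    refine hcard.trans (hle.trans (Nat.add_le_add_right ?_ 1))
    have hcol : ∀ Q : Place K F, Q.colength (Φ Q) =
        k * ∑ j ∈ s, a j * Q.colength (Q.poleInv (y j)) + ∑ α, Q.colength (Q.poleInv (w α)) := by
      intro Q
      rw [colength_mul hF Q (by rw [map_pow]; exact pow_le_one₀ zero_le (hv1 Q)) (hv2 Q)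
        (pow_ne_zero _ (hΦ1 Q)) (hΦ2 Q), colength_pow hF Q (hv1 Q) (hΦ1 Q),
        colength_prod hF Q _ _ (fun j _ => by
          rw [map_pow]; exact pow_le_one₀ zero_le (Q.v_poleInv_le _))
          (fun j _ => pow_ne_zero _ (Q.poleInv_ne_zero _)),
        colength_prod hF Q _ _ (fun α _ => Q.v_poleInv_le _) (fun α _ => Q.poleInv_ne_zero _)]
      congr 2
      exact Finset.sum_congr rfl fun j _ =>
        colength_pow hF Q (Q.v_poleInv_le _) (Q.poleInv_ne_zero _) _
    simp_rw [hcol]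
    rw [Finset.sum_add_distrib, ← Finset.mul_sum, Finset.sum_comm, Finset.sum_comm (s := T)]
    refine add_le_add (Nat.mul_le_mul_left k (Finset.sum_le_sum fun j hj => ?_))
      (Finset.sum_le_sum fun α _ => hN α T)
    rw [← Finset.mul_sum]
    exact Nat.mul_le_mul_left _ (sum_colength_poleInv_le hF (hy j hj) T)
  by_contra hlt
  push Not at hlt
  -- At k = C + 1, having n ≥ M + 1 would make the left side exceed the right side by at least M +
  -- 1.
  have h := key (C + 1)
  have h2 : (C + 1 + 1) * (M + 1) ≤ (C + 1 + 1) * n := Nat.mul_le_mul_left _ hlt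
  nlinarith

/-- A function which vanishes to order at least `d` at the places of `Z` has degree at least
`d |Z|`. -/
theorem mul_card_le_finrank_adjoin (hF : FiniteOverTranscendentals K F) {g : F}
    (hg : Transcendental K g) (Z : Finset (Place K F)) (d : ℕ)
    (hZ : ∀ Q ∈ Z, ∃ f, f ≠ 0 ∧ Q.v f < 1 ∧ Q.v g = Q.v f ^ d) (hd : d ≠ 0) :
    d * Z.card ≤ Module.finrank K⟮g⟯ F := by
  refine le_trans ?_ (finite_and_sum_colength_le hF hg Z fun Q hQ => ?_).2
  · rw [mul_comm, ← smul_eq_mul]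
    refine Finset.card_nsmul_le_sum _ _ _ fun Q hQ => ?_
    obtain ⟨f, hf0, hf, hfg⟩ := hZ Q hQ
    rw [colength_congr (hfg.trans (map_pow _ _ _).symm), colength_pow hF Q hf.le hf0]
    exact Nat.le_mul_of_pos_right d (colength_pos hF hf hf0)
  · obtain ⟨f, hf0, hf, hfg⟩ := hZ Q hQ
    rw [hfg]
    exact pow_lt_one₀ zero_le hf hd

end Place

/-! ### Places of a rational function field -/

namespace Place

variable {K F : Type*} [Field K] [Field F] [Algebra K F]

theorem isUniformizer_iff {P : Place K F} {t : P.ring} :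
    P.IsUniformizer t ↔ P.v (t : F) < 1 ∧ ∀ c, P.v c < 1 → P.v c ≤ P.v (t : F) := by
  rw [IsUniformizer]
  constructor
  · intro h
    have ht : t ∈ IsLocalRing.maximalIdeal P.ring := h ▸ Ideal.mem_span_singleton_self t
    refine ⟨(P.ring.valuation_lt_one_iff t).1 ht, fun c hc => ?_⟩
    have hc' : (⟨c, v_le_one_iff.1 hc.le⟩ : P.ring) ∈ IsLocalRing.maximalIdeal P.ring :=
      (P.ring.valuation_lt_one_iff _).2 hc
    rw [h, Ideal.mem_span_singleton'] at hc'
    obtain ⟨a, ha⟩ := hc'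
    have ha' : c = (a : F) * t := by rw [← MulMemClass.coe_mul, ha]
    rw [ha', map_mul]
    exact mul_le_of_le_one_left' (P.ring.valuation_le_one a)
  · rintro ⟨ht, hmax⟩
    apply le_antisymm
    · intro c hc
      have h1 := hmax c ((P.ring.valuation_lt_one_iff c).1 hc)
      obtain ⟨a, ha⟩ := (P.ring.valuation_le_iff _ _).1 h1
      rw [Ideal.mem_span_singleton']
      exact ⟨a, Subtype.ext ha⟩
    · rw [Ideal.span_singleton_le_iff_mem]
      exact (P.ring.valuation_lt_one_iff t).2 ht

theorem v_eq_of_isUniformizer {P : Place K F} {t t' : P.ring} (ht : P.IsUniformizer t)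
    (ht' : P.IsUniformizer t') : P.v (t : F) = P.v (t' : F) :=
  le_antisymm ((isUniformizer_iff.1 ht').2 _ (isUniformizer_iff.1 ht).1)
    ((isUniformizer_iff.1 ht).2 _ (isUniformizer_iff.1 ht').1)

/-- `π` is the monic irreducible polynomial such that `π(x)` generates the prime ideal of `K[x]`
below the place `P`. -/
structure IsPrimePoly (P : Place K F) (x : F) (π : K[X]) : Prop where
  monic : π.Monic
  irreducible : Irreducible π
  v_lt_one_iff : ∀ p : K[X], P.v (Polynomial.aeval x p) < 1 ↔ π ∣ p

variable {x : F}

theorem v_aeval_le {P : Place K F} (hP : x ∈ P.ring) (p : K[X]) :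
    P.v (Polynomial.aeval x p) ≤ 1 := v_le_one_iff.2 (aeval_mem hP p)

/-- π generates the contraction of the maximal ideal to K[x]. The contraction is nonzero: otherwise
all nonzero polynomials in x would be units at P, and the valuation ring would be the whole field.
-/
theorem exists_isPrimePoly (hx : ∀ c : F, c ∈ K⟮x⟯) {P : Place K F} (hP : x ∈ P.ring) :
    ∃ π, P.IsPrimePoly x π := by
  classical
  let J : Ideal K[X] :=
    { carrier := {p | P.v (Polynomial.aeval x p) < 1}
      zero_mem' := by simp
      add_mem' := fun {p q} hp hq => by
        change P.v (Polynomial.aeval x (p + q)) < 1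
        rw [map_add]; exact P.v.map_add_lt hp hq
      smul_mem' := fun c p hp => by
        change P.v (Polynomial.aeval x (c * p)) < 1
        rw [map_mul, map_mul]
        exact mul_lt_one_of_nonneg_of_lt_one_right (v_aeval_le hP c) zero_le hp }
  have hmem : ∀ p, p ∈ J ↔ P.v (Polynomial.aeval x p) < 1 := fun p => Iff.rfl
  have hone : ∀ p, p ∉ J → P.v (Polynomial.aeval x p) = 1 := fun p hp =>
    le_antisymm (v_aeval_le hP p) (not_lt.1 hp)
  have hJ0 : J ≠ ⊥ := by
    intro h0
    apply P.ne_top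
    rw [eq_top_iff]
    intro c _
    obtain ⟨p, q, -, hq, rfl⟩ := exists_isCoprime_of_mem_adjoin (hx c)
    have hqJ : q ∉ J := by rw [h0]; simpa using hq
    rw [← v_le_one_iff, map_div₀, hone q hqJ, div_one]
    exact v_aeval_le hP p
  have hJp : J.IsPrime := by
    refine ⟨?_, fun {a b} hab => ?_⟩
    · rw [Ne, Ideal.eq_top_iff_one, hmem]; simp
    · by_contra! h
      rw [hmem, map_mul, map_mul, hone a h.1, hone b h.2, one_mul] at hab
      exact lt_irrefl _ hab
  have hg0 : Submodule.IsPrincipal.generator J ≠ 0 := fun h =>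
    hJ0 ((Submodule.IsPrincipal.eq_bot_iff_generator_eq_zero J).2 h)
  have hgp := Submodule.IsPrincipal.prime_generator_of_isPrime J hJ0
  have hass : Associated (Submodule.IsPrincipal.generator J)
      (normalize (Submodule.IsPrincipal.generator J)) := (normalize_associated _).symm
  refine ⟨normalize (Submodule.IsPrincipal.generator J), Polynomial.monic_normalize hg0,
    (hass.prime hgp).irreducible, fun p => ?_⟩
  rw [← hmem, Submodule.IsPrincipal.mem_iff_generator_dvd J]
  exact hass.dvd_iff_dvd_left

namespace IsPrimePoly

variable {P : Place K F} {π : K[X]}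

theorem v_eq_one (h : P.IsPrimePoly x π) (hP : x ∈ P.ring) {p : K[X]} (hp : ¬ π ∣ p) :
    P.v (Polynomial.aeval x p) = 1 :=
  le_antisymm (v_aeval_le hP p) (not_lt.1 fun h' => hp ((h.v_lt_one_iff p).1 h'))

theorem not_dvd_of_mem (h : P.IsPrimePoly x π) (hP : x ∈ P.ring) {p q : K[X]}
    (hpq : IsCoprime p q) (hc : Polynomial.aeval x p / Polynomial.aeval x q ∈ P.ring)
    (hq0 : Polynomial.aeval x q ≠ 0) : ¬ π ∣ q := by
  intro hq
  have hp : ¬ π ∣ p := fun hp => h.irreducible.not_isUnit (hpq.isUnit_of_dvd' hp hq)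
  rw [← v_le_one_iff, map_div₀, h.v_eq_one hP hp, div_le_one₀ (by
    rw [zero_lt_iff]; simpa using hq0)] at hc
  exact absurd ((h.v_lt_one_iff q).2 hq) (not_lt.2 hc)

theorem le_v (h : P.IsPrimePoly x π) (hP : x ∈ P.ring) (hx : ∀ c : F, c ∈ K⟮x⟯) {c : F}
    (hc : P.v c < 1) : P.v c ≤ P.v (Polynomial.aeval x π) := by
  obtain ⟨p, q, hpq, hq, rfl⟩ := exists_isCoprime_of_mem_adjoin (hx c)
  by_cases hq0 : Polynomial.aeval x q = 0
  · simp [hq0]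
  have hπq := h.not_dvd_of_mem hP hpq (v_le_one_iff.1 hc.le) hq0
  rw [map_div₀, h.v_eq_one hP hπq, div_one] at hc ⊢
  obtain ⟨r, rfl⟩ := (h.v_lt_one_iff p).1 hc
  rw [map_mul, map_mul]
  exact mul_le_of_le_one_right' (v_aeval_le hP r)

theorem isUniformizer (h : P.IsPrimePoly x π) (hP : x ∈ P.ring) (hx : ∀ c : F, c ∈ K⟮x⟯) :
    P.IsUniformizer ⟨Polynomial.aeval x π, aeval_mem hP π⟩ :=
  isUniformizer_iff.2 ⟨(h.v_lt_one_iff π).2 dvd_rfl, fun _ hc => h.le_v hP hx hc⟩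

theorem coe_aeval (hP : x ∈ P.ring) (p : K[X]) :
    ((Polynomial.aeval (⟨x, hP⟩ : P.ring) p : P.ring) : F) = Polynomial.aeval x p := by
  induction p using Polynomial.induction_on' with
  | add p q hp hq => rw [map_add, map_add, ← hp, ← hq]; rfl
  | monomial n a => rw [Polynomial.aeval_monomial, Polynomial.aeval_monomial]; rfl

/-- The residue field is K[x]/(π): the class of p/q is that of p b, where b inverts q modulo π. -/
theorem degree_eq (h : P.IsPrimePoly x π) (hP : x ∈ P.ring) (hx : ∀ c : F, c ∈ K⟮x⟯) :
    P.degree = π.natDegree := by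
  let φ : K[X] →ₐ[K] (P.ring ⧸ IsLocalRing.maximalIdeal P.ring) :=
    (Ideal.Quotient.mkₐ K (IsLocalRing.maximalIdeal P.ring)).comp
      (Polynomial.aeval (⟨x, hP⟩ : P.ring))
  have hφ : ∀ p, φ p = Ideal.Quotient.mk _ (Polynomial.aeval (⟨x, hP⟩ : P.ring) p) :=
    fun p => rfl
  have hker : RingHom.ker φ = Ideal.span {π} := by
    ext p
    rw [RingHom.mem_ker, hφ, Ideal.Quotient.eq_zero_iff_mem, P.ring.valuation_lt_one_iff,
      coe_aeval, Ideal.mem_span_singleton]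
    exact h.v_lt_one_iff p
  have hsurj : Function.Surjective φ := by
    intro z
    obtain ⟨⟨c, hc⟩, rfl⟩ := Ideal.Quotient.mk_surjective z
    obtain ⟨p, q, hpq, hq, rfl⟩ := exists_isCoprime_of_mem_adjoin (hx c)
    by_cases hq0 : Polynomial.aeval x q = 0
    · refine ⟨0, ?_⟩
      rw [map_zero, eq_comm, Ideal.Quotient.eq_zero_iff_mem, P.ring.valuation_lt_one_iff]
      simp [hq0]
    have hπq := h.not_dvd_of_mem hP hpq hc hq0
    obtain ⟨a, b, hab⟩ := h.irreducible.coprime_iff_not_dvd.2 hπq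
    refine ⟨p * b, ?_⟩
    rw [hφ, Ideal.Quotient.eq, P.ring.valuation_lt_one_iff]
    change P.v (((Polynomial.aeval (⟨x, hP⟩ : P.ring) (p * b) : P.ring) : F) - _) < 1
    rw [coe_aeval]
    have e : Polynomial.aeval x (p * b) - Polynomial.aeval x p / Polynomial.aeval x q
        = - (Polynomial.aeval x p / Polynomial.aeval x q) * Polynomial.aeval x (a * π) := by
      have h1 : Polynomial.aeval x (a * π) = 1 - Polynomial.aeval x b * Polynomial.aeval x q := by
        rw [← map_mul, eq_sub_iff_add_eq, ← map_add, hab, map_one]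
      rw [h1, map_mul]
      field_simp
      ring
    change P.v (Polynomial.aeval x (p * b) - Polynomial.aeval x p / Polynomial.aeval x q) < 1
    rw [e, map_mul, Valuation.map_neg]
    exact mul_lt_one_of_nonneg_of_lt_one_right (v_le_one_iff.2 hc) zero_le
      ((h.v_lt_one_iff _).2 (dvd_mul_left π a))
  have e := (Ideal.quotientKerAlgEquivOfSurjective hsurj).toLinearEquiv.finrank_eq
  have e' := ((Ideal.quotientEquivAlgOfEq K hker).toLinearEquiv).finrank_eq
  rw [e, finrank_quotient_span_eq_natDegree] at e'
  exact e'

theorem ring_eq {P' : Place K F} (h : P.IsPrimePoly x π) (hP : x ∈ P.ring)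
    (h' : P'.IsPrimePoly x π) (hP' : x ∈ P'.ring) (hx : ∀ c : F, c ∈ K⟮x⟯) : P = P' := by
  have key : ∀ {P P' : Place K F}, P.IsPrimePoly x π → x ∈ P.ring → P'.IsPrimePoly x π →
      x ∈ P'.ring → P.ring ≤ P'.ring := by
    intro P P' h hP h' hP' c hc
    obtain ⟨p, q, hpq, hq, rfl⟩ := exists_isCoprime_of_mem_adjoin (hx c)
    by_cases hq0 : Polynomial.aeval x q = 0
    · simp [hq0]
    have hπq := h.not_dvd_of_mem hP hpq hc hq0
    rw [← v_le_one_iff, map_div₀, h'.v_eq_one hP' hπq, div_one]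
    exact v_aeval_le hP' p
  exact Place.ext (le_antisymm (key h hP h' hP') (key h' hP' h hP))

end IsPrimePoly

/-- At a pole of x the leading term strictly dominates. -/
theorem v_aeval_of_notMem {P : Place K F} (hP : x ∉ P.ring) {p : K[X]} (hp : p ≠ 0) :
    P.v (Polynomial.aeval x p) = P.v x ^ p.natDegree := by
  have hvx : 1 < P.v x := one_lt_v_iff.2 hP
  have h1 : P.v (Polynomial.aeval x p.eraseLead) < P.v x ^ p.natDegree := by
    rw [Polynomial.aeval_eq_sum_range]
    refine P.v.map_sum_lt (pow_ne_zero _ (zero_lt_one.trans hvx).ne') fun k hk => ?_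
    by_cases hk0 : p.eraseLead.coeff k = 0
    · rw [hk0, zero_smul, map_zero]
      exact pow_pos (zero_lt_one.trans hvx) _
    have hkn : k < p.natDegree := by
      have h2 := Polynomial.le_natDegree_of_ne_zero hk0
      by_contra hge
      have h3 := Polynomial.eraseLead_natDegree_le p
      have : k = p.natDegree := by omega
      rw [this, Polynomial.eraseLead_coeff_natDegree] at hk0
      exact hk0 rfl
    rw [Algebra.smul_def, map_mul, map_pow]
    calc _ ≤ P.v x ^ k := mul_le_of_le_one_left' (P.v_algebraMap_le _)
      _ < _ := pow_lt_pow_right₀ hvx hkn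
  have h2 : Polynomial.aeval x p = Polynomial.aeval x p.eraseLead +
      algebraMap K F p.leadingCoeff * x ^ p.natDegree := by
    conv_lhs => rw [← p.eraseLead_add_C_mul_X_pow]
    rw [map_add, map_mul, Polynomial.aeval_C, map_pow, Polynomial.aeval_X]
  have h3 : P.v (algebraMap K F p.leadingCoeff * x ^ p.natDegree) = P.v x ^ p.natDegree := by
    rw [map_mul, P.v_algebraMap (Polynomial.leadingCoeff_ne_zero.2 hp), one_mul, map_pow]
  rw [h2, P.v.map_add_eq_of_lt_right (by rwa [h3]), h3]

/-- A pole of x is a finite place for the generator x⁻¹, so the results on finite places apply to it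
with prime polynomial X. -/
theorem isPrimePoly_X_inv {P : Place K F} (hx : ∀ c : F, c ∈ K⟮x⟯) (hP : x ∉ P.ring) :
    P.IsPrimePoly x⁻¹ Polynomial.X ∧ x⁻¹ ∈ P.ring ∧ ∀ c : F, c ∈ K⟮x⁻¹⟯ := by
  have hx' : ∀ c : F, c ∈ K⟮x⁻¹⟯ := fun c => by rw [adjoin_simple_inv]; exact hx c
  have hv : P.v x⁻¹ < 1 := by
    rw [map_inv₀]; exact inv_lt_one_of_one_lt₀ (one_lt_v_iff.2 hP)
  have hP' := v_le_one_iff.1 hv.le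
  obtain ⟨π, hπ⟩ := exists_isPrimePoly hx' hP'
  have hd : π ∣ Polynomial.X := (hπ.v_lt_one_iff _).1 (by simpa using hv)
  have : π = Polynomial.X := Polynomial.eq_of_monic_of_associated hπ.monic Polynomial.monic_X
    (hπ.irreducible.associated_of_dvd Polynomial.irreducible_X hd)
  subst this
  exact ⟨hπ, hP', hx'⟩

theorem exists_isUniformizer (hx : ∀ c : F, c ∈ K⟮x⟯) (P : Place K F) :
    ∃ t, P.IsUniformizer t := by
  by_cases hP : x ∈ P.ring
  · obtain ⟨π, hπ⟩ := exists_isPrimePoly hx hP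
    exact ⟨_, hπ.isUniformizer hP hx⟩
  · obtain ⟨h1, h2, h3⟩ := isPrimePoly_X_inv hx hP
    exact ⟨_, h1.isUniformizer h2 h3⟩

theorem eq_of_notMem (hx : ∀ c : F, c ∈ K⟮x⟯) {P P' : Place K F} (hP : x ∉ P.ring)
    (hP' : x ∉ P'.ring) : P = P' := by
  obtain ⟨h1, h2, h3⟩ := isPrimePoly_X_inv hx hP
  obtain ⟨h1', h2', -⟩ := isPrimePoly_X_inv hx hP'
  exact h1.ring_eq h2 h1' h2' h3

theorem degree_of_notMem (hx : ∀ c : F, c ∈ K⟮x⟯) {P : Place K F} (hP : x ∉ P.ring) :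
    P.degree = 1 := by
  obtain ⟨h1, h2, h3⟩ := isPrimePoly_X_inv hx hP
  rw [h1.degree_eq h2 h3, Polynomial.natDegree_X]

theorem exists_notMem (hxt : Transcendental K x) : ∃ P : Place K F, x ∉ P.ring := by
  by_contra! h
  exact hxt (isAlgebraic_of_forall_mem h)

/-- If the reduced denominator q were not constant, q(x) would vanish at some place. There x is
finite, since q(x) has no zero at a pole of x, and c fails to be integral. -/
theorem eq_aeval_of_forall_mem (hxt : Transcendental K x) (hx : ∀ c : F, c ∈ K⟮x⟯) {c : F}
    (hc : ∀ P : Place K F, x ∈ P.ring → c ∈ P.ring) : ∃ p : K[X], c = Polynomial.aeval x p := by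
  obtain ⟨p, q, hpq, hq, rfl⟩ := exists_isCoprime_of_mem_adjoin (hx c)
  have hq0 : Polynomial.aeval x q ≠ 0 := fun h => hxt ⟨q, hq, h⟩
  have hu : IsUnit q := by
    by_contra hu
    have hqt : Transcendental K (Polynomial.aeval x q) := hxt.aeval q (fun h => hu
      ((Polynomial.isUnit_iff_degree_eq_zero).2 (by rw [Polynomial.degree_eq_natDegree hq, h]; rfl)))
      (mem_nonZeroDivisors_of_ne_zero (Polynomial.leadingCoeff_ne_zero.2 hq))
    obtain ⟨P, hP⟩ := exists_notMem (transcendental_inv hqt)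
    have hv : P.v (Polynomial.aeval x q) < 1 := v_lt_one_iff.2 (Or.inr hP)
    have hxP : x ∈ P.ring := by
      by_contra hxP
      rw [v_aeval_of_notMem hxP hq] at hv
      exact absurd hv (not_lt.2 (one_le_pow₀ (one_lt_v_iff.2 hxP).le))
    obtain ⟨π, hπ⟩ := exists_isPrimePoly hx hxP
    exact hπ.not_dvd_of_mem hxP hpq (hc P hxP) hq0 ((hπ.v_lt_one_iff q).1 hv)
  obtain ⟨a, ha, rfl⟩ := Polynomial.isUnit_iff.1 hu
  refine ⟨Polynomial.C a⁻¹ * p, ?_⟩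
  rw [map_mul, Polynomial.aeval_C, Polynomial.aeval_C, map_inv₀, div_eq_inv_mul]

end Place

/-! ### Riemann-Roch spaces of a rational function field. -/

namespace PlaceDivisor

variable {K F : Type*} [Field K] [Field F] [Algebra K F] {x : F}

theorem mem_riemannRochSpace_iff {D : PlaceDivisor K F} {f : F} :
    f ∈ D.riemannRochSpace ↔ ∀ (P : Place K F) (t : P.ring), P.IsUniformizer t →
      P.v f * P.v (t : F) ^ (D P) ≤ 1 := by
  have : ∀ (P : Place K F) (t : P.ring), f * (t : F) ^ (D P) ∈ P.ring ↔
      P.v f * P.v (t : F) ^ (D P) ≤ 1 := fun P t => by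
    rw [← Place.v_le_one_iff, map_mul, map_zpow₀]
  simp_rw [← this]
  rfl

/-- On a rational function field every Riemann-Roch space is a multiple of a space of polynomials
of bounded degree. -/
theorem exists_mul_eq_aeval (hxt : Transcendental K x) (hx : ∀ c : F, c ∈ K⟮x⟯)
    (D : PlaceDivisor K F) : ∃ z : F, z ≠ 0 ∧
      (∀ f, f ∈ D.riemannRochSpace ↔
        ∃ p : K[X], (p = 0 ∨ (p.natDegree : ℤ) ≤ D.deg) ∧ f * z = Polynomial.aeval x p) ∧
      (∀ P : Place K F, D P = 0 → x ∈ P.ring → P.v z = 1) ∧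
      (∀ P : Place K F, D P = 0 → x ∉ P.ring → P.v z = P.v x ^ D.deg) := by
  classical
  have hex : ∀ P : Place K F, ∃ π : K[X], (x ∈ P.ring → P.IsPrimePoly x π) ∧
      (x ∉ P.ring → π = 1) := fun P => by
    by_cases hP : x ∈ P.ring
    · obtain ⟨π, hπ⟩ := Place.exists_isPrimePoly hx hP
      exact ⟨π, fun _ => hπ, fun h => absurd hP h⟩
    · exact ⟨1, fun h => absurd h hP, fun _ => rfl⟩
  choose π hπ hπ1 using hex
  have hπ0 : ∀ P, π P ≠ 0 := fun P => by
    by_cases hP : x ∈ P.ring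
    · exact (hπ P hP).irreducible.ne_zero
    · rw [hπ1 P hP]; exact one_ne_zero
  have haev : ∀ {p : K[X]}, p ≠ 0 → Polynomial.aeval x p ≠ 0 := fun hp h => hxt ⟨_, hp, h⟩
  -- The divisor of z is D - (deg D)·∞, with ∞ the pole of x. Multiplication by z thus carries L(D)
  -- to L((deg D)·∞), the polynomials of degree at most deg D.
  set z : F := ∏ P ∈ D.support, Polynomial.aeval x (π P) ^ D P with hz
  have hz0 : z ≠ 0 := Finset.prod_ne_zero_iff.2 fun P _ => zpow_ne_zero _ (haev (hπ0 P))
  have hfin : ∀ P : Place K F, x ∈ P.ring →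
      P.v z = P.v (Polynomial.aeval x (π P)) ^ D P := by
    intro P hP
    rw [hz, map_prod, Finset.prod_eq_single P]
    · rw [map_zpow₀]
    · intro P' _ hne
      rw [map_zpow₀, (hπ P hP).v_eq_one hP, one_zpow]
      intro hd
      by_cases hP' : x ∈ P'.ring
      · have : π P = π P' := Polynomial.eq_of_monic_of_associated (hπ P hP).monic (hπ P' hP').monic
          ((hπ P hP).irreducible.associated_of_dvd (hπ P' hP').irreducible hd)
        have h2 := hπ P hP
        rw [this] at h2
        exact hne ((hπ P' hP').ring_eq hP' h2 hP hx)
      · rw [hπ1 P' hP'] at hd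
        exact (hπ P hP).irreducible.not_isUnit (isUnit_of_dvd_one hd)
    · intro h
      rw [Finsupp.notMem_support_iff.1 h, zpow_zero, map_one]
  have hdeg : ∀ P : Place K F, x ∉ P.ring →
      D.deg = ∑ P' ∈ D.support, D P' * ((π P').natDegree : ℤ) + D P := by
    intro P hP
    have h1 : ∀ P' : Place K F, D P' * (P'.degree : ℤ) =
        D P' * ((π P').natDegree : ℤ) + if P' = P then D P' else 0 := by
      intro P'
      by_cases hP' : x ∈ P'.ring
      · rw [(hπ P' hP').degree_eq hP' hx, if_neg (by rintro rfl; exact hP hP'), add_zero]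
      · rw [Place.degree_of_notMem hx hP', hπ1 P' hP', if_pos (Place.eq_of_notMem hx hP' hP)]
        simp
    rw [PlaceDivisor.deg, Finsupp.sum, Finset.sum_congr rfl fun P' _ => h1 P',
      Finset.sum_add_distrib, Finset.sum_ite_eq']
    congr 1
    split_ifs with h
    · rfl
    · exact (Finsupp.notMem_support_iff.1 h).symm
  have hinf : ∀ P : Place K F, x ∉ P.ring → P.v z = P.v x ^ (D.deg - D P) := by
    intro P hP
    have hvx : P.v x ≠ 0 := (zero_lt_one.trans (Place.one_lt_v_iff.2 hP)).ne'
    have h1 : D.deg - D P = ∑ P' ∈ D.support, D P' * ((π P').natDegree : ℤ) := by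
      rw [hdeg P hP]; ring
    rw [h1, hz, map_prod]
    have h2 : ∀ P', P.v (Polynomial.aeval x (π P') ^ D P') =
        P.v x ^ (D P' * ((π P').natDegree : ℤ)) := fun P' => by
      rw [map_zpow₀, Place.v_aeval_of_notMem hP (hπ0 P'), mul_comm, zpow_mul, zpow_natCast]
    rw [Finset.prod_congr rfl fun P' _ => h2 P']
    induction D.support using Finset.induction_on with
    | empty => simp
    | insert a s ha ih => rw [Finset.prod_insert ha, Finset.sum_insert ha, zpow_add₀ hvx, ih]
  refine ⟨z, hz0, fun f => ?_, fun P hD hP => by rw [hfin P hP, hD, zpow_zero], fun P hD hP => by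
    rw [hinf P hP, hD, sub_zero]⟩
  have hPinf : ∀ P : Place K F, x ∉ P.ring → ∀ t : P.ring, P.IsUniformizer t →
      P.v (t : F) = P.v x⁻¹ := fun P hP t ht => by
    obtain ⟨h1, h2, h3⟩ := Place.isPrimePoly_X_inv hx hP
    rw [Place.v_eq_of_isUniformizer ht (h1.isUniformizer h2 h3)]
    simp
  have hPfin : ∀ P : Place K F, ∀ hP : x ∈ P.ring, ∀ t : P.ring, P.IsUniformizer t →
      P.v (t : F) = P.v (Polynomial.aeval x (π P)) := fun P hP t ht =>
    Place.v_eq_of_isUniformizer ht ((hπ P hP).isUniformizer hP hx)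
  have hinf' : ∀ P : Place K F, x ∉ P.ring → ∀ t : P.ring, P.IsUniformizer t →
      (P.v f * P.v (t : F) ^ (D P) ≤ 1 ↔ P.v (f * z) ≤ P.v x ^ D.deg) := by
    intro P hP t ht
    have hvx : 0 < P.v x := zero_lt_one.trans (Place.one_lt_v_iff.2 hP)
    rw [hPinf P hP t ht, map_inv₀, inv_zpow, ← div_eq_mul_inv, div_le_one₀ (zpow_pos hvx _),
      map_mul, hinf P hP, zpow_sub₀ hvx.ne', mul_div_assoc', div_le_iff₀ (zpow_pos hvx _),
      mul_comm (P.v f), mul_le_mul_iff_right₀ (zpow_pos hvx _)]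
  rw [mem_riemannRochSpace_iff]
  constructor
  · intro hf
    obtain ⟨p, hp⟩ := Place.eq_aeval_of_forall_mem hxt hx (c := f * z) fun P hP => by
      obtain ⟨t, ht⟩ := Place.exists_isUniformizer hx P
      have := hf P t ht
      rwa [hPfin P hP t ht, ← hfin P hP, ← map_mul, Place.v_le_one_iff] at this
    refine ⟨p, ?_, hp⟩
    rw [or_iff_not_imp_left]
    intro hp0
    obtain ⟨P, hP⟩ := Place.exists_notMem hxt
    obtain ⟨t, ht⟩ := Place.exists_isUniformizer hx P
    have h1 := (hinf' P hP t ht).1 (hf P t ht)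
    rw [hp, Place.v_aeval_of_notMem hP hp0, ← zpow_natCast] at h1
    exact (zpow_le_zpow_iff_right₀ (Place.one_lt_v_iff.2 hP)).1 h1
  · rintro ⟨p, hp, hfz⟩ P t ht
    by_cases hP : x ∈ P.ring
    · rw [hPfin P hP t ht, ← hfin P hP, ← map_mul, hfz]
      exact Place.v_aeval_le hP p
    · rw [hinf' P hP t ht, hfz]
      rcases eq_or_ne p 0 with rfl | hp0
      · simp
      · rw [Place.v_aeval_of_notMem hP hp0, ← zpow_natCast]
        exact zpow_le_zpow_right₀ (Place.one_lt_v_iff.2 hP).le (hp.resolve_left hp0)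

/-- The truncation `toNat` accounts for divisors of negative degree, whose space is zero. -/
theorem finrank_riemannRochSpace (hxt : Transcendental K x) (hx : ∀ c : F, c ∈ K⟮x⟯)
    (D : PlaceDivisor K F) : Module.Finite K D.riemannRochSpace ∧
      Module.finrank K D.riemannRochSpace = (D.deg + 1).toNat := by
  obtain ⟨z, hz, hmem, -⟩ := D.exists_mul_eq_aeval hxt hx
  let f : Polynomial.degreeLT K (D.deg + 1).toNat →ₗ[K] F :=
    LinearMap.mulRight K z⁻¹ ∘ₗ (Polynomial.aeval (R := K) x).toLinearMap ∘ₗ Submodule.subtype _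
  have hf : Function.Injective f := by
    intro p q h
    have h' : Polynomial.aeval x p.1 * z⁻¹ = Polynomial.aeval x q.1 * z⁻¹ := h
    exact Subtype.ext (transcendental_iff_injective.1 hxt
      (mul_right_cancel₀ (inv_ne_zero hz) h'))
  have hr : LinearMap.range f = D.riemannRochSpace := by
    ext c
    rw [hmem]
    constructor
    · rintro ⟨⟨p, hp⟩, rfl⟩
      refine ⟨p, ?_, ?_⟩
      · rw [or_iff_not_imp_left]
        intro hp0
        rw [Polynomial.mem_degreeLT, Polynomial.degree_eq_natDegree hp0, Nat.cast_lt] at hp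
        omega
      · change Polynomial.aeval x p * z⁻¹ * z = _
        rw [mul_assoc, inv_mul_cancel₀ hz, mul_one]
    · rintro ⟨p, hp, hc⟩
      refine ⟨⟨p, ?_⟩, ?_⟩
      · rw [Polynomial.mem_degreeLT]
        rcases eq_or_ne p 0 with rfl | hp0
        · simp
        · rw [Polynomial.degree_eq_natDegree hp0, Nat.cast_lt]
          have := hp.resolve_left hp0
          omega
      · change Polynomial.aeval x p * z⁻¹ = c
        rw [← hc, mul_assoc, mul_inv_cancel₀ hz, mul_one]
  have e := (Polynomial.degreeLTEquiv K (D.deg + 1).toNat).symm.trans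
    ((LinearEquiv.ofInjective f hf).trans (LinearEquiv.ofEq _ _ hr))
  exact ⟨Module.Finite.equiv e, by rw [← e.finrank_eq, Module.finrank_fin_fun]⟩

end PlaceDivisor

/-! ### Counting zeros -/

namespace Place

variable {K F : Type*} [Field K] [Field F] [Algebra K F]

theorem finrank_adjoin_simple_inv (y : F) :
    Module.finrank K⟮y⁻¹⟯ F = Module.finrank K⟮y⟯ F := by
  rw [adjoin_simple_inv]

/-- With t = p(x), the element x is a root of p(Y) - t, a polynomial over K(t) of the same degree as
p. -/
theorem finrank_adjoin_aeval_le {x : F} {p : K[X]}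
    (hp : p.natDegree ≠ 0) : Module.finrank K⟮Polynomial.aeval x p⟯ F ≤
      p.natDegree * Module.finrank K⟮x⟯ F := by
  set t := Polynomial.aeval x p with ht
  have hle : K⟮t⟯ ≤ K⟮x⟯ := by
    rw [IntermediateField.adjoin_simple_le_iff, ht]
    exact IntermediateField.algebra_adjoin_le_adjoin K _ (Polynomial.aeval_mem_adjoin_singleton K x)
  rw [← IntermediateField.relfinrank_mul_finrank_top hle]
  refine Nat.mul_le_mul_right _ ?_
  rw [IntermediateField.relfinrank_eq_finrank_of_le hle]
  set P : (K⟮t⟯)[X] := p.map (algebraMap K K⟮t⟯) -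
    Polynomial.C (IntermediateField.AdjoinSimple.gen K t) with hP
  have hPd : P.natDegree = p.natDegree := by
    rw [hP, Polynomial.natDegree_sub_C, Polynomial.natDegree_map]
  have hP0 : P ≠ 0 := by rintro h; rw [h, Polynomial.natDegree_zero] at hPd; exact hp hPd.symm
  have hroot : Polynomial.aeval x P = 0 := by
    rw [hP, map_sub, Polynomial.aeval_map_algebraMap, Polynomial.aeval_C, ← ht]
    exact sub_self t
  have hint : IsIntegral K⟮t⟯ x := IsAlgebraic.isIntegral ⟨P, hP0, hroot⟩
  have heq : IntermediateField.extendScalars hle = IntermediateField.adjoin K⟮t⟯ {x} := by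
    apply le_antisymm
    · intro c hc
      have hc' : c ∈ K⟮x⟯ := hc
      have : K⟮x⟯ ≤ (IntermediateField.adjoin K⟮t⟯ {x}).restrictScalars K := by
        rw [IntermediateField.adjoin_simple_le_iff]
        exact IntermediateField.mem_adjoin_simple_self K⟮t⟯ x
      exact this hc'
    · rw [IntermediateField.adjoin_simple_le_iff]
      exact IntermediateField.mem_adjoin_simple_self K x
  rw [heq, IntermediateField.adjoin.finrank hint, ← hPd]
  exact Polynomial.natDegree_le_of_dvd (minpoly.dvd _ _ hroot) hP0

variable {E : Type*} [Field E] [Algebra E F]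

theorem v_algebraMap_lt_one_iff [Algebra K E] {P : Place K E} {Q : Place K F}
    (h : ∀ c : E, algebraMap E F c ∈ Q.ring ↔ c ∈ P.ring) {c : E} :
    Q.v (algebraMap E F c) < 1 ↔ P.v c < 1 := by
  rw [v_lt_one_iff, v_lt_one_iff, ← map_inv₀, h, map_eq_zero]

theorem v_algebraMap_eq_one_iff [Algebra K E] {P : Place K E} {Q : Place K F}
    (h : ∀ c : E, algebraMap E F c ∈ Q.ring ↔ c ∈ P.ring) {c : E} :
    Q.v (algebraMap E F c) = 1 ↔ P.v c = 1 := by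
  rw [le_antisymm_iff, le_antisymm_iff, v_le_one_iff, v_le_one_iff, h, ← not_lt,
    ← not_lt (b := (1 : P.ring.ValueGroup)), v_algebraMap_lt_one_iff h]

/-- X^q - X + 1 takes the value 1 on all of K. For such p the function p(x) has no zero at a
rational place. -/
theorem exists_poly_without_roots (K : Type*) [Field K] [Finite K] :
    ∃ p : K[X], p.natDegree ≠ 0 ∧ ∀ a, p.eval a ≠ 0 := by
  have := Fintype.ofFinite K
  have hq : 1 < Fintype.card K := Fintype.one_lt_card
  refine ⟨Polynomial.X ^ Fintype.card K - Polynomial.X + 1, ?_, fun a => ?_⟩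
  · rw [show (1 : K[X]) = Polynomial.C 1 from rfl, Polynomial.natDegree_add_C,
      FiniteField.X_pow_card_sub_X_natDegree_eq K hq]
    omega
  · simp [FiniteField.pow_card]

variable [Algebra K E] [IsScalarTower K E F]

/-- A non-zero function in the span of the products of functions of `L(D)` with monomials in
the `y j` has at most as many zeros over rational places off `D` as the degrees suggest. -/
theorem card_zeros_le [Finite K] (hF : FiniteOverTranscendentals K F)
    (hK : ∀ z : F, IsAlgebraic K z → z ∈ Set.range (algebraMap K F)) {x : E}
    (hxt : Transcendental K x) (hx : ∀ c : E, c ∈ K⟮x⟯) (D : PlaceDivisor K E)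
    {ι : Type*} (s : Finset ι) (y : ι → F) (a : ι → ℕ) (hy : ∀ j ∈ s, Transcendental K (y j))
    {f : F} (hf0 : f ≠ 0) (hf : f ∈ Submodule.span K {u : F | ∃ c ∈ D.riemannRochSpace,
      ∃ e : ι → ℕ, (∀ j ∈ s, e j ≤ a j) ∧ u = algebraMap E F c * ∏ j ∈ s, y j ^ e j})
    (Z : Finset (Place K F)) (hZ : ∀ Q ∈ Z, Q.v f < 1 ∧ ∃ P : Place K E, P.degree = 1 ∧ D P = 0 ∧
      ∀ c : E, algebraMap E F c ∈ Q.ring ↔ c ∈ P.ring) :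
    (Z.card : ℤ) ≤ D.deg * Module.finrank K⟮algebraMap E F x⟯ F +
      ∑ j ∈ s, (a j : ℤ) * Module.finrank K⟮y j⟯ F := by
  obtain ⟨z, hz0, hmem, hz1, hz2⟩ := D.exists_mul_eq_aeval hxt hx
  have hl : 0 ≤ D.deg := by
    by_contra hl
    apply hf0
    rw [← Submodule.mem_bot K]
    convert! hf
    rw [eq_comm, Submodule.span_eq_bot]
    rintro u ⟨c, hc, e, -, rfl⟩
    obtain ⟨p, hp, hcz⟩ := (hmem c).1 hc
    have hp0 : p = 0 := hp.resolve_right (by omega)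
    rw [hp0, map_zero] at hcz
    rw [(mul_eq_zero.1 hcz).resolve_right hz0, map_zero, zero_mul]
  obtain ⟨l, hl'⟩ := Int.eq_ofNat_of_zero_le hl
  rw [hl'] at hmem hz2 ⊢
  set X : F := algebraMap E F x with hX
  have hXt : Transcendental K X := (transcendental_algebraMap_iff
    (algebraMap E F).injective).2 hxt
  rcases Z.eq_empty_or_nonempty with rfl | ⟨Q₀, hQ₀⟩
  · simp only [Finset.card_empty, Nat.cast_zero]
    positivity
  obtain ⟨p, hpd, hpr⟩ := exists_poly_without_roots K
  have hp0 : p ≠ 0 := by rintro rfl; simp at hpd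
  set d := p.natDegree with hd
  set w : F := Polynomial.aeval X p with hw
  have hwt : Transcendental K w := hXt.aeval p hpd
    (mem_nonZeroDivisors_of_ne_zero (Polynomial.leadingCoeff_ne_zero.2 hp0))
  have hw0 : w ≠ 0 := fun h => hXt ⟨p, hp0, h⟩
  set h : F := f * algebraMap E F z with hh
  have hz0' : algebraMap E F z ≠ 0 := by simpa using hz0
  -- Over a pole of x the factor z has the value of x^l even where D vanishes, so h alone may lose
  -- the zeros of f there. Division of h^d by w^l repairs this: w has the value of X^d over the pole
  -- of x, and is a unit over the other rational places because p has no root.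
  set g : F := h ^ d * w⁻¹ ^ l with hg
  have hg0 : g ≠ 0 := mul_ne_zero (pow_ne_zero _ (mul_ne_zero hf0 hz0'))
    (pow_ne_zero _ (inv_ne_zero hw0))
  -- The poles of h are at most l (X)_∞ + Σ a_j (y_j)_∞; it suffices to see this on the spanning
  -- products, where c z is a polynomial in x of degree at most l.
  have hbound : ∀ Q : Place K F,
      Q.v (h * (∏ j ∈ s, Q.poleInv (y j) ^ a j) * Q.poleInv X ^ l) ≤ 1 := by
    intro Q
    rw [v_le_one_iff, hh, mul_assoc, mul_assoc]
    refine Submodule.span_induction (p := fun f _ => f * _ ∈ Q.ring) ?_ ?_ ?_ ?_ hf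
    · rintro u ⟨c, hc, e, he, rfl⟩
      obtain ⟨r, hr, hcz⟩ := (hmem c).1 hc
      have hcz' : algebraMap E F c * algebraMap E F z = Polynomial.aeval X r := by
        rw [← map_mul, hcz, hX, Polynomial.aeval_algebraMap_apply]
      have e1 : (algebraMap E F c * ∏ j ∈ s, y j ^ e j) * (algebraMap E F z *
          ((∏ j ∈ s, Q.poleInv (y j) ^ a j) * Q.poleInv X ^ l)) =
          (Polynomial.aeval X r * Q.poleInv X ^ l) *
            ∏ j ∈ s, (y j ^ e j * Q.poleInv (y j) ^ a j) := by
        rw [← hcz', Finset.prod_mul_distrib]; ring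
      rw [e1]
      refine mul_mem (v_le_one_iff.1 ?_) (prod_mem fun j hj => v_le_one_iff.1 ?_)
      · by_cases hXQ : X ∈ Q.ring
        · rw [poleInv_of_mem hXQ, one_pow, mul_one]
          exact v_aeval_le hXQ r
        · rcases eq_or_ne r 0 with rfl | hr0
          · simp
          · have hrl : r.natDegree ≤ l := by exact_mod_cast hr.resolve_left hr0
            have hvX : 1 < Q.v X := one_lt_v_iff.2 hXQ
            rw [poleInv_of_notMem hXQ, map_mul, v_aeval_of_notMem hXQ hr0, map_pow, map_inv₀,
              inv_pow, ← div_eq_mul_inv, div_le_one₀ (pow_pos (zero_lt_one.trans hvX) _)]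
            exact pow_le_pow_right₀ hvX.le hrl
      · obtain ⟨t, ht⟩ := Nat.exists_eq_add_of_le (he j hj)
        rw [ht, pow_add, ← mul_assoc, ← mul_pow, map_mul, map_pow, map_pow]
        exact mul_le_one' (pow_le_one₀ zero_le (Q.v_mul_poleInv_le _))
          (pow_le_one₀ zero_le (Q.v_poleInv_le _))
    · rw [zero_mul]; exact Q.ring.zero_mem
    · intro u u' _ _ hu hu'
      rw [add_mul]; exact Q.ring.add_mem _ _ hu hu'
    · intro c u _ hu
      rw [Algebra.smul_def, mul_assoc]; exact Q.ring.mul_mem _ _ (Q.algebraMap_mem c) hu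
  have hzero : ∀ Q ∈ Z, Q.v g = Q.v f ^ d := by
    intro Q hQ
    obtain ⟨-, P, hP1, hPD, hPQ⟩ := hZ Q hQ
    have e1 : g = f ^ d * (algebraMap E F z ^ d * w⁻¹ ^ l) := by rw [hg, hh, mul_pow]; ring
    have e2 : Q.v (algebraMap E F z ^ d * w⁻¹ ^ l) = 1 := by
      by_cases hxP : x ∈ P.ring
      · have h1 : Q.v (algebraMap E F z) = 1 := (v_algebraMap_eq_one_iff hPQ).2 (hz1 P hPD hxP)
        have h2 : Q.v w = 1 := by
          rw [hw, hX, Polynomial.aeval_algebraMap_apply, v_algebraMap_eq_one_iff hPQ]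
          obtain ⟨π, hπ⟩ := exists_isPrimePoly hx hxP
          apply hπ.v_eq_one hxP
          intro hdvd
          have hπ1 : π.degree = 1 := by
            rw [Polynomial.degree_eq_natDegree hπ.irreducible.ne_zero, ← hπ.degree_eq hxP hx, hP1]
            rfl
          obtain ⟨b, hb⟩ := Polynomial.exists_root_of_degree_eq_one hπ1
          exact hpr b (hb.dvd hdvd)
        rw [map_mul, map_pow, map_pow, map_inv₀, h1, h2]
        simp
      · have hXQ : X ∉ Q.ring := by rwa [hX, hPQ]
        have hvX : Q.v X ≠ 0 := (zero_lt_one.trans (one_lt_v_iff.2 hXQ)).ne'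
        have hvx : P.v x ≠ 0 := (zero_lt_one.trans (one_lt_v_iff.2 hxP)).ne'
        have h1 : Q.v (algebraMap E F (z / x ^ l)) = 1 := by
          rw [v_algebraMap_eq_one_iff hPQ, map_div₀, hz2 P hPD hxP, map_pow, zpow_natCast,
            div_self (pow_ne_zero _ hvx)]
        rw [map_div₀, map_pow, map_div₀, map_pow, ← hX,
          div_eq_one_iff_eq (pow_ne_zero _ hvX)] at h1
        rw [map_mul, map_pow, map_pow, map_inv₀, h1, hw, v_aeval_of_notMem hXQ hp0, ← hd,
          inv_pow, ← pow_mul, ← pow_mul, mul_comm l d, mul_inv_cancel₀ (pow_ne_zero _ hvX)]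
    rw [e1, map_mul, e2, mul_one, map_pow]
  have hgt : Transcendental K g := by
    refine transcendental_of_v_lt_one (P := Q₀) ?_ hg0
    rw [hzero Q₀ hQ₀]
    exact pow_lt_one₀ zero_le (hZ Q₀ hQ₀).1 hpd
  have hlow := mul_card_le_finrank_adjoin hF hgt Z d
    (fun Q hQ => ⟨f, hf0, (hZ Q hQ).1, hzero Q hQ⟩) hpd
  -- The index `none` carries w⁻¹ with multiplicity l: dividing by w^l trades the poles of h^d along
  -- (X)_∞ for poles at the zeros of w.
  have hup := finrank_adjoin_le_of_poles hF hK hgt (Finset.insertNone s)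
    (fun o => o.elim w⁻¹ y) (fun o => o.elim l fun j => d * a j) (by
      intro o ho
      cases o with
      | none => exact transcendental_inv hwt
      | some j => exact hy j (by simpa using ho)) (by
      intro Q
      rw [Finset.prod_insertNone, ← v_le_one_iff]
      simp only [Option.elim]
      have e1 : ∏ j ∈ s, Q.poleInv (y j) ^ (d * a j) = (∏ j ∈ s, Q.poleInv (y j) ^ a j) ^ d := by
        rw [← Finset.prod_pow]
        exact Finset.prod_congr rfl fun j _ => by rw [← pow_mul, mul_comm]
      rw [e1]
      have hb := hbound Q
      by_cases hXQ : X ∈ Q.ring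
      · rw [poleInv_of_mem hXQ, one_pow, mul_one] at hb
        have e2 : g * (Q.poleInv w⁻¹ ^ l * (∏ j ∈ s, Q.poleInv (y j) ^ a j) ^ d) =
            (w⁻¹ * Q.poleInv w⁻¹) ^ l * (h * ∏ j ∈ s, Q.poleInv (y j) ^ a j) ^ d := by
          rw [hg, mul_pow, mul_pow]; ring
        rw [e2, map_mul, map_pow, map_pow]
        exact mul_le_one' (pow_le_one₀ zero_le (Q.v_mul_poleInv_le _)) (pow_le_one₀ zero_le hb)
      · have hvX : 1 < Q.v X := one_lt_v_iff.2 hXQ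
        have hvw : Q.v w = Q.v X ^ d := v_aeval_of_notMem hXQ hp0
        have hwm : w⁻¹ ∈ Q.ring := by
          rw [← v_le_one_iff, map_inv₀, hvw]
          exact inv_le_one_of_one_le₀ (one_le_pow₀ hvX.le)
        rw [poleInv_of_notMem hXQ] at hb
        have e2 : Q.v (g * (Q.poleInv w⁻¹ ^ l * (∏ j ∈ s, Q.poleInv (y j) ^ a j) ^ d)) =
            Q.v (h * (∏ j ∈ s, Q.poleInv (y j) ^ a j) * X⁻¹ ^ l) ^ d := by
          rw [poleInv_of_mem hwm, one_pow, one_mul, hg]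
          simp only [map_mul, map_pow, map_inv₀, hvw]
          rw [mul_pow, mul_pow, ← inv_pow, ← pow_mul, ← pow_mul, mul_comm l d]
          exact mul_right_comm _ _ _
        rw [e2]
        exact pow_le_one₀ zero_le hb)
  rw [Finset.sum_insertNone] at hup
  have hup : Module.finrank K⟮g⟯ F ≤ l * Module.finrank K⟮w⁻¹⟯ F +
      ∑ j ∈ s, d * a j * Module.finrank K⟮y j⟯ F := hup
  rw [finrank_adjoin_simple_inv] at hup
  have hup2 := finrank_adjoin_aeval_le (x := X) hpd
  rw [← hw, ← hd] at hup2
  -- Since [F : K(w)] ≤ d [F : K(X)], every term of the upper bound carries the factor d, as does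
  -- the number of zeros.
  have hfinal : d * Z.card ≤ d * (l * Module.finrank K⟮X⟯ F +
      ∑ j ∈ s, a j * Module.finrank K⟮y j⟯ F) := by
    refine hlow.trans (hup.trans ?_)
    rw [mul_add, Finset.mul_sum]
    refine add_le_add ?_ (Finset.sum_le_sum fun j _ => by rw [mul_assoc])
    calc l * Module.finrank K⟮w⟯ F ≤ l * (d * Module.finrank K⟮X⟯ F) := Nat.mul_le_mul_left _ hup2
      _ = _ := by ring
  have := Nat.le_of_mul_le_mul_left hfinal (Nat.pos_of_ne_zero hpd)
  exact_mod_cast this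

end Place

/-! ### Rational places in extensions -/

/-- A finite extension of `K(X)` is finite over each `K(y)` with `y` transcendental. -/
theorem FiniteOverTranscendentals.of_finiteDimensional {K F : Type*} [Field K] [Field F]
    [Algebra K F] (X : F) [FiniteDimensional K⟮X⟯ F] : FiniteOverTranscendentals K F := by
  intro y hy
  have halgX : Algebra.IsAlgebraic (Algebra.adjoin K {X}) F := by
    open scoped IntermediateField.algebraAdjoinAdjoin in
    exact (IsFractionRing.comap_isAlgebraic_iff (A := Algebra.adjoin K {X}) (K := K⟮X⟯)
      (C := F)).2 inferInstance
  -- Transcendence degree at most one makes y alone a transcendence basis. Then F is algebraic and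
  -- finitely generated over K(y), hence finite.
  have htr : Algebra.trdeg K F ≤ 1 := by
    simpa using Algebra.IsAlgebraic.trdeg_le_cardinalMk K {X}
  have hind : AlgebraicIndependent K (fun _ : Unit => y) :=
    (algebraicIndependent_unique_type_iff).2 hy
  have hbasis : IsTranscendenceBasis K (fun _ : Unit => y) :=
    hind.isTranscendenceBasis_of_lift_trdeg_le_of_finite (by simpa using htr)
  have halg := hbasis.isAlgebraic_field
  rw [Set.range_const] at halg
  have hEss1 : Algebra.EssFiniteType K K⟮X⟯ :=
    IntermediateField.essFiniteType_iff.2 ⟨{X}, by simp⟩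
  have hEss : Algebra.EssFiniteType K F := Algebra.EssFiniteType.comp K K⟮X⟯ F
  have hEss' : Algebra.EssFiniteType K⟮y⟯ F := Algebra.EssFiniteType.of_comp K K⟮y⟯ F
  obtain ⟨S, hS⟩ := IntermediateField.fg_top K⟮y⟯ F
  have hfd : FiniteDimensional K⟮y⟯ (IntermediateField.adjoin K⟮y⟯ (S : Set F)) :=
    IntermediateField.finiteDimensional_adjoin fun z _ => (halg.isAlgebraic z).isIntegral
  rw [hS] at hfd
  exact Module.Finite.equiv (IntermediateField.topEquiv (F := K⟮y⟯) (E := F)).toLinearEquiv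

namespace Place

variable {K F E : Type*} [Field K] [Field F] [Field E] [Algebra K F] [Algebra K E]

theorem exists_v_lt_one (P : Place K F) : ∃ b, b ≠ 0 ∧ P.v b < 1 := by
  by_contra! h
  refine P.ne_top (top_le_iff.1 fun c _ => ?_)
  rcases eq_or_ne c 0 with rfl | hc
  · exact P.ring.zero_mem
  · by_contra hcP
    have h1 := h c⁻¹ (inv_ne_zero hc)
    rw [map_inv₀] at h1
    exact absurd (inv_lt_one_of_one_lt₀ (one_lt_v_iff.2 hcP)) (not_lt.2 h1)

theorem hasValue_iff {P : Place K F} {f : F} {a : K} :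
    P.HasValue f a ↔ P.v (f - algebraMap K F a) < 1 := Iff.rfl

theorem HasValue.unique {P : Place K F} {f : F} {a a' : K} (h : P.HasValue f a)
    (h' : P.HasValue f a') : a = a' := by
  rw [← sub_eq_zero]
  refine eq_zero_of_v_algebraMap_lt (P := P) ?_
  have e : algebraMap K F (a - a') = (f - algebraMap K F a') - (f - algebraMap K F a) := by
    rw [map_sub]; ring
  rw [e]
  exact P.v.map_sub_lt h' h

theorem HasValue.value_eq {P : Place K F} {f : F} {a : K} (h : P.HasValue f a) :
    P.value f = a :=
  HasValue.unique (Classical.epsilon_spec (p := P.HasValue f) ⟨a, h⟩) h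

theorem HasValue.mem {P : Place K F} {f : F} {a : K} (h : P.HasValue f a) : f ∈ P.ring := by
  have := P.ring.add_mem _ _ (v_le_one_iff.1 (le_of_lt h)) (P.algebraMap_mem a)
  rwa [sub_add_cancel] at this

theorem hasValue_algebraMap (P : Place K F) (a : K) : P.HasValue (algebraMap K F a) a := by
  simp [hasValue_iff]

theorem HasValue.add {P : Place K F} {f f' : F} {a a' : K} (h : P.HasValue f a)
    (h' : P.HasValue f' a') : P.HasValue (f + f') (a + a') := by
  have e : f + f' - algebraMap K F (a + a') =
      (f - algebraMap K F a) + (f' - algebraMap K F a') := by rw [map_add]; ring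
  rw [hasValue_iff, e]
  exact P.v.map_add_lt h h'

theorem HasValue.mul {P : Place K F} {f f' : F} {a a' : K} (h : P.HasValue f a)
    (h' : P.HasValue f' a') : P.HasValue (f * f') (a * a') := by
  have e : f * f' - algebraMap K F (a * a') =
      (f - algebraMap K F a) * f' + algebraMap K F a * (f' - algebraMap K F a') := by
    rw [map_mul]; ring
  rw [hasValue_iff, e]
  refine P.v.map_add_lt ?_ ?_
  · rw [map_mul, mul_comm]
    exact mul_lt_one_of_nonneg_of_lt_one_right (v_le_one_iff.2 h'.mem) zero_le h
  · rw [map_mul]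
    exact mul_lt_one_of_nonneg_of_lt_one_right (P.v_algebraMap_le a) zero_le h'

theorem HasValue.pow {P : Place K F} {f : F} {a : K} (h : P.HasValue f a) (k : ℕ) :
    P.HasValue (f ^ k) (a ^ k) := by
  induction k with
  | zero => simpa using P.hasValue_algebraMap 1
  | succ k ih => rw [pow_succ, pow_succ]; exact ih.mul h

theorem degree_eq_one_iff {P : Place K F} :
    P.degree = 1 ↔ ∀ f ∈ P.ring, ∃ a, P.HasValue f a := by
  have key : ∀ (f : P.ring) (a : K), a • (1 : IsLocalRing.ResidueField P.ring) =
      IsLocalRing.residue P.ring f ↔ P.HasValue (f : F) a := by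
    intro f a
    rw [← Algebra.algebraMap_eq_smul_one, eq_comm]
    change Ideal.Quotient.mk _ f = Ideal.Quotient.mk _ (algebraMap K P.ring a) ↔ _
    rw [Ideal.Quotient.eq, P.ring.valuation_lt_one_iff]
    rfl
  rw [degree, finrank_eq_one_iff_of_nonzero' (1 : IsLocalRing.ResidueField P.ring) one_ne_zero]
  constructor
  · intro h f hf
    obtain ⟨a, ha⟩ := h (IsLocalRing.residue P.ring ⟨f, hf⟩)
    exact ⟨a, (key ⟨f, hf⟩ a).1 ha⟩
  · intro h w
    obtain ⟨f, rfl⟩ := IsLocalRing.residue_surjective w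
    obtain ⟨a, ha⟩ := h f f.2
    exact ⟨a, (key f a).2 ha⟩

variable [Algebra E F] [IsScalarTower K E F]

theorem degree_eq_one_of_over {P : Place K E} {Q : Place K F}
    (h : ∀ c : E, algebraMap E F c ∈ Q.ring ↔ c ∈ P.ring) (hQ : Q.degree = 1) :
    P.degree = 1 := by
  rw [degree_eq_one_iff] at hQ ⊢
  intro c hc
  obtain ⟨a, ha⟩ := hQ _ ((h c).2 hc)
  refine ⟨a, ?_⟩
  rw [hasValue_iff, IsScalarTower.algebraMap_apply K E F, ← map_sub,
    v_algebraMap_lt_one_iff h] at ha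
  exact ha

theorem HasValue.of_over {P : Place K E} {Q : Place K F}
    (h : ∀ c : E, algebraMap E F c ∈ Q.ring ↔ c ∈ P.ring) {c : E} {a : K}
    (hc : P.HasValue c a) : Q.HasValue (algebraMap E F c) a := by
  rw [hasValue_iff, IsScalarTower.algebraMap_apply K E F, ← map_sub, v_algebraMap_lt_one_iff h]
  exact hc

/-- The contraction is a proper subring: otherwise Q would be a place of F over the constant field
E, and an element of positive order would be transcendental over E. -/
theorem exists_under [Algebra.IsAlgebraic E F] (Q : Place K F) :
    ∃ P : Place K E, Q.ring.comap (algebraMap E F) = P.ring := by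
  refine ⟨⟨Q.ring.comap (algebraMap E F), fun a => ?_, fun htop => ?_⟩, rfl⟩
  · change algebraMap E F (algebraMap K E a) ∈ Q.ring
    rw [← IsScalarTower.algebraMap_apply]
    exact Q.algebraMap_mem a
  · have hE : ∀ c : E, algebraMap E F c ∈ Q.ring := fun c => by
      change c ∈ Q.ring.comap (algebraMap E F)
      rw [htop]; trivial
    let Q' : Place E F := ⟨Q.ring, hE, Q.ne_top⟩
    obtain ⟨b, hb0, hb⟩ := Q'.exists_v_lt_one
    exact transcendental_of_v_lt_one hb hb0 (Algebra.IsAlgebraic.isAlgebraic b)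

/-- The fundamental inequality with maximal ideals as `I Q`: ramification is discarded and only
residue degrees are summed. -/
theorem sum_degree_le [FiniteDimensional E F] (hF : FiniteOverTranscendentals K F)
    {P : Place K E} (hP : P.degree = 1) (T : Finset (Place K F))
    (hT : ∀ Q ∈ T, ∀ c : E, algebraMap E F c ∈ Q.ring ↔ c ∈ P.ring) :
    (∀ Q ∈ T, 0 < Q.degree) ∧ ∑ Q ∈ T, Q.degree ≤ Module.finrank E F := by
  choose b hb0 hb using fun Q : Place K F => Q.exists_v_lt_one
  obtain ⟨hfin, hle⟩ := finrank_pi_quotient_le hF P T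
    (fun Q => IsLocalRing.maximalIdeal Q.ring) b hb0 (fun Q _ x hx =>
      (Q.ring.valuation_lt_one_iff x).2 ((mem_ballIdeal.1 hx).trans_lt (hb Q))) (fun c hc => by
    obtain ⟨a, ha⟩ := degree_eq_one_iff.1 hP c hc
    refine ⟨a, fun Q hQ => ?_⟩
    have h1 := HasValue.of_over (hT Q hQ) ha
    exact ⟨v_le_one_iff.1 (le_of_lt h1), (Q.ring.valuation_lt_one_iff _).2 h1⟩)
  have hfin' : ∀ Q : T, Module.Finite K (Q.1.ring ⧸ IsLocalRing.maximalIdeal Q.1.ring) :=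
    fun Q => by
      classical
      exact Module.Finite.of_surjective
        (LinearMap.proj (R := K)
          (φ := fun Q : T => Q.1.ring ⧸ IsLocalRing.maximalIdeal Q.1.ring) Q)
        (LinearMap.proj_surjective Q)
  refine ⟨fun Q hQ => ?_, ?_⟩
  · have : Module.Finite K (Q.ring ⧸ IsLocalRing.maximalIdeal Q.ring) := hfin' ⟨Q, hQ⟩
    have : Nontrivial (Q.ring ⧸ IsLocalRing.maximalIdeal Q.ring) :=
      Ideal.Quotient.nontrivial_iff.2 (IsLocalRing.maximalIdeal.isMaximal _).ne_top
    exact Module.finrank_pos (R := K) (M := Q.ring ⧸ IsLocalRing.maximalIdeal Q.ring)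
  · rw [Module.finrank_pi_fintype] at hle
    rw [← Finset.sum_coe_sort]
    exact hle

theorem finite_over_and_ncard_le [FiniteDimensional E F] (hF : FiniteOverTranscendentals K F)
    {P : Place K E} (hP : P.degree = 1) :
    {Q : Place K F | ∀ c : E, algebraMap E F c ∈ Q.ring ↔ c ∈ P.ring}.Finite ∧
    {Q : Place K F | ∀ c : E, algebraMap E F c ∈ Q.ring ↔ c ∈ P.ring}.ncard ≤
      Module.finrank E F := by
  have key : ∀ T : Finset (Place K F),
      (T : Set (Place K F)) ⊆ {Q | ∀ c : E, algebraMap E F c ∈ Q.ring ↔ c ∈ P.ring} →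
      T.card ≤ Module.finrank E F := by
    intro T hT
    obtain ⟨h1, h2⟩ := sum_degree_le hF hP T fun Q hQ => hT hQ
    refine le_trans ?_ h2
    rw [Finset.card_eq_sum_ones]
    exact Finset.sum_le_sum h1
  have hfin : {Q : Place K F | ∀ c : E, algebraMap E F c ∈ Q.ring ↔ c ∈ P.ring}.Finite := by
    by_contra hinf
    obtain ⟨T, hT, hcard⟩ := Set.Infinite.exists_subset_card_eq hinf (Module.finrank E F + 1)
    have := key T hT
    omega
  refine ⟨hfin, ?_⟩
  rw [Set.ncard_eq_toFinset_card _ hfin]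
  exact key _ (by simp)

/-- There are [F : E] places of degree at least 1 each, of total degree at most [F : E]. -/
theorem degree_eq_one_of_ncard_eq [FiniteDimensional E F] (hF : FiniteOverTranscendentals K F)
    {P : Place K E} (hP : P.degree = 1)
    (h : {Q : Place K F | ∀ c : E, algebraMap E F c ∈ Q.ring ↔ c ∈ P.ring}.ncard =
      Module.finrank E F) {Q : Place K F} (hQ : ∀ c : E, algebraMap E F c ∈ Q.ring ↔ c ∈ P.ring) :
    Q.degree = 1 := by
  obtain ⟨hfin, -⟩ := finite_over_and_ncard_le hF hP (E := E) (F := F)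
  obtain ⟨h1, h2⟩ := sum_degree_le hF hP hfin.toFinset fun Q hQ => by simpa using hQ
  rw [← h, Set.ncard_eq_toFinset_card _ hfin, Finset.card_eq_sum_ones] at h2
  have h3 := (Finset.sum_eq_sum_iff_of_le h1).1 (le_antisymm (Finset.sum_le_sum h1) h2)
  exact (h3 Q (by simpa using hQ)).symm

end Place

/-! ### Sequences of function fields -/

theorem IntermediateField.finrank_inclusion {K Ω : Type*} [Field K] [Field Ω] [Algebra K Ω]
    {L M : IntermediateField K Ω} (h : L ≤ M) :
    letI := (IntermediateField.inclusion h).toRingHom.toAlgebra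
    Module.finrank L M = IntermediateField.relfinrank L M := by
  let := (IntermediateField.inclusion h).toRingHom.toAlgebra
  rw [IntermediateField.relfinrank_eq_finrank_of_le h]
  let e : M ≃ₗ[L] IntermediateField.extendScalars h :=
    { toFun := fun x => ⟨x.1, x.2⟩
      invFun := fun x => ⟨x.1, x.2⟩
      map_add' := fun _ _ => rfl
      map_smul' := fun _ _ => rfl
      left_inv := fun _ => rfl
      right_inv := fun _ => rfl }
  exact e.finrank_eq

theorem Finset.ncard_biUnion_eq_mul {α β : Type*} (S : Finset α) (A : α → Set β)
    (hd : ∀ P ∈ S, ∀ P' ∈ S, ∀ x, x ∈ A P → x ∈ A P' → P = P') {c : ℕ}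
    (hfin : ∀ P ∈ S, (A P).Finite) (hc : ∀ P ∈ S, (A P).ncard = c) :
    {x | ∃ P ∈ S, x ∈ A P}.Finite ∧ {x | ∃ P ∈ S, x ∈ A P}.ncard = c * S.card := by
  classical
  induction S using Finset.induction_on with
  | empty => simp
  | insert P S hP ih =>
    obtain ⟨h1, h2⟩ := ih
      (fun P hP P' hP' => hd P (Finset.mem_insert_of_mem hP) P' (Finset.mem_insert_of_mem hP'))
      (fun P hP => hfin P (Finset.mem_insert_of_mem hP))
      (fun P hP => hc P (Finset.mem_insert_of_mem hP))
    have e : {x | ∃ P' ∈ insert P S, x ∈ A P'} = A P ∪ {x | ∃ P' ∈ S, x ∈ A P'} := by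
      ext x; simp
    have hPf := hfin P (Finset.mem_insert_self _ _)
    rw [e]
    refine ⟨hPf.union h1, ?_⟩
    rw [Set.ncard_union_eq _ hPf h1, h2, hc P (Finset.mem_insert_self _ _),
      Finset.card_insert_of_notMem hP]
    · ring
    · rw [Set.disjoint_left]
      rintro x hx ⟨P', hP', hx'⟩
      have := hd P (Finset.mem_insert_self _ _) P' (Finset.mem_insert_of_mem hP') x hx hx'
      exact hP (this ▸ hP')

namespace FunctionFieldSequence

variable {K Ω : Type*} [Field K] [Field Ω] [Algebra K Ω] (T : FunctionFieldSequence K Ω)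

/-- The inclusion of `F j` into `F i` as an algebra structure. -/
noncomputable abbrev algebraOfLE {j i : ℕ} (h : j ≤ i) : Algebra (T.F j) (T.F i) :=
  (IntermediateField.inclusion (T.F_mono h)).toRingHom.toAlgebra

theorem isScalarTower_of_le {j i : ℕ} (h : j ≤ i) :
    letI := T.algebraOfLE h
    IsScalarTower K (T.F j) (T.F i) :=
  letI := T.algebraOfLE h
  IsScalarTower.of_algebraMap_eq fun _ => rfl

theorem m_succ_pos (j : ℕ) : 0 < T.m (j + 1) := by
  have := T.finite j
  rw [m, Nat.add_sub_cancel, IntermediateField.relfinrank_eq_finrank_of_le (T.lt_succ j).le]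
  exact Module.finrank_pos

/-- The tower is strict. This makes the truncated differences m_i - 1 and m_i - 2 genuine ones. -/
theorem two_le_m_succ (j : ℕ) : 2 ≤ T.m (j + 1) := by
  have h0 := T.m_succ_pos j
  have h1 : T.m (j + 1) ≠ 1 := fun h => by
    rw [m, Nat.add_sub_cancel, IntermediateField.relfinrank_eq_one_iff] at h
    exact absurd h (T.lt_succ j).not_ge
  omega

theorem relfinrank_zero (i : ℕ) :
    IntermediateField.relfinrank (T.F 0) (T.F i) = ∏ j ∈ Finset.Icc 1 i, T.m j := by
  induction i with
  | zero => simp [IntermediateField.relfinrank_self]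
  | succ i ih =>
    rw [Finset.prod_Icc_succ_top (by omega), ← ih, m, Nat.add_sub_cancel,
      IntermediateField.relfinrank_mul_relfinrank (T.F_mono (Nat.zero_le i)) (T.lt_succ i).le]

theorem prod_m_pos (i : ℕ) : 0 < ∏ j ∈ Finset.Icc 1 i, T.m j :=
  Finset.prod_pos fun j hj => by
    obtain ⟨k, rfl⟩ : ∃ k, j = k + 1 := ⟨j - 1, by have := (Finset.mem_Icc.1 hj).1; omega⟩
    exact T.m_succ_pos k

theorem relfinrank_pos {j i : ℕ} (h : j ≤ i) :
    0 < IntermediateField.relfinrank (T.F j) (T.F i) := by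
  have h1 := IntermediateField.relfinrank_mul_relfinrank (T.F_mono (Nat.zero_le j)) (T.F_mono h)
  rw [T.relfinrank_zero i] at h1
  exact Nat.pos_of_ne_zero fun h2 => by
    rw [h2, mul_zero] at h1
    exact (T.prod_m_pos i).ne h1

theorem finiteDimensional_of_le {j i : ℕ} (h : j ≤ i) :
    letI := T.algebraOfLE h
    FiniteDimensional (T.F j) (T.F i) := by
  let := T.algebraOfLE h
  apply Module.finite_of_finrank_pos
  rw [IntermediateField.finrank_inclusion]
  exact T.relfinrank_pos h

/-- Moves the degree from subfields of Ω into F_i itself, where the bounds on zeros and poles are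
available. -/
theorem h_eq {j i : ℕ} (hji : j ≤ i) : T.h i j = Module.finrank K⟮T.gen hji⟯ (T.F i) := by
  have h1 := IntermediateField.relfinrank_map_map K⟮T.gen hji⟯ ⊤ (T.F i).val
  rw [IntermediateField.relfinrank_top_right] at h1
  rw [← h1, h, IntermediateField.adjoin_map, Set.image_singleton, ← AlgHom.fieldRange_eq_map,
    IntermediateField.fieldRange_val]
  rfl

theorem transcendental_gen {j i : ℕ} (hji : j ≤ i) : Transcendental K (T.gen hji) := fun h =>
  T.transcendental j ((isAlgebraic_algHom_iff (T.F i).val Subtype.val_injective).2 h)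

theorem h_zero (i : ℕ) : T.h i 0 = ∏ j ∈ Finset.Icc 1 i, T.m j := by
  rw [h, ← T.zero_eq, relfinrank_zero]

theorem finiteOverTranscendentals (i : ℕ) : FiniteOverTranscendentals K (T.F i) := by
  have : FiniteDimensional K⟮T.gen (Nat.zero_le i)⟯ (T.F i) := by
    apply Module.finite_of_finrank_pos
    rw [← h_eq, h_zero]
    exact T.prod_m_pos i
  exact FiniteOverTranscendentals.of_finiteDimensional (T.gen (Nat.zero_le i))

theorem isAlgebraic_mem_range {i : ℕ} {z : T.F i} (hz : IsAlgebraic K z) :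
    z ∈ Set.range (algebraMap K (T.F i)) := by
  obtain ⟨c, hc⟩ := T.constants i z z.2
    ((isAlgebraic_algHom_iff (T.F i).val Subtype.val_injective).2 hz)
  exact ⟨c, Subtype.ext hc⟩

theorem mem_adjoin_gen_zero (c : T.F 0) : c ∈ K⟮T.gen (le_refl 0)⟯ := by
  have h1 : (c : Ω) ∈ K⟮T.x 0⟯ := by rw [← T.zero_eq]; exact c.2
  obtain ⟨r, s, hrs⟩ := (IntermediateField.mem_adjoin_simple_iff K _).1 h1
  refine (IntermediateField.mem_adjoin_simple_iff K _).2 ⟨r, s, Subtype.ext ?_⟩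
  rw [hrs]
  have hx : T.x 0 = algebraMap (T.F 0) Ω (T.gen (le_refl 0)) := rfl
  rw [hx, Polynomial.aeval_algebraMap_apply, Polynomial.aeval_algebraMap_apply, ← map_div₀]
  rfl

/-! ### Places above one another in the tower. -/

variable {T}

theorem over_iff {j i : ℕ} {hji : j ≤ i} {Q : Place K (T.F i)} {P : Place K (T.F j)} :
    T.Over hji Q P ↔ ∀ c : T.F j,
      IntermediateField.inclusion (T.F_mono hji) c ∈ Q.ring ↔ c ∈ P.ring := by
  rw [Over, Place.LiesOver, SetLike.ext_iff]
  rfl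

theorem Over.trans {a b c : ℕ} {hab : a ≤ b} {hbc : b ≤ c} {Q : Place K (T.F c)}
    {R : Place K (T.F b)} {P : Place K (T.F a)} (h1 : T.Over hbc Q R) (h2 : T.Over hab R P) :
    T.Over (hab.trans hbc) Q P := by
  rw [over_iff] at *
  intro f
  rw [← h2, ← h1]
  rfl

theorem Over.of_trans {a b c : ℕ} {hab : a ≤ b} {hbc : b ≤ c} {Q : Place K (T.F c)}
    {R : Place K (T.F b)} {P : Place K (T.F a)} (h1 : T.Over hbc Q R)
    (h2 : T.Over (hab.trans hbc) Q P) : T.Over hab R P := by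
  rw [over_iff] at *
  intro f
  rw [← h2, ← h1]
  rfl

theorem Over.unique {j i : ℕ} {hji : j ≤ i} {Q : Place K (T.F i)} {P P' : Place K (T.F j)}
    (h : T.Over hji Q P) (h' : T.Over hji Q P') : P = P' :=
  Place.ext (Eq.trans (Eq.symm h) h')

theorem exists_over {j i : ℕ} (hji : j ≤ i) (Q : Place K (T.F i)) :
    ∃ P, T.Over hji Q P := by
  let := T.algebraOfLE hji
  have := T.isScalarTower_of_le hji
  have := T.finiteDimensional_of_le hji
  exact Place.exists_under (E := T.F j) Q

theorem finite_over_and_ncard_le {j i : ℕ} (hji : j ≤ i) {P : Place K (T.F j)}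
    (hP : P.degree = 1) : {Q | T.Over hji Q P}.Finite ∧
      {Q | T.Over hji Q P}.ncard ≤ IntermediateField.relfinrank (T.F j) (T.F i) := by
  let := T.algebraOfLE hji
  have := T.isScalarTower_of_le hji
  have := T.finiteDimensional_of_le hji
  rw [← IntermediateField.finrank_inclusion (T.F_mono hji)]
  simp_rw [over_iff]
  exact Place.finite_over_and_ncard_le (T.finiteOverTranscendentals i) hP

theorem degree_eq_one_of_over {j i : ℕ} {hji : j ≤ i} {Q : Place K (T.F i)}
    {P : Place K (T.F j)} (h : T.Over hji Q P) (hQ : Q.degree = 1) : P.degree = 1 := by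
  let := T.algebraOfLE hji
  have := T.isScalarTower_of_le hji
  have h' : ∀ c : T.F j, algebraMap (T.F j) (T.F i) c ∈ Q.ring ↔ c ∈ P.ring := over_iff.1 h
  exact Place.degree_eq_one_of_over (E := T.F j) (F := T.F i) (P := P) (Q := Q) h' hQ

theorem hasValue_of_over {j i : ℕ} {hji : j ≤ i} {Q : Place K (T.F i)} {P : Place K (T.F j)}
    (h : T.Over hji Q P) {c : T.F j} {a : K} (hc : P.HasValue c a) :
    Q.HasValue (IntermediateField.inclusion (T.F_mono hji) c) a := by
  let := T.algebraOfLE hji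
  have := T.isScalarTower_of_le hji
  have h' : ∀ c : T.F j, algebraMap (T.F j) (T.F i) c ∈ Q.ring ↔ c ∈ P.ring := over_iff.1 h
  exact Place.HasValue.of_over (E := T.F j) (F := T.F i) h' hc

theorem SplitsCompletely.degree_eq_one {i : ℕ} {P : Place K (T.F 0)} (hP : P.degree = 1)
    (hs : T.SplitsCompletely i P) {Q : Place K (T.F i)} (hQ : T.Over (Nat.zero_le i) Q P) :
    Q.degree = 1 := by
  let := T.algebraOfLE (Nat.zero_le i)
  have := T.isScalarTower_of_le (Nat.zero_le i)
  have := T.finiteDimensional_of_le (Nat.zero_le i)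
  refine Place.degree_eq_one_of_ncard_eq (T.finiteOverTranscendentals i) hP ?_ (over_iff.1 hQ)
  rw [SplitsCompletely, ← IntermediateField.finrank_inclusion (T.F_mono (Nat.zero_le i))] at hs
  simp_rw [over_iff] at hs
  exact hs

/-- If `P` splits completely in `F (k+1)`, it splits completely in `F k`, and each place of `F k`
over `P` splits completely in `F (k+1)`. -/
theorem SplitsCompletely.ncard_fibre {k : ℕ} {P : Place K (T.F 0)} (hP : P.degree = 1)
    (hs : T.SplitsCompletely (k + 1) P) :
    {R | T.Over (Nat.zero_le k) R P}.ncard = ∏ j ∈ Finset.Icc 1 k, T.m j ∧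
      ∀ R, T.Over (Nat.zero_le k) R P → (T.fibre (k + 1) R).ncard = T.m (k + 1) := by
  classical
  obtain ⟨hfk, hck⟩ := finite_over_and_ncard_le (Nat.zero_le k) hP
  obtain ⟨hf, -⟩ := finite_over_and_ncard_le (Nat.zero_le (k + 1)) hP
  have hk1 : k ≤ k + 1 := Nat.le_succ k
  -- The fundamental inequality over R needs R rational. This follows from the rationality of any
  -- place above it; an empty fibre needs no argument.
  have hfib : ∀ R : Place K (T.F k), T.Over (Nat.zero_le k) R P →
      (T.fibre (k + 1) R).ncard ≤ T.m (k + 1) := by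
    intro R hR
    by_cases hne : (T.fibre (k + 1) R).Nonempty
    · obtain ⟨Q, hQ⟩ := hne
      have hQR : T.Over hk1 Q R := hQ
      have hQ1 := hs.degree_eq_one hP (hQR.trans hR)
      exact (finite_over_and_ncard_le hk1 (degree_eq_one_of_over hQR hQ1)).2
    · rw [Set.not_nonempty_iff_eq_empty.1 hne, Set.ncard_empty]
      exact Nat.zero_le _
  choose u hu using fun Q : Place K (T.F (k + 1)) => exists_over hk1 Q
  have hmaps : ∀ Q ∈ hf.toFinset, u Q ∈ hfk.toFinset := by
    intro Q hQ
    have hQ' : T.Over (Nat.zero_le (k + 1)) Q P := by simpa using hQ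
    have : T.Over (Nat.zero_le k) (u Q) P := (hu Q).of_trans hQ'
    simpa using this
  have hcard := Finset.card_eq_sum_card_fiberwise hmaps
  have hfibcard : ∀ R ∈ hfk.toFinset, (hf.toFinset.filter fun Q => u Q = R).card =
      (T.fibre (k + 1) R).ncard := by
    intro R hR
    have hR' : T.Over (Nat.zero_le k) R P := by simpa using hR
    rw [← Set.ncard_coe_finset]
    congr 1
    ext Q
    simp only [Finset.coe_filter, Set.Finite.mem_toFinset, Set.mem_ofPred_eq]
    constructor
    · rintro ⟨-, rfl⟩
      exact hu Q
    · intro hQ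
      have hQR : T.Over hk1 Q R := hQ
      exact ⟨hQR.trans hR', (hu Q).unique hQR⟩
  rw [Finset.sum_congr rfl hfibcard, ← Set.ncard_eq_toFinset_card _ hf] at hcard
  have hs' := hs
  rw [SplitsCompletely, relfinrank_zero, Finset.prod_Icc_succ_top (by omega)] at hs'
  rw [hs'] at hcard
  rw [T.relfinrank_zero k, Set.ncard_eq_toFinset_card _ hfk] at hck
  have hle : ∀ R ∈ hfk.toFinset, (T.fibre (k + 1) R).ncard ≤ T.m (k + 1) := fun R hR =>
    hfib R (by simpa using hR)
  -- Double counting: the fibre sizes sum to (∏ m_j) m_{k+1}, while there are at most ∏ m_j fibres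
  -- of size at most m_{k+1}. Both bounds must be equalities.
  have hsum := Finset.sum_le_card_nsmul _ _ _ hle
  rw [smul_eq_mul] at hsum
  have hmpos := T.m_succ_pos k
  have hcardk : hfk.toFinset.card = ∏ j ∈ Finset.Icc 1 k, T.m j := by
    apply le_antisymm hck
    rw [← hcard] at hsum
    exact Nat.le_of_mul_le_mul_right hsum hmpos
  refine ⟨by rw [Set.ncard_eq_toFinset_card _ hfk, hcardk], fun R hR => ?_⟩
  have heq : ∑ R ∈ hfk.toFinset, (T.fibre (k + 1) R).ncard =
      ∑ R ∈ hfk.toFinset, T.m (k + 1) := by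
    rw [← hcard, Finset.sum_const, smul_eq_mul, hcardk]
  exact (Finset.sum_eq_sum_iff_of_le hle).1 heq R (by simpa using hR)

/-- The places over a set `S` of rational places. -/
theorem finite_and_ncard_placesAbove {i c : ℕ} {S : Finset (Place K (T.F 0))}
    (hrat : ∀ P ∈ S, P.degree = 1)
    (hc : ∀ P ∈ S, {Q : Place K (T.F i) | T.Over (Nat.zero_le i) Q P}.ncard = c) :
    (T.placesAbove i S).Finite ∧ (T.placesAbove i S).ncard = c * S.card :=
  S.ncard_biUnion_eq_mul (fun P => {Q : Place K (T.F i) | T.Over (Nat.zero_le i) Q P})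
    (fun _ _ _ _ _ h h' => Over.unique (hji := Nat.zero_le i) h h')
    (fun P hP => (finite_over_and_ncard_le (Nat.zero_le i) (hrat P hP)).1) hc

end FunctionFieldSequence

/-! ### The dimension of the code space -/

/-- The tower argument: a K-independent family in L times an L-independent family is K-independent.
-/
theorem Submodule.finrank_mul_span {K Ω ι : Type*} [Field K] [Field Ω] [Algebra K Ω] [Fintype ι]
    (L : IntermediateField K Ω) (A : Submodule K Ω) [Module.Finite K A] (hA : ∀ a ∈ A, a ∈ L)
    {u : ι → Ω} (hu : LinearIndependent L u) :
    Module.Finite K ↥(A * Submodule.span K (Set.range u)) ∧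
      Module.finrank K ↥(A * Submodule.span K (Set.range u)) =
        Module.finrank K A * Fintype.card ι := by
  let b := Module.finBasis K A
  have hspan : A = Submodule.span K (Set.range fun w => (b w : Ω)) := by
    have h := congrArg (Submodule.map A.subtype) b.span_eq
    rw [Submodule.map_top, Submodule.range_subtype, Submodule.map_span, ← Set.range_comp] at h
    exact h.symm
  have hb : LinearIndependent K fun w => (⟨b w, hA _ (b w).2⟩ : L) := by
    have h1 : LinearIndependent K fun w => (b w : Ω) :=
      b.linearIndependent.map' A.subtype (Submodule.ker_subtype A)
    exact LinearIndependent.of_comp L.val.toLinearMap h1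
  have hli := linearIndependent_smul hb hu
  have hprod : A * Submodule.span K (Set.range u) = Submodule.span K
      (Set.range fun p : Fin (Module.finrank K A) × ι =>
        (⟨b p.1, hA _ (b p.1).2⟩ : L) • u p.2) := by
    conv_lhs => rw [hspan]
    rw [Submodule.span_mul_span]
    congr 1
    ext z
    simp only [Set.mem_mul, Set.mem_range, exists_exists_eq_and, Prod.exists]
    rfl
  rw [hprod]
  refine ⟨Module.Finite.span_of_finite K (Set.finite_range _), ?_⟩
  rw [finrank_span_eq_card hli, Fintype.card_prod, Fintype.card_fin]

/-- The span of the products `f w * x 1 ^ e 1 ⋯ x k ^ e k` with `e j < r j`. -/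
def monomialSpan (K : Type*) {Ω κ : Type*} [Field K] [Field Ω] [Algebra K Ω] (f : κ → Ω)
    (x : ℕ → Ω) (r : ℕ → ℕ) (k : ℕ) : Submodule K Ω :=
  Submodule.span K {u | ∃ (w : κ) (e : ℕ → ℕ), (∀ j ∈ Finset.Icc 1 k, e j < r j) ∧
    u = f w * ∏ j ∈ Finset.Icc 1 k, x j ^ e j}

theorem monomialSpan_zero {K Ω κ : Type*} [Field K] [Field Ω] [Algebra K Ω] (f : κ → Ω)
    (x : ℕ → Ω) (r : ℕ → ℕ) : monomialSpan K f x r 0 = Submodule.span K (Set.range f) := by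
  rw [monomialSpan]
  congr 1
  ext u
  simp [eq_comm]

theorem monomialSpan_succ {K Ω κ : Type*} [Field K] [Field Ω] [Algebra K Ω] (f : κ → Ω)
    (x : ℕ → Ω) (r : ℕ → ℕ) (k : ℕ) : monomialSpan K f x r (k + 1) = monomialSpan K f x r k *
      Submodule.span K (Set.range fun e : Fin (r (k + 1)) => x (k + 1) ^ (e : ℕ)) := by
  rw [monomialSpan, monomialSpan, Submodule.span_mul_span]
  congr 1
  ext u
  rw [Set.mem_mul]
  constructor
  · rintro ⟨w, e, he, rfl⟩
    refine ⟨_, ⟨w, e, fun j hj => he j ?_, rfl⟩, _,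
      ⟨⟨e (k + 1), he _ (Finset.mem_Icc.2 ⟨by omega, le_rfl⟩)⟩, rfl⟩, ?_⟩
    · rw [Finset.mem_Icc] at hj ⊢
      omega
    · rw [Finset.prod_Icc_succ_top (by omega), mul_assoc]
  · rintro ⟨_, ⟨w, e, he, rfl⟩, _, ⟨d, rfl⟩, rfl⟩
    refine ⟨w, Function.update e (k + 1) d, fun j hj => ?_, ?_⟩
    · rcases eq_or_ne j (k + 1) with rfl | hne
      · rw [Function.update_self]
        exact d.2
      · rw [Function.update_of_ne hne]
        rw [Finset.mem_Icc] at hj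
        exact he j (Finset.mem_Icc.2 (by omega))
    · rw [Finset.prod_Icc_succ_top (by omega), Function.update_self, mul_assoc]
      congr 2
      refine Finset.prod_congr rfl fun j hj => ?_
      rw [Finset.mem_Icc] at hj
      rw [Function.update_of_ne (by omega)]

namespace FunctionFieldSequence

variable {K Ω : Type*} [Field K] [Field Ω] [Algebra K Ω] (T : FunctionFieldSequence K Ω)

/-- m_{j+1} is the degree of the minimal polynomial of x_{j+1} over F_j. -/
theorem linearIndependent_x_pow (j : ℕ) :
    LinearIndependent (T.F j) fun e : Fin (T.m (j + 1)) => T.x (j + 1) ^ (e : ℕ) := by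
  have hfin := T.finite j
  have he : IntermediateField.extendScalars (T.lt_succ j).le =
      IntermediateField.adjoin (T.F j) {T.x (j + 1)} := by
    apply IntermediateField.restrictScalars_injective K
    rw [IntermediateField.extendScalars_restrictScalars, ← T.succ_eq j]
  have hint : IsIntegral (T.F j) (T.x (j + 1)) := by
    have h1 : IsIntegral (T.F j)
        (⟨T.x (j + 1), T.x_mem_self (j + 1)⟩ :
          IntermediateField.extendScalars (T.lt_succ j).le) := IsIntegral.of_finite _ _
    exact h1.map (IntermediateField.val _)
  have hm : T.m (j + 1) = (minpoly (T.F j) (T.x (j + 1))).natDegree := by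
    rw [← IntermediateField.adjoin.finrank hint, ← he, m, Nat.add_sub_cancel,
      IntermediateField.relfinrank_eq_finrank_of_le (T.lt_succ j).le]
  rw [hm]
  exact linearIndependent_pow (T.x (j + 1))

theorem monomialSpan_le {κ : Type*} {f : κ → Ω} (hf : ∀ w, f w ∈ T.F 0) (r : ℕ → ℕ) (k : ℕ) :
    ∀ a ∈ monomialSpan K f T.x r k, a ∈ T.F k := by
  intro a ha
  have h1 : monomialSpan K f T.x r k ≤ (T.F k).toSubalgebra.toSubmodule := by
    refine Submodule.span_le.2 ?_
    rintro _ ⟨w, e, -, rfl⟩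
    refine (T.F k).mul_mem (T.F_mono (Nat.zero_le k) (hf w)) ((T.F k).prod_mem fun j hj => ?_)
    exact pow_mem (T.F_mono (Finset.mem_Icc.1 hj).2 (T.x_mem_self j)) _
  exact h1 ha

theorem finrank_monomialSpan {κ : Type*} {f : κ → Ω} (hf : ∀ w, f w ∈ T.F 0)
    [Module.Finite K (Submodule.span K (Set.range f))] {r : ℕ → ℕ} (k : ℕ)
    (hr : ∀ j ∈ Finset.Icc 1 k, r j ≤ T.m j) :
    Module.Finite K (monomialSpan K f T.x r k) ∧
      Module.finrank K (monomialSpan K f T.x r k) =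
        Module.finrank K (Submodule.span K (Set.range f)) * ∏ j ∈ Finset.Icc 1 k, r j := by
  induction k with
  | zero =>
    rw [monomialSpan_zero]
    exact ⟨inferInstance, by simp⟩
  | succ k ih =>
    obtain ⟨h1, h2⟩ := ih fun j hj => hr j (Finset.mem_Icc.2 (by
      have := Finset.mem_Icc.1 hj; omega))
    have hli : LinearIndependent (T.F k) fun e : Fin (r (k + 1)) => T.x (k + 1) ^ (e : ℕ) :=
      (T.linearIndependent_x_pow k).comp
        (Fin.castLE (hr (k + 1) (Finset.mem_Icc.2 ⟨by omega, le_rfl⟩)))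
        (Fin.castLE_injective _)
    have h3 := Submodule.finrank_mul_span (T.F k) (monomialSpan K f T.x r k)
      (T.monomialSpan_le hf r k) hli
    rw [monomialSpan_succ]
    refine ⟨h3.1, h3.2.trans ?_⟩
    rw [h2, Fintype.card_fin, Finset.prod_Icc_succ_top (by omega), mul_assoc]

theorem val_monomial (i : ℕ) (e : ℕ → ℕ) :
    (T.monomial i e : Ω) = ∏ j ∈ Finset.Icc 1 i, T.x j ^ e j := by
  have h1 : Finset.Icc 1 i = Finset.Ico (0 + 1) (i + 1) := by
    ext j; simp only [Finset.mem_Icc, Finset.mem_Ico]; omega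
  rw [monomial, ← IntermediateField.coe_val, map_prod, h1,
    ← Finset.prod_Ico_add' (fun j => T.x j ^ e j) 0 i 1, ← Finset.range_eq_Ico,
    ← Fin.prod_univ_eq_prod_range (fun j => T.x (j + 1) ^ e (j + 1))]
  rfl

/-- Inside Ω the ambient field no longer depends on the level, which permits induction. The
condition e_i ≤ m_i - 2 becomes a strict bound by m_i - 1 because m_i ≥ 2. -/
theorem map_codeSpace (k : ℕ) {κ : Type*} (f : κ → T.F 0) :
    (T.codeSpace (k + 1) f).map (T.F (k + 1)).val.toLinearMap =
      monomialSpan K (fun w => (f w : Ω)) T.x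
        (Function.update T.m (k + 1) (T.m (k + 1) - 1)) (k + 1) := by
  have hm := T.two_le_m_succ k
  rw [codeSpace, Submodule.map_span, monomialSpan]
  congr 1
  ext u
  constructor
  · rintro ⟨_, ⟨w, e, he, he', rfl⟩, rfl⟩
    refine ⟨w, e, fun j hj => ?_, ?_⟩
    · rcases eq_or_ne j (k + 1) with rfl | hne
      · rw [Function.update_self]
        omega
      · rw [Function.update_of_ne hne]
        rw [Finset.mem_Icc] at hj
        have h1 := he' j (Finset.mem_Icc.2 (by omega))
        obtain ⟨a, rfl⟩ : ∃ a, j = a + 1 := ⟨j - 1, by omega⟩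
        have := T.m_succ_pos a
        omega
    · rw [← val_monomial]
      rfl
  · rintro ⟨w, e, he, rfl⟩
    refine ⟨_, ⟨w, e, ?_, fun j hj => ?_, rfl⟩, ?_⟩
    · have := he (k + 1) (Finset.mem_Icc.2 ⟨by omega, le_rfl⟩)
      rw [Function.update_self] at this
      omega
    · rw [Finset.mem_Icc] at hj
      have := he j (Finset.mem_Icc.2 (by omega))
      rw [Function.update_of_ne (by omega)] at this
      omega
    · rw [← val_monomial]
      rfl

theorem finrank_codeSpace (k : ℕ) {κ : Type*} {A : Submodule K (T.F 0)} [Module.Finite K A]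
    (b : Module.Basis κ K A) :
    Module.Finite K (T.codeSpace (k + 1) fun w => (b w : T.F 0)) ∧
      Module.finrank K (T.codeSpace (k + 1) fun w => (b w : T.F 0)) =
        Module.finrank K A * ((T.m (k + 1) - 1) * ∏ j ∈ Finset.Icc 1 k, T.m j) := by
  have hspan : Submodule.span K (Set.range fun w => ((b w : T.F 0) : Ω)) =
      A.map (T.F 0).val.toLinearMap := by
    have h := congrArg (Submodule.map ((T.F 0).val.toLinearMap ∘ₗ A.subtype)) b.span_eq
    rw [Submodule.map_top, LinearMap.range_comp, Submodule.range_subtype, Submodule.map_span,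
      ← Set.range_comp] at h
    exact h
  have hinj : ∀ i, Function.Injective (T.F i).val.toLinearMap := fun i => Subtype.val_injective
  have hfin : Module.Finite K
      (Submodule.span K (Set.range fun w => ((b w : T.F 0) : Ω))) := by
    rw [hspan]; infer_instance
  obtain ⟨h1, h2⟩ := T.finrank_monomialSpan (f := fun w => ((b w : T.F 0) : Ω))
    (fun w => (b w : T.F 0).2) (r := Function.update T.m (k + 1) (T.m (k + 1) - 1)) (k + 1)
    (fun j _ => by
      rcases eq_or_ne j (k + 1) with rfl | hne
      · rw [Function.update_self]; omega
      · rw [Function.update_of_ne hne])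
  rw [← map_codeSpace] at h1 h2
  have e := Submodule.equivMapOfInjective _ (hinj (k + 1))
    (T.codeSpace (k + 1) fun w => (b w : T.F 0))
  refine ⟨Module.Finite.equiv e.symm, ?_⟩
  rw [e.finrank_eq, h2, hspan, ← (Submodule.equivMapOfInjective _ (hinj 0) A).finrank_eq,
    Finset.prod_Icc_succ_top (by omega), Function.update_self, mul_comm (∏ j ∈ _, _)]
  congr 2
  refine Finset.prod_congr rfl fun j hj => ?_
  rw [Finset.mem_Icc] at hj
  rw [Function.update_of_ne (by omega)]

end FunctionFieldSequence

/-! ### Functions in the code space -/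

namespace FunctionFieldSequence

variable {K Ω : Type*} [Field K] [Field Ω] [Algebra K Ω] {T : FunctionFieldSequence K Ω}

theorem mem_ring_of_mem_riemannRochSpace {D : PlaceDivisor K (T.F 0)} {c : T.F 0}
    (hc : c ∈ D.riemannRochSpace) {P : Place K (T.F 0)} (hP : P ∉ D.support) : c ∈ P.ring := by
  obtain ⟨t, ht⟩ := Place.exists_isUniformizer T.mem_adjoin_gen_zero P
  have := hc P t ht
  rwa [Finsupp.notMem_support_iff.1 hP, zpow_zero, mul_one] at this

theorem inclusion_mem_ring_of_mem_placesAbove {i : ℕ} {S : Finset (Place K (T.F 0))}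
    {D : PlaceDivisor K (T.F 0)} (hD : ∀ P ∈ S, P ∉ D.support) {c : T.F 0}
    (hc : c ∈ D.riemannRochSpace) {Q : Place K (T.F i)} (hQ : Q ∈ T.placesAbove i S) :
    IntermediateField.inclusion (T.F_mono (Nat.zero_le i)) c ∈ Q.ring := by
  obtain ⟨P, hP, hQP⟩ := hQ
  exact (over_iff.1 hQP c).2 (mem_ring_of_mem_riemannRochSpace hc (hD P hP))

theorem monomial_mem_ring {i : ℕ} {Q : Place K (T.F i)}
    (hQ : ∀ (j : ℕ) (hj : j ≤ i), 1 ≤ j → T.gen hj ∈ Q.ring) (e : ℕ → ℕ) :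
    T.monomial i e ∈ Q.ring :=
  prod_mem fun _ _ => pow_mem (hQ _ _ (Nat.succ_le_succ (Nat.zero_le _))) _

theorem mem_ring_of_mem_codeSpace {i : ℕ} {κ : Type*} {f : κ → T.F 0} {Q : Place K (T.F i)}
    (hf : ∀ w, IntermediateField.inclusion (T.F_mono (Nat.zero_le i)) (f w) ∈ Q.ring)
    (hQ : ∀ (j : ℕ) (hj : j ≤ i), 1 ≤ j → T.gen hj ∈ Q.ring) {u : T.F i}
    (hu : u ∈ T.codeSpace i f) : u ∈ Q.ring := by
  induction hu using Submodule.span_induction with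
  | mem u hu =>
    obtain ⟨w, e, -, -, rfl⟩ := hu
    exact mul_mem (hf w) (monomial_mem_ring hQ e)
  | zero => exact Q.ring.zero_mem
  | add u v _ _ hu hv => exact add_mem hu hv
  | smul c u _ hu =>
    rw [Algebra.smul_def]
    exact mul_mem (Q.algebraMap_mem c) hu

theorem monomial_succ (k : ℕ) (e : ℕ → ℕ) : T.monomial (k + 1) e =
    IntermediateField.inclusion (T.F_mono (Nat.le_succ k)) (T.monomial k e) *
      T.gen (le_refl (k + 1)) ^ e (k + 1) := by
  apply Subtype.ext
  have h1 : (T.monomial (k + 1) e : Ω) = T.monomial k e * T.x (k + 1) ^ e (k + 1) := by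
    rw [val_monomial, val_monomial, Finset.prod_Icc_succ_top (by omega)]
  exact h1

/-- On the fibre over a rational place, a function of the code space is a polynomial in the last
generator. -/
theorem exists_eval_of_mem_codeSpace {k : ℕ} {κ : Type*} {f : κ → T.F 0} {R : Place K (T.F k)}
    (hR : R.degree = 1)
    (hf : ∀ w, IntermediateField.inclusion (T.F_mono (Nat.zero_le k)) (f w) ∈ R.ring)
    (hx : ∀ (j : ℕ) (hj : j ≤ k), 1 ≤ j → T.gen hj ∈ R.ring)
    (hQ : ∀ Q ∈ T.fibre (k + 1) R, ∃ a, Q.HasValue (T.gen (le_refl (k + 1))) a) {u : T.F (k + 1)}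
    (hu : u ∈ T.codeSpace (k + 1) f) :
    ∃ g : K[X], g.degree < ((T.m (k + 1) - 1 : ℕ) : WithBot ℕ) ∧ ∀ Q ∈ T.fibre (k + 1) R,
      Q.HasValue u (g.eval (Q.value (T.gen (le_refl (k + 1))))) := by
  have hm := T.two_le_m_succ k
  induction hu using Submodule.span_induction with
  | mem u hu =>
    obtain ⟨w, e, he, -, rfl⟩ := hu
    -- The part of the product lying in F_k has a value at the rational place R, and hence the same
    -- value on the whole fibre.
    obtain ⟨a, ha⟩ := Place.degree_eq_one_iff.1 hR _ (mul_mem (hf w) (monomial_mem_ring hx e))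
    refine ⟨Polynomial.C a * Polynomial.X ^ e (k + 1), ?_, fun Q hQR => ?_⟩
    · refine (Polynomial.degree_C_mul_X_pow_le _ _).trans_lt ?_
      exact_mod_cast (by omega : e (k + 1) < T.m (k + 1) - 1)
    · obtain ⟨c, hc⟩ := hQ Q hQR
      have h1 := (hasValue_of_over (hji := Nat.le_succ k) hQR ha).mul (hc.pow (e (k + 1)))
      rw [map_mul, mul_assoc] at h1
      rw [monomial_succ, hc.value_eq]
      simpa using h1
  | zero => exact ⟨0, by rw [Polynomial.degree_zero]; exact WithBot.bot_lt_coe _, fun Q _ => by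
      simp [Place.hasValue_iff]⟩
  | add u v _ _ hu hv =>
    obtain ⟨g, hg, hgu⟩ := hu
    obtain ⟨g', hg', hgv⟩ := hv
    refine ⟨g + g', (Polynomial.degree_add_le _ _).trans_lt (max_lt hg hg'), fun Q hQR => ?_⟩
    rw [Polynomial.eval_add]
    exact (hgu Q hQR).add (hgv Q hQR)
  | smul c u _ hu =>
    obtain ⟨g, hg, hgu⟩ := hu
    refine ⟨c • g, (Polynomial.degree_smul_le _ _).trans_lt hg, fun Q hQR => ?_⟩
    rw [Polynomial.eval_smul, smul_eq_mul, Algebra.smul_def]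
    exact (Q.hasValue_algebraMap c).mul (hgu Q hQR)

/-- The number of zeros of a non-zero function of the code space. -/
theorem card_zeros_codeSpace_le [Finite K] {k : ℕ} {κ : Type*} {f : κ → T.F 0}
    {D : PlaceDivisor K (T.F 0)} (hf : ∀ w, f w ∈ D.riemannRochSpace)
    {S : Finset (Place K (T.F 0))} (hrat : ∀ P ∈ S, P.degree = 1) (hD : ∀ P ∈ S, P ∉ D.support)
    {u : T.F (k + 1)} (hu0 : u ≠ 0) (hu : u ∈ T.codeSpace (k + 1) f)
    (Z : Finset (Place K (T.F (k + 1))))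
    (hZ : ∀ Q ∈ Z, Q.HasValue u 0 ∧ Q ∈ T.placesAbove (k + 1) S) :
    (Z.card : ℤ) ≤ D.deg * ((∏ j ∈ Finset.Icc 1 (k + 1), T.m j : ℕ) : ℤ)
      + ∑ j ∈ Finset.Icc 1 k, ((T.m j : ℤ) - 1) * (T.h (k + 1) j : ℤ)
      + ((T.m (k + 1) : ℤ) - 2) * (T.h (k + 1) (k + 1) : ℤ) := by
  let := T.algebraOfLE (Nat.zero_le (k + 1))
  have := T.isScalarTower_of_le (Nat.zero_le (k + 1))
  have hmk := T.two_le_m_succ k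
  let a : ℕ → ℕ := fun j => if j = k + 1 then T.m j - 2 else T.m j - 1
  have h1 := Place.card_zeros_le (E := T.F 0) (T.finiteOverTranscendentals (k + 1))
    (fun z hz => T.isAlgebraic_mem_range hz) (T.transcendental_gen (le_refl 0))
    T.mem_adjoin_gen_zero D (Finset.univ : Finset (Fin (k + 1)))
    (fun j => T.gen (Nat.succ_le_of_lt j.2)) (fun j => a (j + 1))
    (fun j _ => T.transcendental_gen _) hu0 ?_ Z ?_
  · have h2 : Module.finrank K⟮algebraMap (T.F 0) (T.F (k + 1)) (T.gen (le_refl 0))⟯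
        (T.F (k + 1)) = ∏ j ∈ Finset.Icc 1 (k + 1), T.m j := by
      rw [← h_zero, h_eq _ (Nat.zero_le (k + 1))]
      rfl
    have h3 : ∑ j : Fin (k + 1), (a (j + 1) : ℤ) *
        Module.finrank K⟮T.gen (Nat.succ_le_of_lt j.2)⟯ (T.F (k + 1)) =
        ∑ j ∈ Finset.Icc 1 k, ((T.m j : ℤ) - 1) * (T.h (k + 1) j : ℤ)
        + ((T.m (k + 1) : ℤ) - 2) * (T.h (k + 1) (k + 1) : ℤ) := by
      have h4 : Finset.Icc 1 k = Finset.Ico (0 + 1) (k + 1) := by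
        ext j; simp only [Finset.mem_Icc, Finset.mem_Ico]; omega
      simp_rw [← h_eq]
      rw [Fin.sum_univ_eq_sum_range (fun j => (a (j + 1) : ℤ) * (T.h (k + 1) (j + 1) : ℤ)),
        Finset.sum_range_succ, h4, ← Finset.sum_Ico_add' _ 0 k 1, ← Finset.range_eq_Ico]
      congr 1
      · refine Finset.sum_congr rfl fun j hj => ?_
        have := Finset.mem_range.1 hj
        have := T.m_succ_pos j
        have : a (j + 1) = T.m (j + 1) - 1 := if_neg (by omega)
        rw [this, Nat.cast_sub (by omega)]
        rfl
      · have : a (k + 1) = T.m (k + 1) - 2 := if_pos rfl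
        rw [this, Nat.cast_sub hmk]
        rfl
    rw [h2, h3, ← add_assoc] at h1
    exact h1
  · refine Submodule.span_mono ?_ hu
    rintro _ ⟨w, e, he, he', rfl⟩
    refine ⟨f w, hf w, fun j => e (j + 1), fun j _ => ?_, rfl⟩
    by_cases hj : (j : ℕ) + 1 = k + 1
    · simp only [a, if_pos hj]
      rw [hj]; exact he
    · simp only [a, if_neg hj]
      exact he' _ (Finset.mem_Icc.2 (by have := j.2; omega))
  · intro Q hQ
    obtain ⟨h1, P, hP, hQP⟩ := hZ Q hQ
    rw [Place.hasValue_iff, map_zero, sub_zero] at h1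
    exact ⟨h1, P, hrat P hP, Finsupp.notMem_support_iff.1 (hD P hP), over_iff.1 hQP⟩

end FunctionFieldSequence

theorem Polynomial.eq_of_degree_lt_of_eval_injOn {K α : Type*} [Field K] {v : α → K} {A : Set α}
    (hA : A.Finite) (hv : Set.InjOn v A) {g g' : K[X]} (hg : g.degree < (A.ncard : WithBot ℕ))
    (hg' : g'.degree < (A.ncard : WithBot ℕ)) (h : ∀ a ∈ A, g.eval (v a) = g'.eval (v a)) :
    g = g' := by
  rw [Set.ncard_eq_toFinset_card _ hA] at hg hg'
  exact Polynomial.eq_of_degrees_lt_of_eval_index_eq hA.toFinset (v := v) (by simpa using hv)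
    hg hg' (by simpa using h)

/-! ### Evaluation codes -/

section

variable {K F : Type*} [Field K] [Field F] [Algebra K F]

theorem finrank_evalCode {V : Submodule K F} {B : Set (Place K F)}
    (hV : ∀ f ∈ V, ∀ Q ∈ B, ∃ a, Q.HasValue f a)
    (hinj : ∀ f ∈ V, (∀ Q ∈ B, Q.HasValue f 0) → f = 0) :
    Module.finrank K (evalCode V B) = Module.finrank K V := by
  have hval : ∀ f : V, ∀ Q : B, Q.1.HasValue (f : F) (Q.1.value (f : F)) := fun f Q => by
    obtain ⟨a, ha⟩ := hV f f.2 Q Q.2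
    rwa [ha.value_eq]
  let ev : V →ₗ[K] (B → K) :=
    { toFun := fun f Q => Q.1.value (f : F)
      map_add' := fun f g => funext fun Q => ((hval f Q).add (hval g Q)).value_eq
      map_smul' := fun c f => funext fun Q => by
        have h := ((Q.1.hasValue_algebraMap c).mul (hval f Q)).value_eq
        rw [← Algebra.smul_def] at h
        exact h }
  have hker : Function.Injective ev := by
    rw [injective_iff_map_eq_zero]
    intro f hf
    refine Subtype.ext (hinj f f.2 fun Q hQ => ?_)
    have h1 : Q.value (f : F) = 0 := congrFun hf ⟨Q, hQ⟩
    rw [← h1]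
    exact hval f ⟨Q, hQ⟩
  have hrange : LinearMap.range ev = evalCode V B := by
    ext c
    constructor
    · rintro ⟨f, rfl⟩
      exact ⟨f, f.2, hval f⟩
    · rintro ⟨f, hf, hc⟩
      exact ⟨⟨f, hf⟩, funext fun Q => (hc Q).value_eq⟩
  rw [← hrange, LinearMap.finrank_range_of_inj hker]

theorem wordWeight_add_ncard_zeros {B : Set (Place K F)} (hB : B.Finite) {f : F} {c : B → K}
    (hc : ∀ Q : B, Q.1.HasValue f (c Q)) :
    wordWeight c + {Q | Q ∈ B ∧ Q.HasValue f 0}.ncard = B.ncard := by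
  have := hB.to_subtype
  have e : {Q | Q ∈ B ∧ Q.HasValue f 0} = Subtype.val '' (Function.support c)ᶜ := by
    ext Q
    constructor
    · rintro ⟨hQ, h⟩
      exact ⟨⟨Q, hQ⟩, Function.notMem_support.2 ((hc ⟨Q, hQ⟩).unique h), rfl⟩
    · rintro ⟨Q, h, rfl⟩
      have h' := hc Q
      rw [Function.notMem_support.1 h] at h'
      exact ⟨Q.2, h'⟩
  rw [e, Set.ncard_image_of_injective _ Subtype.val_injective, wordWeight,
    Set.ncard_add_ncard_compl, Nat.card_coe_set_eq]

theorem le_minDistance {ι : Type*} {C : Submodule K (ι → K)} (hC : C ≠ ⊥) {d : ℤ}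
    (h : ∀ c ∈ C, c ≠ 0 → d ≤ (wordWeight c : ℤ)) : d ≤ (minDistance C : ℤ) := by
  obtain ⟨c, hc, hc0⟩ := C.ne_bot_iff.1 hC
  obtain ⟨c', hc', hc0', h'⟩ := Nat.sInf_mem
    (s := {w | ∃ c ∈ C, c ≠ 0 ∧ w = wordWeight c}) ⟨_, c, hc, hc0, rfl⟩
  rw [minDistance, h']
  exact h c' hc' hc0'

end

/-! ### The locally recoverable code. -/

theorem theorem3p3 {K Ω : Type*} [Field K] [Finite K] [Field Ω] [Algebra K Ω]
    (T : FunctionFieldSequence K Ω) (i : ℕ) (hi : 2 ≤ i)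
    (S : Finset (Place K (T.F 0))) (hS : S.Nonempty)
    (hrat : ∀ P ∈ S, P.degree = 1)
    (hsplit : ∀ P ∈ S, T.SplitsCompletely i P)
    (hpole : ∀ Q ∈ T.placesAbove i S, ∀ (j : ℕ) (hj : j ≤ i), 1 ≤ j → ¬ Q.IsPole (T.gen hj))
    (D : PlaceDivisor K (T.F 0)) (hD : ∀ P ∈ S, P ∉ D.support)
    {κ : Type*} (b : Module.Basis κ K D.riemannRochSpace)
    (B : Set (Place K (T.F i))) (hB : B = T.placesAbove i S)
    (V : Submodule K (T.F i)) (hV : V = T.codeSpace i (fun w => (b w : T.F 0)))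
    (C : Submodule K (B → K)) (hC : C = evalCode V B)
    (n s m m' : ℕ) (hn : n = B.ncard) (hs : s = S.card)
    (hm : m = ∏ j ∈ Finset.Icc 1 i, T.m j)
    (hm' : m' = ∏ j ∈ Finset.Icc 1 (i - 1), T.m j)
    (l d₀ : ℤ) (hl : l = D.deg)
    (hd₀ : d₀ = (n : ℤ) - l * m
      - ∑ j ∈ Finset.Icc 1 (i - 1), ((T.m j : ℤ) - 1) * (T.h i j : ℤ)
      - ((T.m i : ℤ) - 2) * (T.h i i : ℤ)) :
    -- the length
    (B.Finite ∧ n = m * s) ∧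
    -- the evaluation map is well defined on `V`
    (∀ Q ∈ B, Q.degree = 1 ∧ ∀ f ∈ V, ¬ Q.IsPole f) ∧
    (∀ f ∈ V, ∃! c : B → K, ∀ Q : B, Q.1.HasValue f (c Q)) ∧
    -- the partition of the coordinates into `m' * s` fibres of size `m_i`
    ((T.placesAbove (i - 1) S).ncard = m' * s ∧
      (∀ R ∈ T.placesAbove (i - 1) S, T.fibre i R ⊆ B ∧ (T.fibre i R).ncard = T.m i) ∧
      (∀ Q ∈ B, ∃! R, R ∈ T.placesAbove (i - 1) S ∧ Q ∈ T.fibre i R)) ∧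
    -- recovery by interpolation in every fibre on which the nodes `x_i(Q)` are distinct
    (∀ R ∈ T.placesAbove (i - 1) S,
      Set.InjOn (fun Q => Q.value (T.gen (le_refl i))) (T.fibre i R) →
      ∀ c ∈ C, ∀ Q : B, Q.1 ∈ T.fibre i R →
        ∃ g : K[X],
          (g.degree < ((T.m i - 1 : ℕ) : WithBot ℕ) ∧
            ∀ Q' : B, Q'.1 ∈ T.fibre i R → Q' ≠ Q →
              g.eval (Q'.1.value (T.gen (le_refl i))) = c Q') ∧
          (∀ g' : K[X],
            (g'.degree < ((T.m i - 1 : ℕ) : WithBot ℕ) ∧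
              ∀ Q' : B, Q'.1 ∈ T.fibre i R → Q' ≠ Q →
                g'.eval (Q'.1.value (T.gen (le_refl i))) = c Q') → g' = g) ∧
          c Q = g.eval (Q.1.value (T.gen (le_refl i)))) ∧
    -- the locality
    ((∀ R ∈ T.placesAbove (i - 1) S,
        Set.InjOn (fun Q => Q.value (T.gen (le_refl i))) (T.fibre i R)) →
      IsLocallyRecoverable C (T.m i - 1)) ∧
    -- the dimension and the minimum distance
    (0 < d₀ →
      Module.finrank K C = Module.finrank K D.riemannRochSpace * ((T.m i - 1) * m') ∧
      (l + 1) * (((T.m i : ℤ) - 1) * (m' : ℤ)) ≤ (Module.finrank K C : ℤ) ∧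
      (C ≠ ⊥ → d₀ ≤ (minDistance C : ℤ))) := by
  classical
  obtain ⟨k, rfl⟩ : ∃ k, i = k + 1 := ⟨i - 1, by omega⟩
  have hkk : k ≤ k + 1 := Nat.le_succ k
  have hmk := T.two_le_m_succ k
  have hb : ∀ w, (b w : T.F 0) ∈ D.riemannRochSpace := fun w => (b w).2
  obtain ⟨hBfin, hBcard⟩ := FunctionFieldSequence.finite_and_ncard_placesAbove (i := k + 1) hrat
    (fun P hP => (hsplit P hP).trans (T.relfinrank_zero (k + 1)))
  have hQ1 : ∀ Q ∈ T.placesAbove (k + 1) S, Q.degree = 1 := by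
    rintro Q ⟨P, hP, hQP⟩
    exact (hsplit P hP).degree_eq_one (hrat P hP) hQP
  have hgen : ∀ Q ∈ T.placesAbove (k + 1) S, ∀ (j : ℕ) (hj : j ≤ k + 1), 1 ≤ j →
      T.gen hj ∈ Q.ring := fun Q hQ j hj h1 => not_not.1 (hpole Q hQ j hj h1)
  have hreg : ∀ Q ∈ T.placesAbove (k + 1) S, ∀ f ∈ V, f ∈ Q.ring := by
    rintro Q hQ f hf
    rw [hV] at hf
    exact FunctionFieldSequence.mem_ring_of_mem_codeSpace
      (fun w => FunctionFieldSequence.inclusion_mem_ring_of_mem_placesAbove hD (hb w) hQ)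
      (hgen Q hQ) hf
  have hvals : ∀ f ∈ V, ∀ Q ∈ T.placesAbove (k + 1) S, ∃ a, Q.HasValue f a := fun f hf Q hQ =>
    Place.degree_eq_one_iff.1 (hQ1 Q hQ) f (hreg Q hQ f hf)
  have habove : ∀ R ∈ T.placesAbove k S, T.fibre (k + 1) R ⊆ T.placesAbove (k + 1) S := by
    rintro R ⟨P, hP, hRP⟩ Q hQ
    have hQR : T.Over hkk Q R := hQ
    exact ⟨P, hP, hQR.trans hRP⟩
  have hfibre : ∀ R ∈ T.placesAbove k S, (T.fibre (k + 1) R).ncard = T.m (k + 1) := by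
    rintro R ⟨P, hP, hRP⟩
    exact ((hsplit P hP).ncard_fibre (hrat P hP)).2 R hRP
  have hpart : ∀ Q ∈ T.placesAbove (k + 1) S,
      ∃! R, R ∈ T.placesAbove k S ∧ Q ∈ T.fibre (k + 1) R := by
    rintro Q ⟨P, hP, hQP⟩
    obtain ⟨R, hR⟩ := FunctionFieldSequence.exists_over hkk Q
    exact ⟨R, ⟨⟨P, hP, hR.of_trans hQP⟩, hR⟩, fun R' hR' =>
      FunctionFieldSequence.Over.unique (hji := hkk) hR'.2 hR⟩
  have hinterp : ∀ R ∈ T.placesAbove k S,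
      Set.InjOn (fun Q => Q.value (T.gen (le_refl (k + 1)))) (T.fibre (k + 1) R) →
      ∀ c ∈ C, ∀ Q : B, Q.1 ∈ T.fibre (k + 1) R →
        ∃ g : K[X],
          (g.degree < ((T.m (k + 1) - 1 : ℕ) : WithBot ℕ) ∧
            ∀ Q' : B, Q'.1 ∈ T.fibre (k + 1) R → Q' ≠ Q →
              g.eval (Q'.1.value (T.gen (le_refl (k + 1)))) = c Q') ∧
          (∀ g' : K[X],
            (g'.degree < ((T.m (k + 1) - 1 : ℕ) : WithBot ℕ) ∧
              ∀ Q' : B, Q'.1 ∈ T.fibre (k + 1) R → Q' ≠ Q →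
                g'.eval (Q'.1.value (T.gen (le_refl (k + 1)))) = c Q') → g' = g) ∧
          c Q = g.eval (Q.1.value (T.gen (le_refl (k + 1)))) := by
    intro R hR hnodes c hc Q hQ
    rw [hC] at hc
    obtain ⟨f, hf, hcf⟩ := hc
    have hQR : T.Over hkk Q.1 R := hQ
    have hR1 := FunctionFieldSequence.degree_eq_one_of_over hQR (hQ1 _ (habove R hR hQ))
    rw [hV] at hf
    obtain ⟨g, hg, hgf⟩ := FunctionFieldSequence.exists_eval_of_mem_codeSpace hR1
      (fun w => FunctionFieldSequence.inclusion_mem_ring_of_mem_placesAbove hD (hb w) hR)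
      (fun j hj h1 => (FunctionFieldSequence.over_iff.1 hQR (T.gen hj)).1
        (hgen _ (habove R hR hQ) j (hj.trans hkk) h1))
      (fun Q' hQ' => Place.degree_eq_one_iff.1 (hQ1 Q' (habove R hR hQ')) _
        (hgen Q' (habove R hR hQ') (k + 1) le_rfl (by omega))) hf
    have hgc : ∀ Q' : B, Q'.1 ∈ T.fibre (k + 1) R →
        g.eval (Q'.1.value (T.gen (le_refl (k + 1)))) = c Q' := fun Q' hQ' =>
      (hgf Q'.1 hQ').unique (hcf Q')
    have hfin : (T.fibre (k + 1) R).Finite := hBfin.subset (habove R hR)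
    -- The m_i - 1 remaining nodes match the strict degree bound, so the interpolating polynomial is
    -- unique.
    have hcard : (T.fibre (k + 1) R \ {Q.1}).ncard = T.m (k + 1) - 1 := by
      rw [Set.ncard_sdiff_singleton_of_mem hQ, hfibre R hR]
    refine ⟨g, ⟨hg, fun Q' hQ' _ => hgc Q' hQ'⟩, fun g' hg' => ?_, (hgc Q hQ).symm⟩
    refine Polynomial.eq_of_degree_lt_of_eval_injOn hfin.sdiff (hnodes.mono Set.sdiff_subset)
      (by rw [hcard]; exact hg'.1) (by rw [hcard]; exact hg) fun Q' hQ' => ?_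
    have hQB : Q' ∈ B := hB ▸ habove R hR hQ'.1
    have h1 := hg'.2 ⟨Q', hQB⟩ hQ'.1 fun h => hQ'.2 (congrArg Subtype.val h)
    exact h1.trans (hgc ⟨Q', hQB⟩ hQ'.1).symm
  refine ⟨⟨hB ▸ hBfin, ?_⟩, ?_, ?_, ⟨?_, ?_, ?_⟩, hinterp, ?_, ?_⟩
  · rw [hn, hB, hBcard, hm, hs]
  · intro Q hQ
    rw [hB] at hQ
    exact ⟨hQ1 Q hQ, fun f hf => not_not.2 (hreg Q hQ f hf)⟩
  · intro f hf
    choose c hc using fun Q : B => hvals f hf Q.1 (hB ▸ Q.2)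
    exact ⟨c, hc, fun c' hc' => funext fun Q => (hc' Q).unique (hc Q)⟩
  · rw [hm', hs]
    exact (FunctionFieldSequence.finite_and_ncard_placesAbove (i := k) hrat
      (fun P hP => ((hsplit P hP).ncard_fibre (hrat P hP)).1)).2
  · exact fun R hR => ⟨hB ▸ habove R hR, hfibre R hR⟩
  · exact fun Q hQ => hpart Q (hB ▸ hQ)
  · intro hnodes Q
    obtain ⟨R, ⟨hR, hQR⟩, -⟩ := hpart Q.1 (hB ▸ Q.2)
    have hfin : (T.fibre (k + 1) R).Finite := hBfin.subset (habove R hR)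
    have hBf : Finite B := (hB ▸ hBfin : B.Finite).to_subtype
    have hfin' : {Q' : B | Q'.1 ∈ T.fibre (k + 1) R ∧ Q' ≠ Q}.Finite := Set.toFinite _
    refine ⟨hfin'.toFinset, by simp, ?_, fun c hc c' hc' hcc => ?_⟩
    · have himage : Subtype.val '' {Q' : B | Q'.1 ∈ T.fibre (k + 1) R ∧ Q' ≠ Q} ⊆
          T.fibre (k + 1) R \ {Q.1} := by
        rintro _ ⟨Q', ⟨h1, h2⟩, rfl⟩
        exact ⟨h1, fun h => h2 (Subtype.ext h)⟩
      have h1 := Set.ncard_le_ncard himage hfin.sdiff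
      rw [Set.ncard_image_of_injective _ Subtype.val_injective,
        Set.ncard_sdiff_singleton_of_mem hQR, hfibre R hR,
        Set.ncard_eq_toFinset_card _ hfin'] at h1
      exact h1
    · obtain ⟨g, hg, hgu, hgQ⟩ := hinterp R hR (hnodes R hR) c hc Q hQR
      obtain ⟨g', hg', -, hgQ'⟩ := hinterp R hR (hnodes R hR) c' hc' Q hQR
      -- As c and c' agree at the other places of the fibre, g' also solves the interpolation
      -- problem of c.
      have h1 : g' = g := hgu g' ⟨hg'.1, fun Q' hQ' hne => (hg'.2 Q' hQ' hne).trans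
        (hcc Q' (hfin'.mem_toFinset.2 ⟨hQ', hne⟩)).symm⟩
      rw [hgQ, hgQ', h1]
  · intro hd
    have hDfin := PlaceDivisor.finrank_riemannRochSpace (T.transcendental_gen (le_refl 0))
      T.mem_adjoin_gen_zero D
    have hzeros : ∀ f ∈ V, f ≠ 0 →
        ({Q | Q ∈ B ∧ Q.HasValue f 0}.ncard : ℤ) ≤ (n : ℤ) - d₀ := by
      intro f hf hf0
      rw [hV] at hf
      have hfin : {Q | Q ∈ B ∧ Q.HasValue f 0}.Finite :=
        (hB ▸ hBfin : B.Finite).subset fun Q hQ => hQ.1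
      have h1 := FunctionFieldSequence.card_zeros_codeSpace_le hb hrat hD hf0 hf hfin.toFinset
        fun Q hQ => by
          have := hfin.mem_toFinset.1 hQ
          exact ⟨this.2, hB ▸ this.1⟩
      rw [← Set.ncard_eq_toFinset_card _ hfin, ← hm, ← hl] at h1
      rw [hd₀, Nat.add_sub_cancel]
      linarith
    have hBn : B.ncard = n := hn.symm
    have hBfin' : B.Finite := hB ▸ hBfin
    have hdim : Module.finrank K C =
        Module.finrank K D.riemannRochSpace * ((T.m (k + 1) - 1) * m') := by
      have := hDfin.1
      rw [hC, finrank_evalCode (fun f hf Q hQ => hvals f hf Q (hB ▸ hQ)) fun f hf hz => ?_, hV,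
        (T.finrank_codeSpace k b).2, hm']
      · rfl
      -- A nonzero function vanishing on all of B would have n zeros, more than the n - d₀ allowed.
      · by_contra hf0
        have h1 := hzeros f hf hf0
        have h2 : {Q | Q ∈ B ∧ Q.HasValue f 0} = B :=
          Set.ext fun Q => ⟨fun h => h.1, fun h => ⟨h, hz Q h⟩⟩
        rw [h2, hBn] at h1
        linarith
    refine ⟨hdim, ?_, fun hC0 => le_minDistance hC0 fun c hc hc0 => ?_⟩
    -- ℓ(D) is the maximum of l + 1 and 0, and the other factor is nonnegative.
    · rw [hdim, hDfin.2, hl]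
      push_cast [Nat.cast_sub (by omega : 1 ≤ T.m (k + 1))]
      refine mul_le_mul_of_nonneg_right (Int.self_le_toNat _) (mul_nonneg ?_ (Nat.cast_nonneg _))
      have : (2 : ℤ) ≤ T.m (k + 1) := by exact_mod_cast hmk
      linarith
    · rw [hC] at hc
      obtain ⟨f, hf, hcf⟩ := hc
      have hf0 : f ≠ 0 := by
        rintro rfl
        exact hc0 (funext fun Q => (hcf Q).unique (by simp [Place.hasValue_iff]))
      have h1 := hzeros f hf hf0
      have h2 := wordWeight_add_ncard_zeros hBfin' hcf
      rw [hBn] at h2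
      have h3 : (wordWeight c : ℤ) + ({Q | Q ∈ B ∧ Q.HasValue f 0}.ncard : ℤ) = n := by
        exact_mod_cast h2
      linarith
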